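/- Let $K>0$, $\alpha\ge 0$, $\beta>0$ and $d\in\mathbb N$. Let $J=(J(t))_{t\ge0}$ be a continuous-time Markov chain (càdlàg, not necessarily irreducible) on $\{1,\dots,d\}$ with transition rate matrix $Q$. Let $Y_1,\dots,Y_d$ be càdlàg Lévy processes without negative jumps (subordinators are allowed), and let $B_{ij}$ be non-negative random variables. Let $Y$ be the spectrally-positive Markov additive process driven by these ingredients: $Y(0)=0$; while $J$ is in state $i$, $Y$ evolves by the increments of $Y_i$; at each transition of $J$ from $i$ to $j\ne i$, $Y$ in addition jumps upward by a fresh independent copy of $B_{ij}$. Let $T_\beta$ be exponentially distributed with parameter $\beta$. The chain $J$, the processes $Y_i$, the jump sizes and $T_\beta$ are all independent. Write $\mathbb P_i,\mathbb E_i$ for probability and expectation given $J(0)=i$. For $x\in[0,K]$ let $V=V^{x}$ be the two-sided Skorokhod reflection of $x+Y$ at $0$ and $K$: $V(t)=x+Y(t)+U^-(t)-U^+(t)\in[0,K]$ for all $t\ge0$, where $U^\pm$ are non-decreasing, right-continuous and null at $0$, and $U^-$ (respectively $U^+$) increases only when $V=0$ (respectively $V=K$). For $u\ge0$ put $$\sigma(u)=\inf\{t\ge0:-Y(t)>u\},\qquad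 \tau(u)=\inf\{t\ge0:Y(t)>u\}\qquad(\inf\emptyset=\infty).$$ For $x\in[0,K]$ define the $d\times d$ matrices with entries $$\chi_{ij}(x)=\mathbb E_i\big(e^{-\alpha V^{x}(T_\beta)}\mathbf 1_{\{J(T_\beta)=j\}}\big),$$ $$\delta_{-,ij}(x)=\mathbb P_i\big(\sigma(x)\le\min\{\tau(K-x),T_\beta\},\ J(\sigma(x))=j\big),$$ $$\delta_{+,ij}(x)=\mathbb P_i\big(\tau(K-x)\le\min\{\sigma(x),T_\beta\},\ J(\tau(K-x))=j\big),$$ $$\delta_{\star,ij}(x)=e^{-\alpha x}\,\mathbb E_i\big(e^{-\alpha Y(T_\beta)}\mathbf 1_{\{T_\beta\le\min\{\sigma(x),\tau(K-x)\},\ J(T_\beta)=j\}}\big).$$ Then, for every $x\in[0,K]$, $$\boldsymbol\chi(x)=\boldsymbol\delta_-(x)\,\boldsymbol\chi(0)+\boldsymbol\delta_+(x)\,\boldsymbol\chi(K)+\boldsymbol\delta_\star(x).$$ -/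

import Mathlib

open MeasureTheory ProbabilityTheory Filter Set
open scoped NNReal ENNReal Topology

namespace MAPQueue

noncomputable section

/-! ### Paths and first-passage times -/

/-- Right-continuous paths with left limits, on the time axis `[0, ∞)`. -/
def IsCadlag {E : Type*} [TopologicalSpace E] (f : ℝ≥0 → E) : Prop :=
  (∀ t, ContinuousWithinAt f (Ici t) t) ∧ ∀ t, ∃ l, Tendsto f (𝓝[<] t) (𝓝 l)

/-- The infimum of a set of times; it is `∞` for the empty set. -/
def firstTime (S : Set ℝ≥0) : ℝ≥0∞ := ⨅ t ∈ S, (t : ℝ≥0∞)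

/-- `σ(u) = inf {t ≥ 0 : -y(t) > u}`. -/
def dropTime (y : ℝ≥0 → ℝ) (u : ℝ) : ℝ≥0∞ := firstTime {t | -y t > u}

/-- `τ(u) = inf {t ≥ 0 : y(t) > u}`. -/
def exceedTime (y : ℝ≥0 → ℝ) (u : ℝ) : ℝ≥0∞ := firstTime {t | y t > u}

/-! ### The free path, built from its ingredients -/

/-- The successive jump times `S₀ = 0 < S₁ < S₂ < ⋯` of a path `j` of the background process
(`∞` from the moment on that there are no further jumps). -/
def jumpTime {d : ℕ} (j : ℝ≥0 → Fin d) : ℕ → ℝ≥0∞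
  | 0 => 0
  | n + 1 => firstTime {t | jumpTime j n < t ∧ j t ≠ j (jumpTime j n).toNNReal}

/-- The `n`-th state visited by `j` (meaningful when the `n`-th jump time is finite). -/
def visited {d : ℕ} (j : ℝ≥0 → Fin d) (n : ℕ) : Fin d := j (jumpTime j n).toNNReal

/-- The free path: during the `n`-th sojourn `[S_n, S_{n+1})`, spent in state `i`, it moves by the
increments of the path `l i`; at the jump at time `S_{n+1}`, from state `i` to state `k`, the
amount `b n i k` is added. For a càdlàg path `j` the sum has finitely many nonzero terms. -/
def freePath {d : ℕ} (j : ℝ≥0 → Fin d) (l : Fin d → ℝ≥0 → ℝ) (b : ℕ → Fin d → Fin d → ℝ)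
    (t : ℝ≥0) : ℝ :=
  ∑' n : ℕ,
    ((l (visited j n) (min (jumpTime j (n + 1)) t).toNNReal
        - l (visited j n) (min (jumpTime j n) t).toNNReal)
      + {s : ℝ≥0∞ | s ≤ t}.indicator (fun _ => b n (visited j n) (visited j (n + 1)))
          (jumpTime j (n + 1)))

/-! ### Two-sided Skorokhod reflection -/

/-- `v` is the reflection of `x + y` at `0` and `K`: there are non-decreasing right-continuous
regulators, null at time `0`, with `v = x + y + U⁻ - U⁺` in `[0, K]`, such that `U⁻` increases
only when `v` is at `0` and `U⁺` only when `v` is at `K`. -/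
def IsDoublyReflected (K x : ℝ) (y v : ℝ≥0 → ℝ) : Prop :=
  ∃ Um Up : StieltjesFunction ℝ≥0,
    Um 0 = 0 ∧ Up 0 = 0 ∧
    (∀ t, v t = x + y t + Um t - Up t) ∧
    (∀ t, v t ∈ Icc 0 K) ∧
    Um.measure {t | v t ≠ 0} = 0 ∧
    Up.measure {t | v t ≠ K} = 0

/-! ### The stochastic ingredients -/

section Stochastic

variable {Ω : Type*} [MeasurableSpace Ω]

/-- The σ-algebra generated by a process up to time `s`. -/
abbrev pastSigma {E : Type*} [mE : MeasurableSpace E] (X : ℝ≥0 → Ω → E) (s : ℝ≥0) :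
    MeasurableSpace Ω :=
  ⨆ u ∈ Iic s, mE.comap (X u)

/-- The σ-algebra generated by a whole process. -/
abbrev processSigma {E : Type*} [mE : MeasurableSpace E] (X : ℝ≥0 → Ω → E) : MeasurableSpace Ω :=
  ⨆ u, mE.comap (X u)

/-- Transition rate matrices: non-negative off-diagonal entries, zero row sums. -/
def IsRateMatrix {d : ℕ} (Q : Matrix (Fin d) (Fin d) ℝ) : Prop :=
  (∀ i j, i ≠ j → 0 ≤ Q i j) ∧ ∀ i, ∑ j, Q i j = 0

/-- `J` is a (time-homogeneous, càdlàg) continuous-time Markov chain with transition rate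
matrix `Q`. -/
structure IsMarkovChain {d : ℕ} (P : Measure Ω) (Q : Matrix (Fin d) (Fin d) ℝ)
    (J : ℝ≥0 → Ω → Fin d) : Prop where
  rate : IsRateMatrix Q
  measurable : ∀ t, Measurable (J t)
  cadlag : ∀ ω, IsCadlag fun t => J t ω
  markov : ∀ (s t : ℝ≥0) (A : Set Ω), MeasurableSet[pastSigma J s] A → ∀ i j : Fin d,
    P.real (A ∩ {ω | J s ω = i} ∩ {ω | J (s + t) ω = j})
      = P.real (A ∩ {ω | J s ω = i}) * NormedSpace.exp ((t : ℝ) • Q) i j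

/-- `X` is a Lévy process without negative jumps. -/
structure IsSpectrallyPositiveLevy (P : Measure Ω) (X : ℝ≥0 → Ω → ℝ) : Prop where
  measurable : ∀ t, Measurable (X t)
  zero : ∀ ω, X 0 ω = 0
  cadlag : ∀ ω, IsCadlag fun t => X t ω
  indep_increments : HasIndepIncrements X P
  stationary_increments : ∀ s t : ℝ≥0,
    IdentDistrib (fun ω => X (s + t) ω - X s ω) (X t) P P
  no_negative_jumps : ∀ ω t, Function.leftLim (fun s => X s ω) t ≤ X t ω

/-- The independent sources of randomness of the model. -/
inductive Source (d : ℕ) : Type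
  | chain : Source d
  | levy (i : Fin d) : Source d
  | job (n : ℕ) (i j : Fin d) : Source d
  | clock : Source d

/-- The information carried by each source. -/
abbrev sourceSigma {d : ℕ} (J : ℝ≥0 → Ω → Fin d) (L : Fin d → ℝ≥0 → Ω → ℝ)
    (B : ℕ → Fin d → Fin d → Ω → ℝ) (T : Ω → ℝ≥0) : Source d → MeasurableSpace Ω
  | .chain => processSigma J
  | .levy i => processSigma (L i)
  | .job n i j => MeasurableSpace.comap (B n i j) inferInstance
  | .clock => MeasurableSpace.comap T inferInstance

/-- The ingredients of the model: the background Markov chain `J` with rate matrix `Q`, the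
spectrally-positive Lévy processes `L i`, the non-negative job sizes `B n i j` (distributed as
`B 0 i j` for every `n`), and the exponential killing time `T` of rate `β`, all independent.
The initial law of `J` charges every state, so that one can condition on `J 0 = i`. -/
structure IsModel {d : ℕ} (P : Measure Ω) (Q : Matrix (Fin d) (Fin d) ℝ) (β : ℝ)
    (J : ℝ≥0 → Ω → Fin d) (L : Fin d → ℝ≥0 → Ω → ℝ)
    (B : ℕ → Fin d → Fin d → Ω → ℝ) (T : Ω → ℝ≥0) : Prop where
  chain : IsMarkovChain P Q J
  start : ∀ i, P {ω | J 0 ω = i} ≠ 0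
  levy : ∀ i, IsSpectrallyPositiveLevy P (L i)
  job_measurable : ∀ n i j, Measurable (B n i j)
  job_nonneg : ∀ n i j ω, 0 ≤ B n i j ω
  job_law : ∀ n i j, IdentDistrib (B n i j) (B 0 i j) P P
  clock_measurable : Measurable T
  clock_law : P.map (fun ω => (T ω : ℝ)) = expMeasure β
  indep : iIndep (sourceSigma J L B T) P

/-- The law `ℙ_i`: conditioning on `J(0) = i`. -/
def startAt {d : ℕ} (P : Measure Ω) (J : ℝ≥0 → Ω → Fin d) (i : Fin d) : Measure Ω :=
  cond P {ω | J 0 ω = i}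

/-- The free process `Y`, a spectrally-positive Markov additive process with `Y(0) = 0`. -/
def freeProcess {d : ℕ} (J : ℝ≥0 → Ω → Fin d) (L : Fin d → ℝ≥0 → Ω → ℝ)
    (B : ℕ → Fin d → Fin d → Ω → ℝ) (t : ℝ≥0) (ω : Ω) : ℝ :=
  freePath (fun s => J s ω) (fun i s => L i s ω) (fun n i j => B n i j ω) t

/-! ### The matrices -/

/-- `χ_{ij} = 𝔼_i (e^{-α V(T)} 1{J(T) = j})`, for a workload process `V`. -/
def chi {d : ℕ} (P : Measure Ω) (J : ℝ≥0 → Ω → Fin d) (T : Ω → ℝ≥0) (α : ℝ)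
    (V : ℝ≥0 → Ω → ℝ) : Matrix (Fin d) (Fin d) ℝ :=
  Matrix.of fun i j =>
    ∫ ω, {ω | J (T ω) ω = j}.indicator (fun ω => Real.exp (-α * V (T ω) ω)) ω ∂(startAt P J i)

/-- `δ_{-,ij}(u₋, u₊) = ℙ_i (σ(u₋) ≤ min {τ(u₊), T}, J(σ(u₋)) = j)`. -/
def deltaMinus {d : ℕ} (P : Measure Ω) (J : ℝ≥0 → Ω → Fin d) (T : Ω → ℝ≥0)
    (Y : ℝ≥0 → Ω → ℝ) (um up : ℝ) : Matrix (Fin d) (Fin d) ℝ :=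
  Matrix.of fun i j => (startAt P J i).real
    {ω | dropTime (Y · ω) um ≤ min (exceedTime (Y · ω) up) (T ω) ∧
      J (dropTime (Y · ω) um).toNNReal ω = j}

/-- `δ_{+,ij}(u₋, u₊) = ℙ_i (τ(u₊) ≤ min {σ(u₋), T}, J(τ(u₊)) = j)`. -/
def deltaPlus {d : ℕ} (P : Measure Ω) (J : ℝ≥0 → Ω → Fin d) (T : Ω → ℝ≥0)
    (Y : ℝ≥0 → Ω → ℝ) (um up : ℝ) : Matrix (Fin d) (Fin d) ℝ :=
  Matrix.of fun i j => (startAt P J i).real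
    {ω | exceedTime (Y · ω) up ≤ min (dropTime (Y · ω) um) (T ω) ∧
      J (exceedTime (Y · ω) up).toNNReal ω = j}

/-- `δ_{⋆,ij}(x) = e^{-α x} 𝔼_i (e^{-α Y(T)} 1{T ≤ min {σ(x), τ(K - x)}, J(T) = j})`. -/
def deltaStar {d : ℕ} (P : Measure Ω) (J : ℝ≥0 → Ω → Fin d) (T : Ω → ℝ≥0)
    (Y : ℝ≥0 → Ω → ℝ) (α K x : ℝ) : Matrix (Fin d) (Fin d) ℝ :=
  Matrix.of fun i j => Real.exp (-α * x) *
    ∫ ω, {ω | (T ω : ℝ≥0∞) ≤ min (dropTime (Y · ω) x) (exceedTime (Y · ω) (K - x)) ∧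
        J (T ω) ω = j}.indicator (fun ω => Real.exp (-α * Y (T ω) ω)) ω ∂(startAt P J i)

end Stochastic

end

end MAPQueue

open MAPQueue

namespace MAPQueue

/-! ### Two-sided reflection of deterministic paths -/

/-! Let ρ be the first time at which the free path x + Y leaves [0, K]. If T comes before ρ, the
regulators have not acted, V(T) = x + Y(T), and the reward is the one in `deltaStar`. If the path
leaves through 0 before T, it does so without undershoot because it has no downward jumps, so V(ρ) =
0. If it leaves through K it may overshoot, but the regulator removes the excess and V(ρ) = K. Given
J(ρ) = k, what follows is a fresh copy of the model started in state k from level 0 or K, the clock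
being restarted by its lack of memory; summing over k produces the matrix products. Ties T = ρ are
null because T has no atoms and is independent of ρ, and the two exits exclude each other because K
> 0.

Pathwise, everything rests on two facts about the net regulator φ - v = U⁺ - U⁻: it does not fall
below c while φ ≥ c (`IsReflection.le_of_le`), and it passes c upwards only while v = K
(`IsReflection.exists_at_upper`). They give the value of v at the exit, and also an explicit formula
for v in terms of countably many values of φ (`IsReflection.eq_reflected`). Uniqueness and
measurability of the reflection come from this formula, and comparing levels gives Lipschitz
dependence on the starting point (`IsReflection.abs_sub_le`).

The strong Markov property is proved from the ingredients. At a fixed time s, and for a fixed number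
m of jumps so far, the ingredients split into a past and a future; `IsModel.lintegral_past_future`
shows that the future is independent of the past and distributed as a fresh copy. Since V after s is
the reflection of the future free path started from V(s) (`reflection_shift`), this yields the
Markov property at s (`IsModel.markov`). The exit time is approached from the right by grid times,
which take countably many values, and right continuity together with continuity of `value` in the
level allows passing to the limit (`IsModel.strong_markov`). `exit_decomposition` sorts the outcome
by the end of the interval, and `IsModel.value_decomposition` is the identity in terms of
expectations. -/

/-- `U` is non-decreasing and increases only at times when `v` is at level `b`. -/
structure GrowsOnlyAt (U v : ℝ≥0 → ℝ) (b : ℝ) : Prop where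
  mono : Monotone U
  eq_of_Ioc : ∀ a c, a ≤ c → (∀ u ∈ Ioc a c, v u ≠ b) → U c = U a
  eq_of_Icc : ∀ a c, 0 < a → a ≤ c → (∀ u ∈ Icc a c, v u ≠ b) →
    ∀ ε > 0, ∃ a' < a, U c - U a' < ε

/-- `v` is the reflection of `φ` at `0` and `K` with regulators `Um` and `Up`. -/
structure IsReflection (K : ℝ) (φ v Um Up : ℝ≥0 → ℝ) : Prop where
  lower : GrowsOnlyAt Um v 0
  upper : GrowsOnlyAt Up v K
  lower_zero : Um 0 = 0
  upper_zero : Up 0 = 0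
  eq : ∀ t, v t = φ t + Um t - Up t
  mem : ∀ t, v t ∈ Icc 0 K

/-- An interval that avoids the level `b` is a null set of the Stieltjes measure, whose mass is `U c
- U a` on `Ioc a c` and `U c` minus the left limit at `a` on `Icc a c`. The condition `0 < a`
ensures that there are times to the left of `a`. -/
theorem growsOnlyAt_stieltjes (U : StieltjesFunction ℝ≥0) {v : ℝ≥0 → ℝ} {b : ℝ}
    (h : U.measure {t | v t ≠ b} = 0) : GrowsOnlyAt U v b where
  mono := U.mono
  eq_of_Ioc a c hac hu := by
    have h0 : U.measure (Ioc a c) = 0 := measure_mono_null (fun u hu' => hu u hu') h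
    rw [StieltjesFunction.measure_Ioc, ENNReal.ofReal_eq_zero] at h0
    exact le_antisymm (by linarith) (U.mono hac)
  eq_of_Icc a c ha hac hu ε hε := by
    have h0 : U.measure (Icc a c) = 0 := measure_mono_null (fun u hu' => hu u hu') h
    rw [StieltjesFunction.measure_Icc, ENNReal.ofReal_eq_zero] at h0
    have hne : (𝓝[<] a).NeBot := nhdsLT_neBot_of_exists_lt ⟨0, ha⟩
    have ht := U.mono.tendsto_leftLim a
    have hev : ∀ᶠ a' in 𝓝[<] a, U c - U a' < ε :=
      (tendsto_const_nhds.sub ht).eventually (gt_mem_nhds (by linarith))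
    obtain ⟨a', h1, h2⟩ := (hev.and self_mem_nhdsWithin).exists
    exact ⟨a', h2, h1⟩

theorem IsDoublyReflected.exists_isReflection {K x : ℝ} {y v : ℝ≥0 → ℝ}
    (h : IsDoublyReflected K x y v) : ∃ Um Up, IsReflection K (fun t => x + y t) v Um Up := by
  obtain ⟨Um, Up, h1, h2, h3, h4, h5, h6⟩ := h
  exact ⟨Um, Up, growsOnlyAt_stieltjes Um h5, growsOnlyAt_stieltjes Up h6, h1, h2, h3, h4⟩

theorem IsDoublyReflected.rightContinuous {K x : ℝ} {y v : ℝ≥0 → ℝ}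
    (h : IsDoublyReflected K x y v) (hy : ∀ t, ContinuousWithinAt y (Ici t) t) (t : ℝ≥0) :
    ContinuousWithinAt v (Ici t) t := by
  obtain ⟨Um, Up, -, -, h3, -⟩ := h
  have : v = fun t => x + y t + Um t - Up t := funext h3
  rw [this]
  exact (((continuousWithinAt_const).add (hy t)).add (Um.right_continuous t)).sub
    (Up.right_continuous t)

namespace IsReflection

variable {K : ℝ} {φ v Um Up : ℝ≥0 → ℝ}

theorem initial_le (h : IsReflection K φ v Um Up) : φ 0 - v 0 = 0 := by
  rw [h.eq, h.lower_zero, h.upper_zero]; ring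

/-- As long as the path stays above the level `c`, the net regulator does not fall below `c`. -/
theorem le_of_le (h : IsReflection K φ v Um Up) {s t : ℝ≥0} {c : ℝ} (hst : s ≤ t)
    (hs : c ≤ φ s - v s) (hφ : ∀ u ∈ Icc s t, c ≤ φ u) : c ≤ φ t - v t := by
  by_contra! hlt
  -- Consider the last time at which the net regulator was at least `c`. After it, `v > φ - c ≥ 0`,
  -- so `Um` is frozen, and `Up` can only raise the net regulator.
  set A : Set ℝ≥0 := {u | u ∈ Icc s t ∧ c ≤ φ u - v u}
  have hsA : s ∈ A := ⟨⟨le_rfl, hst⟩, hs⟩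
  have hbdd : BddAbove A := ⟨t, fun u hu => hu.1.2⟩
  set q := sSup A
  have hsq : s ≤ q := le_csSup hbdd hsA
  have hqt : q ≤ t := csSup_le ⟨s, hsA⟩ fun u hu => hu.1.2
  have hafter : ∀ u ∈ Ioc q t, v u ≠ 0 := by
    intro u hu h0
    have hnot : u ∉ A := fun huA => absurd (le_csSup hbdd huA) (not_le.2 hu.1)
    have : φ u - v u < c := by
      by_contra! hc
      exact hnot ⟨⟨hsq.trans hu.1.le, hu.2⟩, hc⟩
    have := hφ u ⟨hsq.trans hu.1.le, hu.2⟩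
    linarith
  have et := h.eq t
  by_cases hq : c ≤ φ q - v q
  · have h1 := h.lower.eq_of_Ioc q t hqt hafter
    have h2 := h.upper.mono hqt
    have eq := h.eq q
    linarith
  -- The supremum is not attained. Then `v` avoids `0` at `q` too, so `Um` grows by less than `c -
  -- (φ t - v t)` from some time just before `q`, and there are points of `A` after that time.
  · have hsq' : s < q := lt_of_le_of_ne hsq fun e => hq (e ▸ hs)
    have hIcc : ∀ u ∈ Icc q t, v u ≠ 0 := by
      intro u hu h0
      rcases eq_or_lt_of_le hu.1 with e | e
      · have := hφ q ⟨hsq, hqt⟩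
        rw [← e] at h0
        rw [h0] at hq
        exact hq (by linarith)
      · exact hafter u ⟨e, hu.2⟩ h0
    obtain ⟨a', ha', hlt'⟩ := h.lower.eq_of_Icc q t (pos_of_gt hsq') hqt hIcc
      (c - (φ t - v t)) (by linarith)
    obtain ⟨u, huA, hu⟩ := exists_lt_of_lt_csSup ⟨s, hsA⟩ ha'
    have h1 := h.lower.mono hu.le
    have h2 := h.upper.mono huA.1.2
    have h3 := huA.2
    have eu := h.eq u
    linarith

/-- The net regulator can pass the level `c` only while the reflected path is at `K`. -/
theorem exists_at_upper (h : IsReflection K φ v Um Up) {s t : ℝ≥0} {c : ℝ} (hst : s ≤ t)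
    (hs : φ s - v s ≤ c) (ht : c < φ t - v t) :
    ∃ r ∈ Icc s t, v r = K ∧ ∀ u ∈ Icc r t, c < φ u - v u := by
  -- After the last time with net regulator at most `c`, only growth of `Up` can raise it; hence `v`
  -- visits `K` after `q`, or at `q` itself if `q ∉ A`.
  set A : Set ℝ≥0 := {u | u ∈ Icc s t ∧ φ u - v u ≤ c}
  have hsA : s ∈ A := ⟨⟨le_rfl, hst⟩, hs⟩
  have hbdd : BddAbove A := ⟨t, fun u hu => hu.1.2⟩
  set q := sSup A
  have hsq : s ≤ q := le_csSup hbdd hsA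
  have hqt : q ≤ t := csSup_le ⟨s, hsA⟩ fun u hu => hu.1.2
  have hafter : ∀ u ∈ Ioc q t, c < φ u - v u := by
    intro u hu
    by_contra! hc
    exact absurd (le_csSup hbdd ⟨⟨hsq.trans hu.1.le, hu.2⟩, hc⟩) (not_le.2 hu.1)
  by_cases hq : φ q - v q ≤ c
  · by_contra! hcon
    have h1 := h.upper.eq_of_Ioc q t hqt fun u hu hK => by
      obtain ⟨w, hw, hw'⟩ := hcon u ⟨hsq.trans hu.1.le, hu.2⟩ hK
      exact absurd (hafter w ⟨hu.1.trans_le hw.1, hw.2⟩) (not_lt.2 hw')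
    have h2 := h.lower.mono hqt
    have := h.eq q
    have := h.eq t
    linarith
  · have hsq' : s < q := lt_of_le_of_ne hsq fun e => hq (e ▸ hs)
    refine ⟨q, ⟨hsq, hqt⟩, ?_, fun u hu => ?_⟩
    · by_contra hK
      -- On the degenerate interval `Icc q q` this says that `Up` does not jump at `q`.
      obtain ⟨a', ha', hlt'⟩ := h.upper.eq_of_Icc q q (pos_of_gt hsq') le_rfl
        (fun u hu => by rwa [le_antisymm hu.2 hu.1]) (φ q - v q - c) (by linarith)
      obtain ⟨u, huA, hu⟩ := exists_lt_of_lt_csSup ⟨s, hsA⟩ ha'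
      have h1 := h.upper.mono hu.le
      have h2 := h.lower.mono (le_csSup hbdd huA)
      have h3 := huA.2
      have := h.eq u
      have := h.eq q
      linarith
    · rcases eq_or_lt_of_le hu.1 with e | e
      · rw [← e]; linarith
      · exact hafter u ⟨e, hu.2⟩

/-- The reflection restarts afresh at time `s`. -/
theorem shift (h : IsReflection K φ v Um Up) (s : ℝ≥0) :
    IsReflection K (fun t => v s + (φ (s + t) - φ s)) (fun t => v (s + t))
      (fun t => Um (s + t) - Um s) (fun t => Up (s + t) - Up s) := by
  have key : ∀ {U : ℝ≥0 → ℝ} {b : ℝ}, GrowsOnlyAt U v b →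
      GrowsOnlyAt (fun t => U (s + t) - U s) (fun t => v (s + t)) b := by
    intro U b hU
    refine ⟨fun a c hac => sub_le_sub_right (hU.mono (by gcongr)) _,
      fun a c hac hu => ?_, fun a c ha hac hu ε hε => ?_⟩
    · rw [hU.eq_of_Ioc (s + a) (s + c) (by gcongr) fun u hu' => ?_]
      have hsu : s ≤ u := le_self_add.trans hu'.1.le
      have := hu (u - s) ⟨lt_tsub_iff_left.2 hu'.1, tsub_le_iff_left.2 hu'.2⟩
      rwa [add_tsub_cancel_of_le hsu] at this
    · have hne : ∀ u ∈ Icc (s + a) (s + c), v u ≠ b := fun u hu' => by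
        have hsu : s ≤ u := le_self_add.trans hu'.1
        have := hu (u - s) ⟨le_tsub_of_add_le_left hu'.1, tsub_le_iff_left.2 hu'.2⟩
        rwa [add_tsub_cancel_of_le hsu] at this
      obtain ⟨a', ha', h'⟩ := hU.eq_of_Icc (s + a) (s + c) (by positivity) (by gcongr) hne ε hε
      -- `a'` may lie before `s`, where the shifted path has no time; by monotonicity it can be
      -- replaced with `max a' s`.
      refine ⟨max a' s - s, ?_, ?_⟩
      · rw [tsub_lt_iff_left (le_max_right _ _)]
        exact max_lt ha' (lt_add_of_pos_right s ha)
      · simp only [add_tsub_cancel_of_le (le_max_right a' s)]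
        have := hU.mono (le_max_left a' s)
        linarith
  refine ⟨key h.lower, key h.upper, by simp, by simp, fun t => ?_, fun t => h.mem _⟩
  have := h.eq (s + t)
  have := h.eq s
  linarith

/-- Up to the first exit from `[0, K]` the path is not modified. -/
theorem eq_of_mem (h : IsReflection K φ v Um Up) {t : ℝ≥0}
    (h0 : ∀ u ≤ t, 0 ≤ φ u) (hK : ∀ u ≤ t, φ u ≤ K) : v t = φ t := by
  have h1 : 0 ≤ φ t - v t :=
    h.le_of_le zero_le (h.initial_le).ge fun u hu => h0 u hu.2
  by_contra hne
  -- A positive net regulator would require a time `r` with `v r = K` and `φ r - v r > 0`, that is,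
  -- `φ r > K`.
  obtain ⟨r, hr, hrK, hr'⟩ := h.exists_at_upper (zero_le (a := t)) (h.initial_le).le
    (lt_of_le_of_ne h1 fun e => hne (by linarith))
  have := hr' r ⟨le_rfl, hr.2⟩
  have := hK r hr.2
  linarith

/-- At the first passage above `K` the reflected path is at `K`. -/
theorem eq_upper (h : IsReflection K φ v Um Up) {t : ℝ≥0} (h0 : ∀ u ≤ t, 0 ≤ φ u)
    (hK : ∀ u < t, φ u ≤ K) (ht : K ≤ φ t) : v t = K := by
  have h1 : 0 ≤ φ t - v t :=
    h.le_of_le zero_le (h.initial_le).ge fun u hu => h0 u hu.2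
  by_contra hne
  have hlt : v t < K := lt_of_le_of_ne (h.mem t).2 hne
  obtain ⟨r, hr, hrK, hr'⟩ := h.exists_at_upper (zero_le (a := t)) (h.initial_le).le
    (show 0 < φ t - v t by linarith)
  rcases eq_or_lt_of_le hr.2 with e | e
  · exact hne (e ▸ hrK)
  · have := hr' r ⟨le_rfl, hr.2⟩
    have := hK r e
    linarith

end IsReflection

/-! ### An explicit formula for the reflection -/

/-- A fixed countable dense sequence of times. -/
noncomputable def denseTime (n : ℕ) : ℝ≥0 := TopologicalSpace.denseSeq ℝ≥0 n

theorem exists_denseTime_mem {U : Set ℝ≥0} (hU : IsOpen U) (hne : U.Nonempty) :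
    ∃ n, denseTime n ∈ U :=
  (TopologicalSpace.denseRange_denseSeq ℝ≥0).exists_mem_open hU hne

theorem exists_denseTime_of_eventually {p : ℝ≥0 → Prop} {t : ℝ≥0} (h : ∀ᶠ u in 𝓝[>] t, p u) :
    ∃ n, t < denseTime n ∧ p (denseTime n) := by
  obtain ⟨b, hb, hsub⟩ := (mem_nhdsGT_iff_exists_Ioo_subset' (lt_add_one t)).1 h
  obtain ⟨n, hn⟩ := exists_denseTime_mem isOpen_Ioo (nonempty_Ioo.2 hb)
  exact ⟨n, hn.1, hsub hn⟩

/-- The levels that the net regulator `U⁺ - U⁻` has reached at time `t`. -/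
def regulatorLevels (K : ℝ) (φ : ℝ≥0 → ℝ) (t : ℝ≥0) : Set ℝ :=
  {c | (c ≤ 0 ∧ ∀ n, c ≤ φ (min (denseTime n) t)) ∨
    ∃ n, c ≤ φ (min (denseTime n) t) - K ∧
      ∀ m, denseTime n ≤ denseTime m → c ≤ φ (min (denseTime m) t)}

open Classical in
/-- The reflection of `φ` at `0` and `K`, as an explicit function of the path. -/
noncomputable def reflected (K : ℝ) (φ : ℝ≥0 → ℝ) (t : ℝ≥0) : ℝ :=
  φ t - (⨆ c : ℚ, if (c : ℝ) ∈ regulatorLevels K φ t then ((c : ℝ) : EReal) else ⊥).toReal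

/-- Right continuity carries a weak inequality from dense times to all times. Thanks to the
truncation at `t`, any dense time beyond `t` tests the endpoint; if `s > t`, that endpoint is all
that remains, hence `min s t`. -/
theorem le_of_forall_denseTime {φ : ℝ≥0 → ℝ} (hφ : ∀ t, ContinuousWithinAt φ (Ici t) t)
    {s t : ℝ≥0} {c : ℝ} (h : ∀ m, s ≤ denseTime m → c ≤ φ (min (denseTime m) t)) :
    ∀ u ∈ Icc (min s t) t, c ≤ φ u := by
  intro u hu
  rcases eq_or_lt_of_le hu.2 with rfl | hut
  · obtain ⟨n, hn⟩ := exists_denseTime_mem (isOpen_Ioi (a := max s u)) nonempty_Ioi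
    have := h n ((le_max_left _ _).trans (le_of_lt hn))
    rwa [min_eq_right ((le_max_right s u).trans (le_of_lt hn))] at this
  · have hsu : s ≤ u := by
      rcases min_le_iff.1 hu.1 with h1 | h1
      · exact h1
      · exact absurd h1 (not_le.2 hut)
    by_contra! hc
    have h1 : ∀ᶠ w in 𝓝[>] u, φ w < c :=
      ((hφ u).mono Ioi_subset_Ici_self).eventually (gt_mem_nhds hc)
    have h2 : ∀ᶠ w in 𝓝[>] u, w < t := by
      filter_upwards [Ioo_mem_nhdsGT hut] with w hw using hw.2
    obtain ⟨n, hn, h3, h4⟩ := exists_denseTime_of_eventually (h1.and h2)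
    have := h n (hsu.trans hn.le)
    rw [min_eq_left h4.le] at this
    linarith

/-- Both alternatives feed `le_of_le`: the net regulator vanishes at time `0`, and where `φ - K ≥ c`
it is at least `c` because `v ≤ K`. -/
theorem IsReflection.le_of_mem_levels {K : ℝ} {φ v Um Up : ℝ≥0 → ℝ}
    (h : IsReflection K φ v Um Up) (hφ : ∀ t, ContinuousWithinAt φ (Ici t) t) {t : ℝ≥0} {c : ℝ}
    (hc : c ∈ regulatorLevels K φ t) : c ≤ φ t - v t := by
  rcases hc with ⟨h0, hc⟩ | ⟨n, h0, hc⟩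
  · refine h.le_of_le zero_le (h.initial_le ▸ h0) fun u hu => ?_
    exact le_of_forall_denseTime hφ (s := 0) (t := t) (fun m _ => hc m) u (by simpa using hu)
  · refine h.le_of_le (min_le_right (denseTime n) t) ?_
      (le_of_forall_denseTime hφ hc)
    have := (h.mem (min (denseTime n) t)).2
    linarith

/-- If the net regulator was at most `c` at some time up to `t`, it passed `c` while `v = K`, where
`φ > K + c`; strictness leaves room to move to a dense time nearby. Otherwise it was above `c`
throughout, and `c < 0`. In both cases `φ ≥ φ - v` bounds the path from below. -/
theorem IsReflection.mem_levels_of_lt {K : ℝ} {φ v Um Up : ℝ≥0 → ℝ}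
    (h : IsReflection K φ v Um Up) (hφ : ∀ t, ContinuousWithinAt φ (Ici t) t) {t : ℝ≥0} {c : ℝ}
    (hc : c < φ t - v t) : c ∈ regulatorLevels K φ t := by
  have pos : ∀ u, φ u - v u ≤ φ u := fun u => by linarith [(h.mem u).1]
  have main : ∀ s ≤ t, φ s - v s ≤ c → c ∈ regulatorLevels K φ t := by
    intro s hs hsc
    obtain ⟨r, hr, hrK, hr'⟩ := h.exists_at_upper hs hsc hc
    have hcont : ContinuousWithinAt (fun u => φ (min u t)) (Ici r) r := by
      have e : min r t = r := min_eq_left hr.2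
      refine ContinuousWithinAt.comp (t := Ici r) (g := φ) (f := fun u => min u t) ?_
        (by fun_prop) fun u hu => le_min hu hr.2
      simpa only [e] using hφ r
    have hlt : c + K < φ (min r t) := by
      rw [min_eq_left hr.2]
      have := hr' r ⟨le_rfl, hr.2⟩
      linarith
    obtain ⟨n, hn, hn'⟩ := exists_denseTime_of_eventually
      ((hcont.mono Ioi_subset_Ici_self).eventually (lt_mem_nhds hlt))
    refine Or.inr ⟨n, by linarith, fun m hm => ?_⟩
    have := hr' (min (denseTime m) t) ⟨le_min (hn.le.trans hm) hr.2, min_le_right _ _⟩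
    linarith [pos (min (denseTime m) t)]
  by_cases h0 : 0 ≤ c
  · exact main 0 zero_le (h.initial_le.trans_le h0)
  by_cases h1 : ∃ s ≤ t, φ s - v s ≤ c
  · obtain ⟨s, hs, hs'⟩ := h1
    exact main s hs hs'
  · push Not at h0 h1
    exact Or.inl ⟨h0.le, fun n => ((h1 _ (min_le_right _ _)).trans_le (pos _)).le⟩

/-- The two preceding lemmas identify the net regulator as the supremum of its rational levels. As
the right-hand side mentions neither `Um` nor `Up`, the reflection is unique. -/
theorem IsReflection.eq_reflected {K : ℝ} {φ v Um Up : ℝ≥0 → ℝ}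
    (h : IsReflection K φ v Um Up) (hφ : ∀ t, ContinuousWithinAt φ (Ici t) t) (t : ℝ≥0) :
    v t = reflected K φ t := by
  classical
  have key : (⨆ c : ℚ, if (c : ℝ) ∈ regulatorLevels K φ t then ((c : ℝ) : EReal) else ⊥)
      = ((φ t - v t : ℝ) : EReal) := by
    apply le_antisymm
    · refine iSup_le fun c => ?_
      split_ifs with hc
      · exact EReal.coe_le_coe_iff.2 (h.le_of_mem_levels hφ hc)
      · exact bot_le
    · refine le_of_forall_lt fun b hb => ?_
      obtain ⟨c, hc1, hc2⟩ := EReal.lt_iff_exists_rat_btwn.1 hb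
      have hc2' : (c : ℝ) < φ t - v t := EReal.coe_lt_coe_iff.1 hc2
      refine hc1.trans_le (le_iSup_of_le c ?_)
      rw [if_pos (h.mem_levels_of_lt hφ hc2')]
  unfold reflected
  rw [key, EReal.toReal_coe]
  ring

/-- The reflection depends in a Lipschitz way on the starting point. -/
theorem IsReflection.abs_sub_le {K x x' : ℝ} {y v v' Um Up Um' Up' : ℝ≥0 → ℝ}
    (h : IsReflection K (fun t => x + y t) v Um Up)
    (h' : IsReflection K (fun t => x' + y t) v' Um' Up')
    (hy : ∀ t, ContinuousWithinAt y (Ici t) t) (t : ℝ≥0) : |v t - v' t| ≤ 2 * |x - x'| := by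
  have hφ : ∀ z : ℝ, ∀ t, ContinuousWithinAt (fun t => z + y t) (Ici t) t := fun z t =>
    continuousWithinAt_const.add (hy t)
  -- A level for the path from `x`, lowered by `|x - x'|`, is a level for the path from `x'`. So the
  -- net regulators differ by at most `|x - x'|`; the starting points account for the second `|x -
  -- x'|`.
  have key : ∀ {x x' : ℝ} {v v' Um Up Um' Up' : ℝ≥0 → ℝ},
      IsReflection K (fun t => x + y t) v Um Up → IsReflection K (fun t => x' + y t) v' Um' Up' →
      (x + y t - v t) - |x - x'| ≤ x' + y t - v' t := by
    intro x x' v v' Um Up Um' Up' h h'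
    have hx : x - x' ≤ |x - x'| := le_abs_self _
    refine le_of_forall_lt fun c hc => ?_
    obtain ⟨c', hc1, hc2⟩ := exists_between (show c + |x - x'| < x + y t - v t by linarith)
    have hm := h.mem_levels_of_lt (hφ x) hc2
    have hm' : c' - |x - x'| ∈ regulatorLevels K (fun t => x' + y t) t := by
      rcases hm with ⟨h0, hc⟩ | ⟨n, h0, hc⟩
      · refine Or.inl ⟨by linarith [abs_nonneg (x - x')], fun n => ?_⟩
        linarith [hc n]
      · refine Or.inr ⟨n, by linarith, fun m hm => ?_⟩
        linarith [hc m hm]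
    have := h'.le_of_mem_levels (hφ x') hm'
    linarith
  have h1 := key h h'
  have h2 := key h' h
  rw [abs_sub_comm x' x] at h2
  have h3 := abs_le.1 (le_refl |x - x'|)
  rw [abs_le]
  constructor <;> linarith

/-! ### Jump times of a path with values in a finite set -/

theorem firstTime_lt_iff {S : Set ℝ≥0} {a : ℝ≥0∞} : firstTime S < a ↔ ∃ t ∈ S, (t : ℝ≥0∞) < a := by
  simp [firstTime, iInf_lt_iff]

theorem firstTime_le {S : Set ℝ≥0} {t : ℝ≥0} (ht : t ∈ S) : firstTime S ≤ t :=
  iInf₂_le t ht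

theorem le_firstTime_iff {S : Set ℝ≥0} {a : ℝ≥0∞} :
    a ≤ firstTime S ↔ ∀ t ∈ S, a ≤ (t : ℝ≥0∞) := by
  simp [firstTime]

theorem add_firstTime {A B : Set ℝ≥0} {s : ℝ≥0} (h : ∀ u, u ∈ B ↔ ∃ t ∈ A, u = s + t) :
    (s : ℝ≥0∞) + firstTime A = firstTime B := by
  apply le_antisymm
  · refine le_firstTime_iff.2 fun u hu => ?_
    obtain ⟨t, ht, rfl⟩ := (h u).1 hu
    rw [ENNReal.coe_add]
    gcongr
    exact firstTime_le ht
  · rw [← tsub_le_iff_left, le_firstTime_iff]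
    intro t ht
    rw [tsub_le_iff_left, ← ENNReal.coe_add]
    exact firstTime_le ((h _).2 ⟨t, ht, rfl⟩)

section Jumps

variable {d : ℕ} {j : ℝ≥0 → Fin d}

theorem jumpTime_le_succ (j : ℝ≥0 → Fin d) (n : ℕ) : jumpTime j n ≤ jumpTime j (n + 1) :=
  le_firstTime_iff.2 fun _ ht => ht.1.le

theorem jumpTime_mono (j : ℝ≥0 → Fin d) : Monotone (jumpTime j) :=
  monotone_nat_of_le_succ (jumpTime_le_succ j)

theorem eq_visited {n : ℕ} {t : ℝ≥0} (h1 : jumpTime j n ≤ t) (h2 : t < jumpTime j (n + 1)) :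
    j t = visited j n := by
  rcases eq_or_lt_of_le h1 with h | h
  · rw [visited, h, ENNReal.toNNReal_coe]
  · by_contra hne
    exact absurd (firstTime_le (S := {t | jumpTime j n < t ∧ j t ≠ j (jumpTime j n).toNNReal})
      ⟨h, hne⟩) (not_le.2 h2)

theorem IsCadlag.eventually_eq_right (hj : IsCadlag j) (t : ℝ≥0) :
    ∃ u > t, ∀ r ∈ Ico t u, j r = j t := by
  have h1 : ∀ᶠ r in 𝓝[≥] t, j r = j t := (hj.1 t).eventually
    (show ∀ᶠ k in 𝓝 (j t), k = j t by simp [nhds_discrete])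
  obtain ⟨u, hu, hsub⟩ := (mem_nhdsGE_iff_exists_Ico_subset' (lt_add_one t)).1 h1
  exact ⟨u, hu, hsub⟩

theorem IsCadlag.jumpTime_lt_succ (hj : IsCadlag j) {n : ℕ} (h : jumpTime j n ≠ ∞) :
    jumpTime j n < jumpTime j (n + 1) := by
  obtain ⟨u, hu, hju⟩ := hj.eventually_eq_right (jumpTime j n).toNNReal
  have h1 : jumpTime j n < u := by
    rw [← ENNReal.coe_toNNReal h]
    exact_mod_cast hu
  refine h1.trans_le (le_firstTime_iff.2 fun t ht => ?_)
  by_contra! hlt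
  refine ht.2 (hju t ⟨?_, by exact_mod_cast hlt⟩)
  rw [← ENNReal.coe_le_coe, ENNReal.coe_toNNReal h]
  exact ht.1.le

/-- The infimum defining the jump time is attained: states other than the old one occur arbitrarily
soon from that time on, and the path is constant just after it. -/
theorem IsCadlag.visited_succ_ne (hj : IsCadlag j) {n : ℕ} (h : jumpTime j (n + 1) ≠ ∞) :
    visited j (n + 1) ≠ visited j n := by
  intro he
  obtain ⟨u, hu, hju⟩ := hj.eventually_eq_right (jumpTime j (n + 1)).toNNReal
  have h1 : jumpTime j (n + 1) < u := by
    rw [← ENNReal.coe_toNNReal h]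
    exact_mod_cast hu
  obtain ⟨t, ht, htu⟩ := firstTime_lt_iff.1 h1
  refine ht.2 ((hju t ⟨?_, by exact_mod_cast htu⟩).trans he)
  rw [← ENNReal.coe_le_coe, ENNReal.coe_toNNReal h]
  exact firstTime_le ht

/-- The jump times of a càdlàg path do not accumulate. -/
theorem IsCadlag.exists_lt_jumpTime (hj : IsCadlag j) (t : ℝ≥0) : ∃ n, t < jumpTime j n := by
  by_contra! hle
  have hfin : ∀ n, jumpTime j n ≠ ∞ := fun n => ne_top_of_le_ne_top ENNReal.coe_ne_top (hle n)
  set s : ℕ → ℝ≥0 := fun n => (jumpTime j n).toNNReal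
  have hs : ∀ n, (s n : ℝ≥0∞) = jumpTime j n := fun n => ENNReal.coe_toNNReal (hfin n)
  have hmono : StrictMono s := strictMono_nat_of_lt_succ fun n => by
    rw [← ENNReal.coe_lt_coe, hs, hs]
    exact hj.jumpTime_lt_succ (hfin n)
  have hbdd : BddAbove (range s) := ⟨t, by
    rintro _ ⟨n, rfl⟩
    rw [← ENNReal.coe_le_coe, hs]
    exact hle n⟩
  have hlim : Tendsto s atTop (𝓝 (⨆ n, s n)) := tendsto_atTop_ciSup hmono.monotone hbdd
  have hlt : ∀ n, s n < ⨆ n, s n := fun n =>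
    (hmono (Nat.lt_succ_self n)).trans_le (le_ciSup hbdd (n + 1))
  have hlim' : Tendsto s atTop (𝓝[<] (⨆ n, s n)) :=
    tendsto_nhdsWithin_iff.2 ⟨hlim, Eventually.of_forall hlt⟩
  -- The left limit at the accumulation point, in a discrete space, would make `j` eventually
  -- constant along the jump times, although consecutive visited states differ.
  obtain ⟨l, hl⟩ := hj.2 (⨆ n, s n)
  have hev : ∀ᶠ n in atTop, j (s n) = l := (hl.comp hlim').eventually
    (show ∀ᶠ k in 𝓝 l, k = l by simp [nhds_discrete])
  obtain ⟨N, hN⟩ := eventually_atTop.1 hev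
  exact hj.visited_succ_ne (hfin (N + 1)) ((hN (N + 1) (by simp)).trans (hN N le_rfl).symm)

theorem IsCadlag.exists_sojourn (hj : IsCadlag j) (t : ℝ≥0) :
    ∃ n, jumpTime j n ≤ t ∧ t < jumpTime j (n + 1) := by
  classical
  have h := hj.exists_lt_jumpTime t
  obtain ⟨k, hk⟩ : ∃ k, Nat.find h = k + 1 := Nat.exists_eq_succ_of_ne_zero fun h0 => by
    have := Nat.find_spec h
    rw [h0] at this
    exact not_lt_bot this
  exact ⟨k, not_lt.1 (Nat.find_min h (by omega)), hk ▸ Nat.find_spec h⟩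

/-- The variant for left limits: just before `t` the path is in this sojourn, even if `t` is the
jump time that ends it. -/
theorem IsCadlag.exists_sojourn_left (hj : IsCadlag j) {t : ℝ≥0} (ht : 0 < t) :
    ∃ n, jumpTime j n < t ∧ t ≤ jumpTime j (n + 1) := by
  classical
  have h : ∃ n, t ≤ jumpTime j n := (hj.exists_lt_jumpTime t).imp fun _ h => h.le
  obtain ⟨k, hk⟩ : ∃ k, Nat.find h = k + 1 := Nat.exists_eq_succ_of_ne_zero fun h0 => by
    have := Nat.find_spec h
    rw [h0, jumpTime] at this
    exact ht.not_ge (by simpa using this)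
  exact ⟨k, not_le.1 (Nat.find_min h (by omega)), hk ▸ Nat.find_spec h⟩

/-- Half of an induction step that is used in both directions: the jump time of `j` is a competitor
in the infimum for `j'`. -/
theorem jumpTime_agree_succ {j' : ℝ≥0 → Fin d} (hj : IsCadlag j) {s : ℝ≥0} {n : ℕ}
    (h : ∀ u ≤ s, j u = j' u) (ih : jumpTime j n ≤ s → jumpTime j' n = jumpTime j n)
    (hle : jumpTime j (n + 1) ≤ s) : jumpTime j' (n + 1) ≤ jumpTime j (n + 1) := by
  have hne : jumpTime j (n + 1) ≠ ∞ := ne_top_of_le_ne_top ENNReal.coe_ne_top hle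
  have hn : jumpTime j n ≤ s := (jumpTime_le_succ j n).trans hle
  have hne' : jumpTime j n ≠ ∞ := ne_top_of_le_ne_top ENNReal.coe_ne_top hn
  have e : ((jumpTime j (n + 1)).toNNReal : ℝ≥0∞) = jumpTime j (n + 1) := ENNReal.coe_toNNReal hne
  have hs1 : (jumpTime j (n + 1)).toNNReal ≤ s := by
    rw [← ENNReal.coe_le_coe, e]; exact hle
  have hs0 : (jumpTime j n).toNNReal ≤ s := by
    rw [← ENNReal.coe_le_coe, ENNReal.coe_toNNReal hne']; exact hn
  rw [← e]
  refine firstTime_le ⟨?_, ?_⟩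
  · rw [ih hn, e]; exact hj.jumpTime_lt_succ hne'
  · rw [ih hn, ← h _ hs1, ← h _ hs0]
    exact hj.visited_succ_ne hne

/-- Jump times up to time `s` only depend on the path up to time `s`. -/
theorem jumpTime_agree {j' : ℝ≥0 → Fin d} (hj : IsCadlag j) (hj' : IsCadlag j') {s : ℝ≥0}
    (h : ∀ u ≤ s, j u = j' u) (n : ℕ) :
    (jumpTime j n ≤ s → jumpTime j' n = jumpTime j n) ∧
      (jumpTime j' n ≤ s → jumpTime j n = jumpTime j' n) := by
  have h' : ∀ u ≤ s, j' u = j u := fun u hu => (h u hu).symm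
  induction n with
  | zero => exact ⟨fun _ => rfl, fun _ => rfl⟩
  | succ n ih =>
    constructor
    · intro hle
      have h1 := jumpTime_agree_succ hj h ih.1 hle
      exact le_antisymm h1 (jumpTime_agree_succ hj' h' ih.2 (h1.trans hle))
    · intro hle
      have h1 := jumpTime_agree_succ hj' h' ih.2 hle
      exact le_antisymm h1 (jumpTime_agree_succ hj h ih.1 (h1.trans hle))

/-- Indices start at `n + 1` because the zeroth jump time of the shifted path corresponds to `s`,
which lies inside sojourn `m` and need not be a jump time of `j`. -/
theorem jumpTime_shift {s : ℝ≥0} {m : ℕ} (h1 : jumpTime j m ≤ s)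
    (h2 : s < jumpTime j (m + 1)) (n : ℕ) :
    s + jumpTime (fun t => j (s + t)) (n + 1) = jumpTime j (m + n + 1) := by
  induction n with
  | zero =>
    refine add_firstTime fun u => ?_
    simp only [jumpTime, mem_ofPred_eq, ENNReal.toNNReal_zero, add_zero, ENNReal.coe_pos]
    rw [eq_visited h1 h2]
    constructor
    · rintro ⟨hu, hne⟩
      have hsu : s < u := by
        by_contra! hus
        exact hne (eq_visited hu.le ((ENNReal.coe_le_coe.2 hus).trans_lt h2))
      refine ⟨u - s, ⟨tsub_pos_of_lt hsu, ?_⟩, (add_tsub_cancel_of_le hsu.le).symm⟩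
      rwa [add_tsub_cancel_of_le hsu.le]
    · rintro ⟨t, ⟨ht, hne⟩, rfl⟩
      refine ⟨h1.trans_lt ?_, hne⟩
      exact_mod_cast lt_add_of_pos_right s ht
  | succ n ih =>
    have hrw : jumpTime j (m + (n + 1) + 1) = firstTime {t | jumpTime j (m + n + 1) < t ∧
      j t ≠ j (jumpTime j (m + n + 1)).toNNReal} := rfl
    rw [hrw, ← ih]
    refine add_firstTime fun u => ?_
    simp only [mem_ofPred_eq]
    set a := jumpTime (fun t => j (s + t)) (n + 1)
    by_cases ha : a = ∞
    · simp [ha]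
    have e : ((s : ℝ≥0∞) + a).toNNReal = s + a.toNNReal := by
      rw [ENNReal.toNNReal_add ENNReal.coe_ne_top ha, ENNReal.toNNReal_coe]
    rw [e]
    constructor
    · rintro ⟨hu, hne⟩
      have hsu : s ≤ u := ENNReal.coe_le_coe.1 (le_self_add.trans hu.le)
      refine ⟨u - s, ⟨?_, ?_⟩, (add_tsub_cancel_of_le hsu).symm⟩
      · rw [ENNReal.coe_sub, lt_tsub_iff_left]; exact hu
      · rwa [add_tsub_cancel_of_le hsu]
    · rintro ⟨t, ⟨ht, hne⟩, rfl⟩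
      refine ⟨?_, hne⟩
      rw [ENNReal.coe_add]
      exact ENNReal.add_lt_add_left ENNReal.coe_ne_top ht

end Jumps

/-! ### The free path -/

section FreePath

variable {d : ℕ} {j : ℝ≥0 → Fin d} {l : Fin d → ℝ≥0 → ℝ} {b : ℕ → Fin d → Fin d → ℝ}

/-- The contribution of the `n`-th sojourn to the free path. -/
noncomputable def pathTerm (j : ℝ≥0 → Fin d) (l : Fin d → ℝ≥0 → ℝ) (b : ℕ → Fin d → Fin d → ℝ)
    (n : ℕ) (t : ℝ≥0) : ℝ :=
  (l (visited j n) (min (jumpTime j (n + 1)) t).toNNReal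
      - l (visited j n) (min (jumpTime j n) t).toNNReal)
    + {s : ℝ≥0∞ | s ≤ t}.indicator (fun _ => b n (visited j n) (visited j (n + 1)))
        (jumpTime j (n + 1))

/-- Jump times increase strictly while they are finite, so even at `t = jumpTime j n` the job that
ends the sojourn is not yet counted. -/
theorem pathTerm_of_le (hj : IsCadlag j) {n : ℕ} {t : ℝ≥0} (h : t ≤ jumpTime j n) :
    pathTerm j l b n t = 0 := by
  have h1 : (t : ℝ≥0∞) < jumpTime j (n + 1) := by
    by_cases hn : jumpTime j n = ∞
    · have := jumpTime_le_succ j n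
      rw [hn, top_le_iff] at this
      rw [this]; exact ENNReal.coe_lt_top
    · exact h.trans_lt (hj.jumpTime_lt_succ hn)
  simp [pathTerm, min_eq_right h, min_eq_right h1.le, h1]

theorem pathTerm_of_ge {n : ℕ} {s t : ℝ≥0} (hs : jumpTime j (n + 1) ≤ s)
    (ht : jumpTime j (n + 1) ≤ t) : pathTerm j l b n s = pathTerm j l b n t := by
  have h1 := (jumpTime_le_succ j n).trans hs
  have h2 := (jumpTime_le_succ j n).trans ht
  simp [pathTerm, hs, ht, h1, h2]

theorem pathTerm_sojourn {n : ℕ} {t : ℝ≥0} (h1 : jumpTime j n ≤ t) (h2 : t < jumpTime j (n + 1)) :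
    pathTerm j l b n t = l (visited j n) t - l (visited j n) (jumpTime j n).toNNReal := by
  simp [pathTerm, min_eq_left h1, min_eq_right h2.le, h2]

theorem hasSum_freePath (hj : IsCadlag j) {M : ℕ} {t : ℝ≥0} (h : t ≤ jumpTime j M) :
    HasSum (fun n => pathTerm j l b n t) (∑ n ∈ Finset.range M, pathTerm j l b n t) :=
  hasSum_sum_of_ne_finset_zero fun n hn => pathTerm_of_le hj
    (h.trans (jumpTime_mono j (by simpa using hn)))

theorem freePath_eq_sum (hj : IsCadlag j) {M : ℕ} {t : ℝ≥0} (h : t ≤ jumpTime j M) :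
    freePath j l b t = ∑ n ∈ Finset.range M, pathTerm j l b n t :=
  (hasSum_freePath hj h).tsum_eq

theorem freePath_zero (hj : IsCadlag j) : freePath j l b 0 = 0 := by
  simp [freePath_eq_sum hj (M := 0) (t := 0) (by simp [jumpTime])]

/-- During one sojourn only one term of the sum moves. -/
theorem freePath_sub (hj : IsCadlag j) {m : ℕ} {s t : ℝ≥0} (hm : jumpTime j m ≤ s)
    (hst : s ≤ t) (ht : t ≤ jumpTime j (m + 1)) :
    freePath j l b t - freePath j l b s = pathTerm j l b m t - pathTerm j l b m s := by
  have hs' : (s : ℝ≥0∞) ≤ jumpTime j (m + 1) := (ENNReal.coe_le_coe.2 hst).trans ht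
  rw [freePath_eq_sum hj ht, freePath_eq_sum hj hs', Finset.sum_range_succ, Finset.sum_range_succ]
  have : ∑ n ∈ Finset.range m, pathTerm j l b n t = ∑ n ∈ Finset.range m, pathTerm j l b n s :=
    Finset.sum_congr rfl fun n hn => by
      have h1 : jumpTime j (n + 1) ≤ s := (jumpTime_mono j (by simpa using hn)).trans hm
      exact pathTerm_of_ge (h1.trans (ENNReal.coe_le_coe.2 hst)) h1
  rw [this]
  ring

theorem freePath_sub_eq (hj : IsCadlag j) {m : ℕ} {s t : ℝ≥0} (hm : jumpTime j m ≤ s)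
    (hst : s ≤ t) (ht : t < jumpTime j (m + 1)) :
    freePath j l b t - freePath j l b s = l (visited j m) t - l (visited j m) s := by
  have hst' : (s : ℝ≥0∞) ≤ t := ENNReal.coe_le_coe.2 hst
  rw [freePath_sub hj hm hst ht.le, pathTerm_sojourn (hm.trans hst') ht,
    pathTerm_sojourn hm (hst'.trans_lt ht)]
  ring

/-- The two increments differ at most by the job that ends the sojourn, received when `t` is the
jump time, and jobs are non-negative. -/
theorem le_freePath_sub (hj : IsCadlag j) (hb : ∀ n i k, 0 ≤ b n i k) {m : ℕ} {s t : ℝ≥0}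
    (hm : jumpTime j m ≤ s) (hst : s < t) (ht : t ≤ jumpTime j (m + 1)) :
    l (visited j m) t - l (visited j m) s ≤ freePath j l b t - freePath j l b s := by
  have hst' : (s : ℝ≥0∞) < t := ENNReal.coe_lt_coe.2 hst
  rw [freePath_sub hj hm hst.le ht, pathTerm_sojourn hm (hst'.trans_le ht), pathTerm,
    min_eq_right ht, min_eq_left (hm.trans hst'.le), ENNReal.toNNReal_coe]
  have : 0 ≤ {s : ℝ≥0∞ | s ≤ t}.indicator (fun _ => b m (visited j m) (visited j (m + 1)))
        (jumpTime j (m + 1)) := indicator_nonneg (fun _ _ => hb _ _ _) _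
  linarith

theorem freePath_rightContinuous (hj : IsCadlag j) (hl : ∀ i, IsCadlag (l i)) (t : ℝ≥0) :
    ContinuousWithinAt (freePath j l b) (Ici t) t := by
  obtain ⟨m, h1, h2⟩ := hj.exists_sojourn t
  have hc : ContinuousWithinAt
      (fun u => freePath j l b t + (l (visited j m) u - l (visited j m) t)) (Ici t) t :=
    continuousWithinAt_const.add (((hl _).1 t).sub continuousWithinAt_const)
  refine hc.congr_of_eventuallyEq ?_ (by simp)
  obtain ⟨r, hr1, hr2⟩ := ENNReal.lt_iff_exists_nnreal_btwn.1 h2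
  have hr1' : t < r := ENNReal.coe_lt_coe.1 hr1
  filter_upwards [Ico_mem_nhdsGE hr1'] with u hu
  have := freePath_sub_eq (l := l) (b := b) hj h1 hu.1
    ((ENNReal.coe_lt_coe.2 hu.2).trans hr2)
  linarith

/-- The free path has no negative jumps. -/
theorem freePath_no_drop (hj : IsCadlag j) (hl : ∀ i, IsCadlag (l i))
    (hneg : ∀ i t, Function.leftLim (l i) t ≤ l i t) (hb : ∀ n i k, 0 ≤ b n i k)
    {t : ℝ≥0} (ht : 0 < t) {ε : ℝ} (hε : 0 < ε) :
    ∀ᶠ u in 𝓝[<] t, freePath j l b u < freePath j l b t + ε := by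
  obtain ⟨m, h1, h2⟩ := hj.exists_sojourn_left ht
  have hne : (𝓝[<] t).NeBot := nhdsLT_neBot_of_exists_lt ⟨0, ht⟩
  -- If a jump of the chain occurs at `t`, its job only raises the path, so the left limit of the
  -- active Lévy path decides.
  obtain ⟨a, ha⟩ := (hl (visited j m)).2 t
  have ha' : a ≤ l (visited j m) t := by
    have h3 := hneg (visited j m) t
    rwa [leftLim_eq_of_tendsto ha] at h3
  obtain ⟨r, hr1, hr2⟩ := ENNReal.lt_iff_exists_nnreal_btwn.1 h1
  have hr2' : r < t := ENNReal.coe_lt_coe.1 hr2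
  filter_upwards [Ioo_mem_nhdsLT hr2', ha.eventually (gt_mem_nhds (show a < l (visited j m) t + ε
    by linarith))] with u hu hu'
  have := le_freePath_sub (l := l) hj hb (hr1.le.trans (ENNReal.coe_le_coe.2 hu.1.le)) hu.2 h2
  linarith

/-- Sojourn `m + n` of the old path is sojourn `n` of the shifted one. For `n = 0` it is already
under way at time `s`, so its value there has to be subtracted; for later sojourns that value is
`0`. -/
theorem pathTerm_shift (hj : IsCadlag j) {j₁ : ℝ≥0 → Fin d} (hj₁ : IsCadlag j₁) {s : ℝ≥0}
    (hj' : j₁ = fun t => j (s + t)) {m : ℕ} (h1 : jumpTime j m ≤ s)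
    (h2 : s < jumpTime j (m + 1)) (t : ℝ≥0) (n : ℕ) :
    pathTerm j l b (m + n) (s + t) - pathTerm j l b (m + n) s
      = pathTerm j₁ (fun i t => l i (s + t) - l i s) (fun n => b (m + n)) n t := by
  have J : ∀ n, s + jumpTime j₁ (n + 1) = jumpTime j (m + n + 1) := fun n => by
    rw [hj']; exact jumpTime_shift h1 h2 n
  have v0 : visited j₁ 0 = visited j m := by
    rw [← eq_visited h1 h2]; simp [visited, jumpTime, hj']
  have hmin : ∀ a : ℝ≥0∞, (min (s + a) ((s + t : ℝ≥0) : ℝ≥0∞)).toNNReal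
      = s + (min a t).toNNReal := fun a => by
    rw [ENNReal.coe_add, min_add_add_left, ENNReal.toNNReal_add ENNReal.coe_ne_top
      (ne_top_of_le_ne_top ENNReal.coe_ne_top (min_le_right _ _)), ENNReal.toNNReal_coe]
  have hvis : ∀ k, jumpTime j₁ (k + 1) ≠ ∞ → visited j (m + k + 1) = visited j₁ (k + 1) :=
    fun k hk => by
      rw [visited, visited, ← J k, ENNReal.toNNReal_add ENNReal.coe_ne_top hk,
        ENNReal.toNNReal_coe, hj']
  have hind : jumpTime j (m + n + 1) ≤ ((s + t : ℝ≥0) : ℝ≥0∞) ↔ jumpTime j₁ (n + 1) ≤ t := by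
    rw [← J n, ENNReal.coe_add]
    exact ENNReal.add_le_add_iff_left ENNReal.coe_ne_top
  clear hj'
  rcases n with _ | n
  · have ht1 := hmin (jumpTime j₁ 1)
    rw [J 0] at ht1
    have h0 : jumpTime j₁ 0 = 0 := rfl
    rw [add_zero, pathTerm_sojourn h1 h2, pathTerm, pathTerm, v0, h0]
    simp only [add_zero, zero_add] at ht1 hind ⊢
    rw [ht1, min_eq_left (h1.trans (ENNReal.coe_le_coe.2 le_self_add))]
    simp only [indicator, mem_ofPred_eq, hind]
    split_ifs with hi
    · have := hvis 0 (ne_top_of_le_ne_top ENNReal.coe_ne_top hi)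
      simp only [add_zero, zero_add] at this
      rw [this]
      simp; ring
    · simp
  · have hs : (s : ℝ≥0∞) ≤ jumpTime j (m + (n + 1)) := h2.le.trans (jumpTime_mono j (by omega))
    rw [pathTerm_of_le hj hs, sub_zero]
    by_cases hk : jumpTime j₁ (n + 1) = ∞
    · rw [pathTerm_of_le hj₁ (by rw [hk]; exact le_top), pathTerm_of_le hj]
      rw [← add_assoc, ← J n, hk]
      simp
    · have hv := hvis n hk
      have ht1 := hmin (jumpTime j₁ (n + 1))
      have ht2 := hmin (jumpTime j₁ (n + 1 + 1))
      rw [J] at ht1 ht2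
      rw [pathTerm, pathTerm, ← add_assoc, hv]
      rw [← add_assoc] at ht2 hind
      rw [ht1, ht2]
      simp only [indicator, mem_ofPred_eq, hind]
      split_ifs with hi
      · have := hvis (n + 1) (ne_top_of_le_ne_top ENNReal.coe_ne_top hi)
        rw [← add_assoc] at this
        rw [this]; ring
      · ring

/-- After time `s`, the increments of the free path are a free path built from the shifted
ingredients. -/
theorem freePath_shift (hj : IsCadlag j) {s : ℝ≥0} (hj' : IsCadlag fun t => j (s + t))
    {m : ℕ} (h1 : jumpTime j m ≤ s) (h2 : s < jumpTime j (m + 1)) (t : ℝ≥0) :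
    freePath j l b (s + t) - freePath j l b s
      = freePath (fun t => j (s + t)) (fun i t => l i (s + t) - l i s) (fun n => b (m + n)) t := by
  obtain ⟨N, hN⟩ := hj'.exists_lt_jumpTime t
  have hN1 : (t : ℝ≥0∞) ≤ jumpTime (fun t => j (s + t)) (N + 1) :=
    hN.le.trans (jumpTime_le_succ _ N)
  have e1 : ((s + t : ℝ≥0) : ℝ≥0∞) ≤ jumpTime j (m + (N + 1)) := by
    rw [← add_assoc, ← jumpTime_shift h1 h2 N, ENNReal.coe_add]
    gcongr
  have e2 : (s : ℝ≥0∞) ≤ jumpTime j (m + (N + 1)) :=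
    (ENNReal.coe_le_coe.2 le_self_add).trans e1
  rw [freePath_eq_sum hj e1, freePath_eq_sum hj e2, freePath_eq_sum hj' hN1,
    Finset.sum_range_add _ m (N + 1), Finset.sum_range_add _ m (N + 1)]
  have e3 : ∑ n ∈ Finset.range m, pathTerm j l b n (s + t)
      = ∑ n ∈ Finset.range m, pathTerm j l b n s := Finset.sum_congr rfl fun n hn => by
    have h3 : jumpTime j (n + 1) ≤ s := (jumpTime_mono j (by simpa using hn)).trans h1
    exact pathTerm_of_ge (h3.trans (ENNReal.coe_le_coe.2 le_self_add)) h3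
  rw [e3, add_sub_add_left_eq_sub, ← Finset.sum_sub_distrib]
  exact Finset.sum_congr rfl fun n _ => pathTerm_shift hj hj' rfl h1 h2 t n

/-- Up to time `s`, the free path only depends on the ingredients up to time `s`. -/
theorem freePath_congr {j' : ℝ≥0 → Fin d} {l' : Fin d → ℝ≥0 → ℝ}
    {b' : ℕ → Fin d → Fin d → ℝ} (hj : IsCadlag j) (hj' : IsCadlag j') {s : ℝ≥0} {m : ℕ}
    (hm : s < jumpTime j (m + 1)) (h : ∀ u ≤ s, j u = j' u) (hl : ∀ i, ∀ u ≤ s, l i u = l' i u)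
    (hb : ∀ n < m, b n = b' n) {u : ℝ≥0} (hu : u ≤ s) :
    freePath j l b u = freePath j' l' b' u := by
  have hus : (u : ℝ≥0∞) ≤ s := ENNReal.coe_le_coe.2 hu
  refine tsum_congr fun n => ?_
  change pathTerm j l b n u = pathTerm j' l' b' n u
  have A := fun k => jumpTime_agree hj hj' h k
  by_cases hn : (u : ℝ≥0∞) ≤ jumpTime j n
  · rw [pathTerm_of_le hj hn, pathTerm_of_le hj']
    by_contra! hlt
    rw [(A n).2 (hlt.le.trans hus)] at hn
    exact absurd hn (not_le.2 hlt)
  push Not at hn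
  have e := (A n).1 (hn.le.trans hus)
  have vis : ∀ k, jumpTime j k ≤ s → visited j' k = visited j k := fun k hk => by
    rw [visited, visited, (A k).1 hk]
    refine (h _ ?_).symm
    rw [← ENNReal.coe_le_coe, ENNReal.coe_toNNReal (ne_top_of_le_ne_top ENNReal.coe_ne_top hk)]
    exact hk
  have hmin : ∀ a : ℝ≥0∞, (min a (u : ℝ≥0∞)).toNNReal ≤ s := fun a => by
    rw [← ENNReal.coe_le_coe, ENNReal.coe_toNNReal
      (ne_top_of_le_ne_top ENNReal.coe_ne_top (min_le_right _ _))]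
    exact (min_le_right _ _).trans hus
  rw [pathTerm, pathTerm, vis n (hn.le.trans hus), e, ← hl _ _ (hmin _), ← hl _ _ (hmin _)]
  by_cases hi : jumpTime j (n + 1) ≤ u
  -- Job `n` arrives with jump `n + 1`, and jump `m + 1` happens only after `s`; so the jobs
  -- received by time `s` are among those on which `b` and `b'` agree.
  · have hnm : n < m := by
      by_contra! hmn
      exact absurd ((jumpTime_mono j (show m + 1 ≤ n + 1 by omega)).trans (hi.trans hus))
        (not_le.2 hm)
    rw [(A (n + 1)).1 (hi.trans hus), vis (n + 1) (hi.trans hus), hb n hnm]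
  · have hi' : ¬ jumpTime j' (n + 1) ≤ u := fun hi' => by
      rw [← (A (n + 1)).2 (hi'.trans hus)] at hi'
      exact hi hi'
    push Not at hi hi'
    simp [min_eq_right hi.le, min_eq_right hi'.le, hi, hi']

end FreePath

/-! ### Measurability -/

/-- The positive multiples of `1 / (n + 1)`. -/
noncomputable def gridTime (n k : ℕ) : ℝ≥0 := (k + 1) / (n + 1)

/-- The index of the first multiple of `1 / (n + 1)` after time `t`. -/
noncomputable def gridIndex (n : ℕ) (t : ℝ≥0) : ℕ := ⌊(n + 1 : ℝ≥0) * t⌋₊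

/-- The first multiple of `1 / (n + 1)` after time `t`. -/
noncomputable def gridAfter (n : ℕ) (t : ℝ≥0) : ℝ≥0 := gridTime n (gridIndex n t)

theorem lt_gridAfter (n : ℕ) (t : ℝ≥0) : t < gridAfter n t := by
  rw [gridAfter, gridTime, gridIndex, lt_div_iff₀ (by positivity), mul_comm]
  exact Nat.lt_floor_add_one _

theorem gridAfter_le (n : ℕ) (t : ℝ≥0) : gridAfter n t ≤ t + 1 / (n + 1) := by
  rw [gridAfter, gridTime, gridIndex, add_div]
  gcongr
  rw [div_le_iff₀ (by positivity), mul_comm]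
  exact Nat.floor_le zero_le

/-- The approach is strictly from the right and through countably many values. This serves both
measurability at random times and the passage from fixed times to the exit time. -/
theorem tendsto_gridAfter (t : ℝ≥0) : Tendsto (fun n => gridAfter n t) atTop (𝓝[>] t) := by
  refine tendsto_nhdsWithin_iff.2 ⟨?_, Eventually.of_forall fun n => lt_gridAfter n t⟩
  refine tendsto_of_tendsto_of_tendsto_of_le_of_le tendsto_const_nhds ?_
    (fun n => (lt_gridAfter n t).le) fun n => gridAfter_le n t
  have : Tendsto (fun n : ℕ => (1 : ℝ≥0) / (n + 1)) atTop (𝓝 0) :=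
    tendsto_one_div_add_atTop_nhds_zero_nat
  simpa using tendsto_const_nhds.add this

theorem measurable_gridIndex (n : ℕ) : Measurable (gridIndex n) :=
  Nat.measurable_floor.comp (measurable_const_mul _)

theorem measurable_gridAfter (n : ℕ) : Measurable (gridAfter n) :=
  (measurable_from_top (f := gridTime n)).comp (measurable_gridIndex n)

section Measurability

variable {Ω : Type*} [MeasurableSpace Ω]

/-- At `gridAfter n (τ ω)` only countably many times are involved, so each approximation is
measurable; right continuity gives the limit. -/
theorem measurable_comp_time_of_rightContinuous {E : Type*} [TopologicalSpace E]
    [TopologicalSpace.PseudoMetrizableSpace E] [MeasurableSpace E] [BorelSpace E]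
    {X : ℝ≥0 → Ω → E} (hX : ∀ t, Measurable (X t))
    (hc : ∀ ω t, ContinuousWithinAt (fun s => X s ω) (Ici t) t) {τ : Ω → ℝ≥0}
    (hτ : Measurable τ) : Measurable fun ω => X (τ ω) ω := by
  refine measurable_of_tendsto_metrizable (f := fun n ω => X (gridAfter n (τ ω)) ω)
    (fun n => ?_) ?_
  · have h1 : Measurable fun p : ℕ × Ω => X (gridTime n p.1) p.2 :=
      measurable_from_prod_countable_right fun k => hX (gridTime n k)
    have h2 : Measurable fun ω => (gridIndex n (τ ω), ω) :=
      ((measurable_gridIndex n).comp hτ).prodMk measurable_id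
    have h3 := h1.comp h2
    exact h3
  · rw [tendsto_pi_nhds]
    intro ω
    exact ((hc ω (τ ω)).mono Ioi_subset_Ici_self).tendsto.comp (tendsto_gridAfter (τ ω))

/-- Each point of `S` is followed by an interval of points of `S`, which contains a dense time. -/
theorem firstTime_lt_iff_dense {S : Set ℝ≥0} (hS : ∀ t ∈ S, ∀ᶠ u in 𝓝[>] t, u ∈ S) {a : ℝ≥0∞} :
    firstTime S < a ↔ ∃ n, (denseTime n : ℝ≥0∞) < a ∧ denseTime n ∈ S := by
  rw [firstTime_lt_iff]
  constructor
  · rintro ⟨t, ht, hta⟩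
    have h2 : ∀ᶠ u : ℝ≥0 in 𝓝[>] t, (u : ℝ≥0∞) < a :=
      (ENNReal.continuous_coe.continuousWithinAt (s := Ioi t) (x := t)).eventually
        (gt_mem_nhds hta)
    obtain ⟨n, -, h3, h4⟩ := exists_denseTime_of_eventually (h2.and (hS t ht))
    exact ⟨n, h3, h4⟩
  · rintro ⟨n, h1, h2⟩
    exact ⟨_, h2, h1⟩

theorem measurable_firstTime {S : Ω → Set ℝ≥0} (hm : ∀ t, MeasurableSet {ω | t ∈ S ω})
    (hS : ∀ ω, ∀ t ∈ S ω, ∀ᶠ u in 𝓝[>] t, u ∈ S ω) : Measurable fun ω => firstTime (S ω) := by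
  refine measurable_of_Iio fun a => ?_
  have : (fun ω => firstTime (S ω)) ⁻¹' Iio a
      = ⋃ n, {ω | (denseTime n : ℝ≥0∞) < a ∧ denseTime n ∈ S ω} := by
    ext ω
    simp only [mem_preimage, mem_Iio, mem_iUnion]
    exact firstTime_lt_iff_dense (hS ω)
  rw [this]
  exact MeasurableSet.iUnion fun n => (MeasurableSet.const _).inter (hm _)

/-- The ingredients of the free process, as measurable càdlàg processes. -/
structure MeasurableIngredients {d : ℕ} (J : ℝ≥0 → Ω → Fin d) (L : Fin d → ℝ≥0 → Ω → ℝ)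
    (B : ℕ → Fin d → Fin d → Ω → ℝ) : Prop where
  chain : ∀ t, Measurable (J t)
  chain_cadlag : ∀ ω, IsCadlag fun t => J t ω
  levy : ∀ i t, Measurable (L i t)
  levy_cadlag : ∀ i ω, IsCadlag fun t => L i t ω
  job : ∀ n i k, Measurable (B n i k)

namespace MeasurableIngredients

variable {d : ℕ} {J : ℝ≥0 → Ω → Fin d} {L : Fin d → ℝ≥0 → Ω → ℝ}
  {B : ℕ → Fin d → Fin d → Ω → ℝ}

theorem chain_at (h : MeasurableIngredients J L B) {τ : Ω → ℝ≥0} (hτ : Measurable τ) :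
    Measurable fun ω => J (τ ω) ω :=
  measurable_comp_time_of_rightContinuous h.chain (fun ω t => (h.chain_cadlag ω).1 t) hτ

theorem levy_at (h : MeasurableIngredients J L B) {τ : Ω → ℝ≥0} (hτ : Measurable τ)
    {i : Ω → Fin d} (hi : Measurable i) : Measurable fun ω => L (i ω) (τ ω) ω := by
  have h1 : ∀ k, Measurable fun ω => L k (τ ω) ω := fun k =>
    measurable_comp_time_of_rightContinuous (h.levy k) (fun ω t => (h.levy_cadlag k ω).1 t) hτ
  have h2 : Measurable fun p : Fin d × Ω => L p.1 (τ p.2) p.2 :=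
    measurable_from_prod_countable_right h1
  exact h2.comp (hi.prodMk measurable_id)

theorem jumpTime (h : MeasurableIngredients J L B) (n : ℕ) :
    Measurable fun ω => MAPQueue.jumpTime (fun s => J s ω) n := by
  induction n with
  | zero => exact measurable_const
  | succ n ih =>
    have hv : Measurable fun ω => J (MAPQueue.jumpTime (fun s => J s ω) n).toNNReal ω :=
      h.chain_at ih.ennreal_toNNReal
    refine measurable_firstTime (fun t => ?_) fun ω t ht => ?_
    · exact (measurableSet_lt ih measurable_const).inter
        (measurableSet_eq_fun (h.chain t) hv).compl
    · obtain ⟨u, hu, hju⟩ := (h.chain_cadlag ω).eventually_eq_right t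
      filter_upwards [Ioo_mem_nhdsGT hu] with r hr
      refine ⟨ht.1.trans (ENNReal.coe_lt_coe.2 hr.1), ?_⟩
      simp only [hju r ⟨hr.1.le, hr.2⟩]
      exact ht.2

theorem visited (h : MeasurableIngredients J L B) (n : ℕ) :
    Measurable fun ω => MAPQueue.visited (fun s => J s ω) n :=
  h.chain_at (h.jumpTime n).ennreal_toNNReal

theorem pathTerm (h : MeasurableIngredients J L B) (n : ℕ) (t : ℝ≥0) :
    Measurable fun ω => MAPQueue.pathTerm (fun s => J s ω) (fun i s => L i s ω)
      (fun n i k => B n i k ω) n t := by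
  unfold MAPQueue.pathTerm
  have h1 : ∀ n, Measurable fun ω => (min (MAPQueue.jumpTime (fun s => J s ω) n) t).toNNReal :=
    fun n => ((h.jumpTime n).min measurable_const).ennreal_toNNReal
  refine ((h.levy_at (h1 _) (h.visited n)).sub (h.levy_at (h1 _) (h.visited n))).add ?_
  have h2 : Measurable fun p : (Fin d × Fin d) × Ω => B n p.1.1 p.1.2 p.2 :=
    measurable_from_prod_countable_right fun p => h.job n p.1 p.2
  have h3 : Measurable fun ω => B n (MAPQueue.visited (fun s => J s ω) n)
      (MAPQueue.visited (fun s => J s ω) (n + 1)) ω :=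
    h2.comp (((h.visited n).prodMk (h.visited (n + 1))).prodMk measurable_id)
  simp only [indicator]
  exact Measurable.ite (measurableSet_le (h.jumpTime (n + 1)) measurable_const) h3 measurable_const

theorem freeProcess_measurable (h : MeasurableIngredients J L B) (t : ℝ≥0) :
    Measurable (MAPQueue.freeProcess J L B t) := by
  refine measurable_of_tendsto_metrizable (f := fun M ω => ∑ n ∈ Finset.range M,
    MAPQueue.pathTerm (fun s => J s ω) (fun i s => L i s ω) (fun n i k => B n i k ω) n t)
    (fun M => Finset.measurable_fun_sum _ fun n _ => h.pathTerm n t) ?_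
  rw [tendsto_pi_nhds]
  intro ω
  obtain ⟨N, hN⟩ := (h.chain_cadlag ω).exists_lt_jumpTime t
  refine tendsto_atTop_of_eventually_const (i₀ := N) fun M hM => ?_
  exact (freePath_eq_sum (h.chain_cadlag ω) (hN.le.trans (jumpTime_mono _ hM))).symm

theorem freeProcess_rightContinuous (h : MeasurableIngredients J L B) (ω : Ω) (t : ℝ≥0) :
    ContinuousWithinAt (fun s => MAPQueue.freeProcess J L B s ω) (Ici t) t :=
  freePath_rightContinuous (h.chain_cadlag ω) (fun i => h.levy_cadlag i ω) t

theorem freeProcess_at (h : MeasurableIngredients J L B) {τ : Ω → ℝ≥0} (hτ : Measurable τ) :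
    Measurable fun ω => MAPQueue.freeProcess J L B (τ ω) ω :=
  measurable_comp_time_of_rightContinuous h.freeProcess_measurable h.freeProcess_rightContinuous hτ

end MeasurableIngredients

/-- Being a level is a countable combination of inequalities between path values at the times `min
(denseTime n) (τ ω)`, and the supremum is over rationals. -/
theorem measurable_reflected {φ : ℝ≥0 → Ω → ℝ}
    (hφ : ∀ τ : Ω → ℝ≥0, Measurable τ → Measurable fun ω => φ (τ ω) ω) (K : ℝ) {τ : Ω → ℝ≥0}
    (hτ : Measurable τ) : Measurable fun ω => reflected K (fun t => φ t ω) (τ ω) := by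
  have hm : ∀ n, Measurable fun ω => φ (min (denseTime n) (τ ω)) ω := fun n =>
    hφ _ (measurable_const.min hτ)
  refine (hφ τ hτ).sub (Measurable.ereal_toReal (Measurable.iSup fun c => ?_))
  refine Measurable.ite ?_ measurable_const measurable_const
  have : {ω | (c : ℝ) ∈ regulatorLevels K (fun t => φ t ω) (τ ω)}
      = ({_ω | (c : ℝ) ≤ 0} ∩ ⋂ n, {ω | (c : ℝ) ≤ φ (min (denseTime n) (τ ω)) ω})
        ∪ ⋃ n, ({ω | (c : ℝ) ≤ φ (min (denseTime n) (τ ω)) ω - K}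
          ∩ ⋂ m, ⋂ (_ : denseTime n ≤ denseTime m),
            {ω | (c : ℝ) ≤ φ (min (denseTime m) (τ ω)) ω}) := by
    ext ω
    simp [regulatorLevels]
  rw [this]
  exact ((MeasurableSet.const _).inter (MeasurableSet.iInter fun n =>
    measurableSet_le measurable_const (hm n))).union (MeasurableSet.iUnion fun n =>
    (measurableSet_le measurable_const ((hm n).sub measurable_const)).inter
      (MeasurableSet.iInter fun m => MeasurableSet.iInter fun _ =>
        measurableSet_le measurable_const (hm m)))

end Measurability

/-! ### Independence -/

section Independence

variable {Ω ι : Type*} [mΩ : MeasurableSpace Ω] {P : Measure Ω}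

/-- If the members of an independent family split into two independent parts, then all the first
parts together are independent of all the second parts together. -/
theorem indep_iSup_iSup {m p f : ι → MeasurableSpace Ω} (hm : iIndep m P) (hle : ∀ i, m i ≤ mΩ)
    (hp : ∀ i, p i ≤ m i) (hf : ∀ i, f i ≤ m i) (hpf : ∀ i, Indep (p i) (f i) P) :
    Indep (⨆ i, p i) (⨆ i, f i) P := by
  classical
  have := hm.isProbabilityMeasure
  have gen : ∀ q : ι → MeasurableSpace Ω, (⨆ i, q i) = MeasurableSpace.generateFrom
      (piiUnionInter (fun i => {s | MeasurableSet[q i] s}) univ) := fun q => by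
    have := generateFrom_piiUnionInter_measurableSet q univ
    simp only [mem_univ, iSup_pos] at this
    exact this.symm
  have pis : ∀ q : ι → MeasurableSpace Ω,
      IsPiSystem (piiUnionInter (fun i => {s | MeasurableSet[q i] s}) univ) := fun q =>
    isPiSystem_piiUnionInter _ (fun i => @MeasurableSpace.isPiSystem_measurableSet _ (q i)) _
  refine IndepSets.indep (iSup_le fun i => (hp i).trans (hle i))
    (iSup_le fun i => (hf i).trans (hle i)) (pis p) (pis f) (gen p) (gen f) ?_
  rw [IndepSets_iff]
  rintro _ _ ⟨t, -, A, hA, rfl⟩ ⟨u, -, C, hC, rfl⟩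
  -- Padding with `univ` lets both finite intersections run over `t ∪ u`; independence then
  -- factorises member by member.
  set A' : ι → Set Ω := fun i => if i ∈ t then A i else univ
  set C' : ι → Set Ω := fun i => if i ∈ u then C i else univ
  have hA' : ∀ i, MeasurableSet[p i] (A' i) := fun i => by
    by_cases h : i ∈ t
    · simpa [A', h] using hA i h
    · simp [A', h]
  have hC' : ∀ i, MeasurableSet[f i] (C' i) := fun i => by
    by_cases h : i ∈ u
    · simpa [C', h] using hC i h
    · simp [C', h]
  have eA : ⋂ i ∈ t, A i = ⋂ i ∈ t ∪ u, A' i := by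
    ext ω
    simp only [mem_iInter, Finset.mem_union, A']
    constructor
    · intro h i _
      split_ifs with hi
      · exact h i hi
      · trivial
    · intro h i hi
      simpa [hi] using h i (Or.inl hi)
  have eC : ⋂ i ∈ u, C i = ⋂ i ∈ t ∪ u, C' i := by
    ext ω
    simp only [mem_iInter, Finset.mem_union, C']
    constructor
    · intro h i _
      split_ifs with hi
      · exact h i hi
      · trivial
    · intro h i hi
      simpa [hi] using h i (Or.inr hi)
  have eAC : (⋂ i ∈ t, A i) ∩ ⋂ i ∈ u, C i = ⋂ i ∈ t ∪ u, (A' i ∩ C' i) := by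
    rw [eA, eC]
    ext ω
    simp only [mem_inter_iff, mem_iInter]
    exact ⟨fun h i hi => ⟨h.1 i hi, h.2 i hi⟩, fun h => ⟨fun i hi => (h i hi).1,
      fun i hi => (h i hi).2⟩⟩
  rw [eAC, eA, eC, hm.meas_biInter fun i _ => ((hp i) _ (hA' i)).inter ((hf i) _ (hC' i)),
    hm.meas_biInter fun i _ => (hp i) _ (hA' i), hm.meas_biInter fun i _ => (hf i) _ (hC' i),
    ← Finset.prod_mul_distrib]
  exact Finset.prod_congr rfl fun i _ => (Indep_iff _ _ _).1 (hpf i) _ _ (hA' i) (hC' i)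

theorem iIndep.measure_inter_biInter {m : ι → MeasurableSpace Ω} (hm : iIndep m P) {i₀ : ι}
    {E : Set Ω} (hE : MeasurableSet[m i₀] E) {s : Finset ι} (hs : i₀ ∉ s) {A : ι → Set Ω}
    (hA : ∀ i ∈ s, MeasurableSet[m i] (A i)) :
    P (E ∩ ⋂ i ∈ s, A i) = P E * ∏ i ∈ s, P (A i) := by
  classical
  have hne : ∀ i ∈ s, i ≠ i₀ := fun i hi h => hs (h ▸ hi)
  have h := hm.meas_biInter (S := insert i₀ s) (s := Function.update A i₀ E) fun i hi => by
    rcases Finset.mem_insert.1 hi with rfl | hi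
    · simpa using hE
    · simpa [hne i hi] using hA i hi
  rw [Finset.prod_insert hs, Function.update_self, Finset.set_biInter_insert,
    Function.update_self] at h
  have e1 : ⋂ i ∈ s, Function.update A i₀ E i = ⋂ i ∈ s, A i :=
    iInter₂_congr fun i hi => by simp [hne i hi]
  have e2 : ∏ i ∈ s, P (Function.update A i₀ E i) = ∏ i ∈ s, P (A i) :=
    Finset.prod_congr rfl fun i hi => by simp [hne i hi]
  rw [← e1, ← e2, h]

/-- Conditioning on an event of one member of an independent family preserves independence. -/
theorem iIndep.cond_of_measurableSet {m : ι → MeasurableSpace Ω} (hm : iIndep m P)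
    (hle : ∀ i, m i ≤ mΩ) {i₀ : ι} {E : Set Ω} (hE : MeasurableSet[m i₀] E) (h0 : P E ≠ 0) :
    iIndep m P[|E] ∧ ∀ i ≠ i₀, ∀ A, MeasurableSet[m i] A → P[|E] A = P A := by
  classical
  have := hm.isProbabilityMeasure
  have hEm : MeasurableSet E := hle _ _ hE
  have hone : (P E)⁻¹ * P E = 1 := ENNReal.inv_mul_cancel h0 (measure_ne_top _ _)
  have key : ∀ i ≠ i₀, ∀ A, MeasurableSet[m i] A → P[|E] A = P A := by
    intro i hi A hA
    have := iIndep.measure_inter_biInter hm hE (s := {i}) (by simpa using hi.symm) (A := fun _ => A)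
      (by simpa using hA)
    simp only [Finset.mem_singleton, iInter_iInter_eq_left, Finset.prod_singleton] at this
    rw [cond_apply hEm, this, ← mul_assoc, hone, one_mul]
  refine ⟨(iIndep_iff _ _).2 fun s A hA => ?_, key⟩
  have key' : ∀ t ⊆ s, i₀ ∉ t → ∏ i ∈ t, P[|E] (A i) = ∏ i ∈ t, P (A i) := fun t ht h =>
    Finset.prod_congr rfl fun i hi => key i (fun h' => h (h' ▸ hi)) _ (hA i (ht hi))
  by_cases hs : i₀ ∈ s
  · obtain ⟨t, ht, rfl⟩ : ∃ t, i₀ ∉ t ∧ insert i₀ t = s :=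
      ⟨s.erase i₀, by simp, Finset.insert_erase hs⟩
    rw [Finset.prod_insert ht, key' t (Finset.subset_insert _ _) ht, Finset.set_biInter_insert,
      cond_apply hEm, cond_apply hEm, ← inter_assoc,
      iIndep.measure_inter_biInter hm (MeasurableSet.inter hE (hA i₀ (by simp))) ht
        fun i hi => hA i (Finset.mem_insert_of_mem hi), mul_assoc]
  · rw [key' s subset_rfl hs, cond_apply hEm, iIndep.measure_inter_biInter hm hE hs hA,
      ← mul_assoc, hone, one_mul]

end Independence

/-! ### Renewal of the ingredients at a fixed time -/

section Renewal

theorem sum_range_increments {Ω : Type*} {X : ℝ≥0 → Ω → ℝ} (h0 : ∀ ω, X 0 ω = 0) {t : ℕ → ℝ≥0} (ht : t 0 = 0)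
    (n : ℕ) (ω : Ω) : ∑ k ∈ Finset.range n, (X (t (k + 1)) ω - X (t k) ω) = X (t n) ω := by
  rw [Finset.sum_range_sub (fun k => X (t k) ω), ht, h0, sub_zero]

variable {Ω : Type*} [mΩ : MeasurableSpace Ω] {P : Measure Ω}

/-- Fits an arbitrary finite set of times to independence of increments along a monotone sequence;
starting at `0` makes values of the process partial sums of increments. -/
theorem exists_monotone_seq (F : Finset ℝ≥0) :
    ∃ (t : ℕ → ℝ≥0) (N : ℕ), Monotone t ∧ t 0 = 0 ∧ ∀ x ∈ F, ∃ n ≤ N, t n = x := by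
  classical
  induction F using Finset.induction_on_max with
  | empty => exact ⟨fun _ => 0, 0, monotone_const, rfl, by simp⟩
  | insert a s ha ih =>
    obtain ⟨t, N, hmono, h0, hs⟩ := ih
    refine ⟨fun n => if n ≤ N then min (t n) a else a, N + 1, fun m n hmn => ?_, by simp [h0],
      fun x hx => ?_⟩
    · dsimp only
      split_ifs with h1 h2
      · exact min_le_min_right _ (hmono hmn)
      · exact min_le_right _ _
      · omega
      · exact le_rfl
    · rcases Finset.mem_insert.1 hx with rfl | hx
      · exact ⟨N + 1, le_rfl, by simp⟩
      · obtain ⟨n, hn, hn'⟩ := hs x hx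
        exact ⟨n, by omega, by simp [hn, hn', (ha x hx).le]⟩

theorem IsSpectrallyPositiveLevy.indepFun_shift {X : ℝ≥0 → Ω → ℝ}
    (h : IsSpectrallyPositiveLevy P X) (s : ℝ≥0) :
    IndepFun (fun ω (u : ℝ≥0) => X (min u s) ω) (fun ω (t : ℝ≥0) => X (s + t) ω - X s ω) P := by
  classical
  have hp : IsProbabilityMeasure P :=
    (h.indep_increments 0 (fun _ => 0) monotone_const).isProbabilityMeasure
  refine IndepFun.process_indepFun_process (fun u => h.measurable _)
    (fun t => (h.measurable _).sub (h.measurable _)) fun I I' => ?_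
  -- With `s = t m` on the list, past values are sums of increments with index below `m`, and future
  -- increments are sums with index at least `m`.
  obtain ⟨t, N, hmono, h0, ht⟩ := exists_monotone_seq
    (insert s (I.image (fun u => min u s) ∪ I'.image (fun u => s + u)))
  obtain ⟨m, hmN, hm⟩ := ht s (by simp)
  have hI : ∀ u : I, ∃ n ≤ m, t n = min (u : ℝ≥0) s := fun u => by
    obtain ⟨n, -, hn⟩ := ht (min u s) (by
      simp only [Finset.mem_insert, Finset.mem_union, Finset.mem_image]
      exact Or.inr (Or.inl ⟨u, u.2, rfl⟩))
    rcases le_total n m with hnm | hnm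
    · exact ⟨n, hnm, hn⟩
    · refine ⟨m, le_rfl, le_antisymm ((hmono hnm).trans hn.le) ?_⟩
      rw [hm]; exact min_le_right _ _
  have hI' : ∀ u : I', ∃ n ≥ m, n ≤ N ∧ t n = s + u := fun u => by
    obtain ⟨n, hnN, hn⟩ := ht (s + u) (by
      simp only [Finset.mem_insert, Finset.mem_union, Finset.mem_image]
      exact Or.inr (Or.inr ⟨u, u.2, rfl⟩))
    rcases le_total m n with hnm | hnm
    · exact ⟨n, hnm, hnN, hn⟩
    · refine ⟨m, le_rfl, hmN, le_antisymm (hm.trans_le le_self_add) ?_⟩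
      exact hn.ge.trans (hmono hnm)
  choose a ha ha' using hI
  choose b hb hbN hb' using hI'
  have hind := (h.indep_increments.nat hmono).indepFun_finset (Finset.range m) (Finset.Ico m N)
    (by rw [Finset.disjoint_left]; intro x; simp; omega)
    (fun i => (h.measurable _).sub (h.measurable _))
  have hcomp := hind.comp
    (φ := fun x (u : I) => ∑ k : Finset.range m, if (k : ℕ) < a u then x k else 0)
    (ψ := fun x (u : I') => ∑ k : Finset.Ico m N, if (k : ℕ) < b u then x k else 0)
    (measurable_pi_lambda _ fun u => Finset.measurable_fun_sum _ fun k _ => by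
      split_ifs <;> fun_prop)
    (measurable_pi_lambda _ fun u => Finset.measurable_fun_sum _ fun k _ => by
      split_ifs <;> fun_prop)
  convert! hcomp using 1
  · ext ω u
    simp only [Function.comp]
    rw [Finset.sum_coe_sort (Finset.range m)
      (fun k => if k < a u then X (t (k + 1)) ω - X (t k) ω else 0), ← Finset.sum_filter,
      ← ha' u, ← sum_range_increments h.zero h0]
    refine Finset.sum_congr ?_ fun _ _ => rfl
    ext k
    have := ha u
    simp
    omega
  · ext ω u
    simp only [Function.comp]
    rw [Finset.sum_coe_sort (Finset.Ico m N)
      (fun k => if k < b u then X (t (k + 1)) ω - X (t k) ω else 0), ← Finset.sum_filter]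
    have e : Finset.filter (fun k => k < b u) (Finset.Ico m N) = Finset.Ico m (b u) := by
      ext k
      have := hbN u
      simp
      omega
    rw [e, Finset.sum_Ico_eq_sub _ (hb u), sum_range_increments h.zero h0,
      sum_range_increments h.zero h0, hb', hm]

/-- Along `t` and along `s + t` the increments are independent and, by stationarity, have the same
marginals, hence the same joint law; the finite-dimensional distributions are its images under
partial sums. -/
theorem IsSpectrallyPositiveLevy.map_shift {X : ℝ≥0 → Ω → ℝ}
    (h : IsSpectrallyPositiveLevy P X) (s : ℝ≥0) :
    P.map (fun ω (t : ℝ≥0) => X (s + t) ω - X s ω) = P.map (fun ω (t : ℝ≥0) => X t ω) := by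
  have hp : IsProbabilityMeasure P :=
    (h.indep_increments 0 (fun _ => 0) monotone_const).isProbabilityMeasure
  have hmX : ∀ u v, Measurable fun ω => X u ω - X v ω := fun u v =>
    (h.measurable u).sub (h.measurable v)
  refine (map_eq_iff_forall_finset_map_restrict_eq (X := fun t ω => X (s + t) ω - X s ω)
    (measurable_pi_lambda _ fun t => hmX _ _).aemeasurable
    (measurable_pi_lambda _ fun t => h.measurable t).aemeasurable).2 fun I => ?_
  obtain ⟨t, N, hmono, h0, ht⟩ := exists_monotone_seq I
  choose! n hn hn' using ht
  have hmono' : Monotone fun k => s + t k := fun k l hkl => by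
    have := hmono hkl
    dsimp only
    gcongr
  have e1 := (h.indep_increments.nat hmono').map_fun_eq_infinitePi_map fun k => hmX _ _
  have e2 := (h.indep_increments.nat hmono).map_fun_eq_infinitePi_map fun k => hmX _ _
  have e3 : ∀ k, P.map (fun ω => X (s + t (k + 1)) ω - X (s + t k) ω)
      = P.map (fun ω => X (t (k + 1)) ω - X (t k) ω) := fun k => by
    have hk : t k ≤ t (k + 1) := hmono (Nat.le_succ k)
    have h1 := (h.stationary_increments (s + t k) (t (k + 1) - t k)).map_eq
    have h2 := (h.stationary_increments (t k) (t (k + 1) - t k)).map_eq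
    rw [add_assoc, add_tsub_cancel_of_le hk] at h1
    rw [add_tsub_cancel_of_le hk] at h2
    rw [h1, h2]
  simp only [e3] at e1
  rw [← e2] at e1
  set S : (ℕ → ℝ) → I → ℝ := fun x u => ∑ k ∈ Finset.range (n u), x k
  have hS : Measurable S := measurable_pi_lambda _ fun u =>
    Finset.measurable_fun_sum _ fun k _ => measurable_pi_apply k
  have e4 := congrArg (Measure.map S) e1
  rw [Measure.map_map hS (measurable_pi_lambda _ fun k => hmX _ _),
    Measure.map_map hS (measurable_pi_lambda _ fun k => hmX _ _)] at e4
  convert e4 using 2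
  · ext ω u
    simp only [Function.comp, S, Finset.restrict_def]
    rw [Finset.sum_range_sub (fun k => X (s + t k) ω), hn' u u.2, h0, add_zero]
  · ext ω u
    simp only [Function.comp, S, Finset.restrict_def]
    rw [sum_range_increments h.zero h0, hn' u u.2]

variable {d : ℕ}

/-- The finite-dimensional distributions after time `s` only depend on the state at time `s`. -/
theorem IsMarkovChain.exists_fidi {Q : Matrix (Fin d) (Fin d) ℝ} {J : ℝ≥0 → Ω → Fin d}
    (h : IsMarkovChain P Q J) (I : Finset ℝ≥0) (a : ℝ≥0 → Fin d) (k : Fin d) :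
    ∃ c : ℝ, ∀ (s : ℝ≥0) (A : Set Ω), MeasurableSet[pastSigma J s] A →
      P.real (A ∩ {ω | J s ω = k} ∩ {ω | ∀ t ∈ I, J (s + t) ω = a t})
        = P.real (A ∩ {ω | J s ω = k}) * c := by
  classical
  have hJ : ∀ {s u : ℝ≥0} (b : Fin d), u ≤ s → MeasurableSet[pastSigma J s] {ω | J u ω = b} :=
    fun {s u} b hu => (le_iSup₂_of_le (f := fun u _ => MeasurableSpace.comap (J u) ⊤) u hu
      le_rfl) _ ⟨{b}, trivial, rfl⟩
  have hmono : ∀ {s u : ℝ≥0}, u ≤ s → pastSigma J u ≤ pastSigma J s := fun {s u} hu =>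
    iSup₂_le fun v hv => le_iSup₂_of_le (f := fun u _ => MeasurableSpace.comap (J u) ⊤) v
      (le_trans (mem_Iic.1 hv) hu) le_rfl
  -- The constant is chosen before `s` and `A`: uniformity in `A` gives independence of the past,
  -- uniformity in `s` gives stationarity. A new last time contributes one more transition
  -- probability.
  induction I using Finset.induction_on_max with
  | empty => exact ⟨1, by simp⟩
  | insert r I hr ih =>
    obtain ⟨c, hc⟩ := ih
    rcases I.eq_empty_or_nonempty with rfl | hne
    · exact ⟨NormedSpace.exp ((r : ℝ) • Q) k (a r), fun s A hA => by
        simpa using h.markov s r A hA k (a r)⟩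
    · set q := I.max' hne
      have hq : q ∈ I := I.max'_mem hne
      have hqr : q < r := hr q hq
      refine ⟨c * NormedSpace.exp (((r - q : ℝ≥0) : ℝ) • Q) (a q) (a r), fun s A hA => ?_⟩
      -- What is prescribed up to time `s + q` becomes the past event for the Markov property at `s
      -- + q`.
      set A' := A ∩ {ω | J s ω = k} ∩ {ω | ∀ t ∈ I, J (s + t) ω = a t} with hA'
      have hmem : MeasurableSet[pastSigma J (s + q)] A' := by
        refine MeasurableSet.inter (MeasurableSet.inter (hmono le_self_add _ hA)
          (hJ k le_self_add)) ?_
        have e : {ω | ∀ t ∈ I, J (s + t) ω = a t} = ⋂ t ∈ I, {ω | J (s + t) ω = a t} := by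
          ext ω; simp
        rw [e]
        refine Finset.measurableSet_biInter _ fun t ht => hJ (a t) ?_
        have := I.le_max' t ht
        gcongr
      have h1 := h.markov (s + q) (r - q) A' hmem (a q) (a r)
      have e1 : A' ∩ {ω | J (s + q) ω = a q} = A' :=
        inter_eq_left.2 fun ω hω => hω.2 q hq
      have e2 : s + q + (r - q) = s + r := by rw [add_assoc, add_tsub_cancel_of_le hqr.le]
      rw [e1, e2, hc s A hA] at h1
      rw [← mul_assoc, ← h1]
      congr 1
      ext ω
      simp only [hA', mem_inter_iff, mem_ofPred_eq, Finset.forall_mem_insert]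
      tauto

theorem IsMarkovChain.cond_fidi [IsProbabilityMeasure P] {Q : Matrix (Fin d) (Fin d) ℝ}
    {J : ℝ≥0 → Ω → Fin d} (h : IsMarkovChain P Q J) (I : Finset ℝ≥0) (a : ℝ≥0 → Fin d)
    (k : Fin d) : ∃ c : ℝ≥0∞, ∀ (s : ℝ≥0), P {ω | J s ω = k} ≠ 0 →
      ∀ A : Set Ω, MeasurableSet[pastSigma J s] A →
      P[|{ω | J s ω = k}] (A ∩ {ω | ∀ t ∈ I, J (s + t) ω = a t})
        = P[|{ω | J s ω = k}] A * c := by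
  obtain ⟨c, hc⟩ := h.exists_fidi I a k
  refine ⟨ENNReal.ofReal c, fun s h0 A hA => ?_⟩
  have hm : MeasurableSet {ω | J s ω = k} := measurableSet_eq_fun (h.measurable s) measurable_const
  have h1 := hc s A hA
  have h2 := congrArg ENNReal.ofReal h1
  rw [ENNReal.ofReal_mul measureReal_nonneg, ofReal_measureReal, ofReal_measureReal] at h2
  rw [cond_apply hm, cond_apply hm, inter_comm _ A, ← inter_assoc, inter_comm _ A, h2, mul_assoc]

/-- Taking `A = univ` identifies the constant of `cond_fidi` as the conditional probability of the
future pattern, so joint probabilities factorise. As there are finitely many states and times,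
patterns can be tested on singletons. -/
theorem IsMarkovChain.indepFun_shift [IsProbabilityMeasure P] {Q : Matrix (Fin d) (Fin d) ℝ}
    {J : ℝ≥0 → Ω → Fin d} (h : IsMarkovChain P Q J) {s : ℝ≥0} {k : Fin d}
    (h0 : P {ω | J s ω = k} ≠ 0) :
    IndepFun (fun ω (u : ℝ≥0) => J (min u s) ω) (fun ω (t : ℝ≥0) => J (s + t) ω)
      P[|{ω | J s ω = k}] := by
  classical
  have := cond_isProbabilityMeasure (μ := P) h0
  refine IndepFun.indepFun_process (measurable_pi_lambda _ fun u => h.measurable _)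
    (fun t => h.measurable _) fun I => ?_
  have hY : Measurable fun ω (t : I) => J (s + t) ω := measurable_pi_lambda _ fun t => h.measurable _
  rw [IndepFun_iff]
  rintro A _ ⟨S, hS, rfl⟩ ⟨C, hC, rfl⟩
  set A := (fun ω (u : ℝ≥0) => J (min u s) ω) ⁻¹' S
  have hA : MeasurableSet[pastSigma J s] A := by
    have : Measurable[pastSigma J s] fun ω (u : ℝ≥0) => J (min u s) ω :=
      @measurable_pi_lambda _ _ _ (pastSigma J s) _ _ fun u =>
        Measurable.mono (comap_measurable (J (min u s)))
          (le_iSup₂_of_le (f := fun u _ => MeasurableSpace.comap (J u) ⊤) _ (min_le_right u s)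
            le_rfl) le_rfl
    exact this hS
  have hA' : MeasurableSet A := (measurable_pi_lambda _ fun u => h.measurable _) hS
  have key : (P[|{ω | J s ω = k}].restrict A).map (fun ω (t : I) => J (s + t) ω)
      = P[|{ω | J s ω = k}] A • P[|{ω | J s ω = k}].map (fun ω (t : I) => J (s + t) ω) := by
    refine Measure.ext_of_singleton fun y => ?_
    rw [Measure.map_apply hY (measurableSet_singleton y), Measure.smul_apply,
      Measure.map_apply hY (measurableSet_singleton y),
      Measure.restrict_apply (hY (measurableSet_singleton y))]
    have e : (fun ω (t : I) => J (s + t) ω) ⁻¹' {y}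
        = {ω | ∀ t ∈ I, J (s + t) ω = (if ht : t ∈ I then y ⟨t, ht⟩ else k)} := by
      ext ω
      simp only [mem_preimage, mem_singleton_iff, mem_ofPred_eq, funext_iff, Subtype.forall]
      exact forall₂_congr fun t ht => by simp [ht]
    obtain ⟨c, hc⟩ := h.cond_fidi I (fun t => if ht : t ∈ I then y ⟨t, ht⟩ else k) k
    have h1 := hc s h0 A hA
    have h2 := hc s h0 univ MeasurableSet.univ
    rw [univ_inter, measure_univ, one_mul] at h2
    rw [e, inter_comm, h1, h2, smul_eq_mul]
  have := congrArg (fun μ => μ C) key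
  simp only [Measure.smul_apply, smul_eq_mul] at this
  rwa [Measure.map_apply hY hC, Measure.map_apply hY hC, Measure.restrict_apply (hY hC),
    inter_comm] at this

/-- The constant of `cond_fidi` is the same for time `s` and time `0`, and finite-dimensional
distributions determine the law. -/
theorem IsMarkovChain.map_shift [IsProbabilityMeasure P] {Q : Matrix (Fin d) (Fin d) ℝ}
    {J : ℝ≥0 → Ω → Fin d} (h : IsMarkovChain P Q J) {s : ℝ≥0} {k : Fin d}
    (hs : P {ω | J s ω = k} ≠ 0) (h0 : P {ω | J 0 ω = k} ≠ 0) :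
    P[|{ω | J s ω = k}].map (fun ω (t : ℝ≥0) => J (s + t) ω)
      = P[|{ω | J 0 ω = k}].map (fun ω (t : ℝ≥0) => J t ω) := by
  classical
  have := cond_isProbabilityMeasure (μ := P) hs
  have := cond_isProbabilityMeasure (μ := P) h0
  have l1 := isProjectiveLimit_map (P := P[|{ω | J s ω = k}]) (X := fun t ω => J (s + t) ω)
    (measurable_pi_lambda _ fun t => h.measurable _).aemeasurable
  have l2 := isProjectiveLimit_map (P := P[|{ω | J 0 ω = k}]) (X := J)
    (measurable_pi_lambda _ fun t => h.measurable _).aemeasurable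
  refine l1.unique (?_ : IsProjectiveLimit _ _)
  convert! l2 using 2 with I
  have hY : ∀ s, Measurable fun ω => I.restrict (fun t => J (s + t) ω) := fun s =>
    measurable_pi_lambda _ fun t => h.measurable _
  have hY0 : Measurable fun ω => I.restrict (fun t => J t ω) :=
    measurable_pi_lambda _ fun t => h.measurable _
  refine Measure.ext_of_singleton fun y => ?_
  rw [Measure.map_apply (hY s) (measurableSet_singleton y),
    Measure.map_apply hY0 (measurableSet_singleton y)]
  have e : ∀ s, (fun ω => I.restrict (fun t => J (s + t) ω)) ⁻¹' {y}
      = {ω | ∀ t ∈ I, J (s + t) ω = (if ht : t ∈ I then y ⟨t, ht⟩ else k)} := fun s => by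
    ext ω
    simp only [mem_preimage, mem_singleton_iff, mem_ofPred_eq, funext_iff, Subtype.forall,
      Finset.restrict_def]
    exact forall₂_congr fun t ht => by simp [ht]
  obtain ⟨c, hc⟩ := h.cond_fidi I (fun t => if ht : t ∈ I then y ⟨t, ht⟩ else k) k
  have h1 := hc s hs univ MeasurableSet.univ
  have h2 := hc 0 h0 univ MeasurableSet.univ
  have e0 := e 0
  simp only [zero_add] at e0 h2
  rw [univ_inter, measure_univ, one_mul] at h1 h2
  rw [e, e0, h1, h2]

end Renewal

/-! ### The space of ingredients -/

section Data

variable {d : ℕ}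

/-- The values of one source of randomness. -/
def SourceSpace : Source d → Type
  | .chain => ℝ≥0 → Fin d
  | .levy _ => ℝ≥0 → ℝ
  | .job _ _ _ => ℝ
  | .clock => ℝ≥0

instance sourceMeasurableSpace : ∀ s : Source d, MeasurableSpace (SourceSpace s)
  | .chain => inferInstanceAs (MeasurableSpace (ℝ≥0 → Fin d))
  | .levy _ => inferInstanceAs (MeasurableSpace (ℝ≥0 → ℝ))
  | .job _ _ _ => inferInstanceAs (MeasurableSpace ℝ)
  | .clock => inferInstanceAs (MeasurableSpace ℝ≥0)

/-- Bundle the ingredients of the model into one family. -/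
def assemble {Ω : Type*} (J : ℝ≥0 → Ω → Fin d) (L : Fin d → ℝ≥0 → Ω → ℝ)
    (B : ℕ → Fin d → Fin d → Ω → ℝ) (T : Ω → ℝ≥0) : ∀ s : Source d, Ω → SourceSpace s
  | .chain => fun ω t => J t ω
  | .levy i => fun ω t => L i t ω
  | .job n i k => B n i k
  | .clock => T

variable (d) in
/-- Families of ingredients with càdlàg paths. -/
def Data : Type :=
  {e : ∀ s : Source d, SourceSpace s //
    IsCadlag (show ℝ≥0 → Fin d from e .chain) ∧
      ∀ i, IsCadlag (show ℝ≥0 → ℝ from e (.levy i))}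

instance : MeasurableSpace (Data d) := inferInstanceAs (MeasurableSpace (Subtype _))

namespace Data

/-- The background chain. -/
def chain (t : ℝ≥0) (e : Data d) : Fin d := (show ℝ≥0 → Fin d from e.1 .chain) t

/-- The Lévy paths. -/
def levy (i : Fin d) (t : ℝ≥0) (e : Data d) : ℝ := (show ℝ≥0 → ℝ from e.1 (.levy i)) t

/-- The job sizes. -/
def job (n : ℕ) (i k : Fin d) (e : Data d) : ℝ := (show ℝ from e.1 (.job n i k))

/-- The clock. -/
def clock (e : Data d) : ℝ≥0 := (show ℝ≥0 from e.1 .clock)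

theorem measurable_coord (s : Source d) : Measurable fun e : Data d => e.1 s :=
  (measurable_pi_apply s).comp measurable_subtype_coe

theorem measurable_clock : Measurable (clock (d := d)) := measurable_coord .clock

theorem measurableIngredients :
    MeasurableIngredients (chain (d := d)) (levy (d := d)) (job (d := d)) where
  chain t := (measurable_pi_apply (X := fun _ : ℝ≥0 => Fin d) t).comp (measurable_coord .chain)
  chain_cadlag e := e.2.1
  levy i t := (measurable_pi_apply (X := fun _ : ℝ≥0 => ℝ) t).comp (measurable_coord (.levy i))
  levy_cadlag i e := e.2.2 i
  job n i k := measurable_coord (.job n i k)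

end Data

section Assemble

variable {Ω : Type*} {J : ℝ≥0 → Ω → Fin d} {L : Fin d → ℝ≥0 → Ω → ℝ}
  {B : ℕ → Fin d → Fin d → Ω → ℝ} {T : Ω → ℝ≥0}

theorem measurable_assemble [MeasurableSpace Ω] (h : MeasurableIngredients J L B) (hT : Measurable T) :
    ∀ s, Measurable (assemble J L B T s)
  | .chain => measurable_pi_lambda (X := fun _ : ℝ≥0 => Fin d) _ h.chain
  | .levy i => measurable_pi_lambda (X := fun _ : ℝ≥0 => ℝ) _ (h.levy i)
  | .job n i k => h.job n i k
  | .clock => hT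

/-- The ingredients as a random element. -/
def toData [MeasurableSpace Ω] (h : MeasurableIngredients J L B) (T : Ω → ℝ≥0) (ω : Ω) : Data d :=
  ⟨fun s => assemble J L B T s ω, h.chain_cadlag ω, fun i => h.levy_cadlag i ω⟩

theorem measurable_toData [MeasurableSpace Ω] (h : MeasurableIngredients J L B) (hT : Measurable T) :
    Measurable (toData h T) :=
  (measurable_pi_lambda _ (measurable_assemble h hT)).subtype_mk

theorem comap_assemble_le : ∀ s,
    MeasurableSpace.comap (assemble J L B T s) inferInstance ≤ sourceSigma J L B T s
  | .chain => by
    refine Measurable.comap_le (@measurable_pi_lambda Ω ℝ≥0 (fun _ => Fin d) (processSigma J)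
      (fun _ => inferInstance) _ fun t => ?_)
    exact Measurable.mono (comap_measurable (J t))
      (le_iSup (fun u => MeasurableSpace.comap (J u) ⊤) t) le_rfl
  | .levy i => by
    refine Measurable.comap_le (@measurable_pi_lambda Ω ℝ≥0 (fun _ => ℝ) (processSigma (L i))
      (fun _ => inferInstance) _ fun t => ?_)
    exact Measurable.mono (comap_measurable (L i t))
      (le_iSup (fun u => MeasurableSpace.comap (L i u) inferInstance) t) le_rfl
  | .job n i k => le_rfl
  | .clock => le_rfl

theorem sourceSigma_le [mΩ : MeasurableSpace Ω] (h : MeasurableIngredients J L B)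
    (hT : Measurable T) : ∀ s, sourceSigma J L B T s ≤ mΩ
  | .chain => iSup_le fun t => (h.chain t).comap_le
  | .levy i => iSup_le fun t => (h.levy i t).comap_le
  | .job n i k => (h.job n i k).comap_le
  | .clock => hT.comap_le

end Assemble

end Data

/-! ### Past and future ingredients -/

theorem isCadlag_stop {E : Type*} [TopologicalSpace E] {f : ℝ≥0 → E} (hf : IsCadlag f) (s : ℝ≥0) :
    IsCadlag fun t => f (min t s) := by
  constructor
  · intro t
    rcases lt_or_ge t s with h | h
    · refine (hf.1 t).congr_of_eventuallyEq ?_ (by rw [min_eq_left h.le])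
      filter_upwards [Ico_mem_nhdsGE h] with u hu
      rw [min_eq_left hu.2.le]
    · refine (continuousWithinAt_const (b := f s)).congr (fun u hu => ?_) ?_
      · rw [min_eq_right (h.trans hu)]
      · rw [min_eq_right h]
  · intro t
    rcases le_or_gt t s with h | h
    · obtain ⟨l, hl⟩ := hf.2 t
      refine ⟨l, hl.congr' ?_⟩
      filter_upwards [self_mem_nhdsWithin] with u hu
      rw [min_eq_left (le_of_lt (lt_of_lt_of_le hu h))]
    · refine ⟨f s, tendsto_const_nhds.congr' ?_⟩
      filter_upwards [Ioo_mem_nhdsLT h] with u hu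
      rw [min_eq_right hu.1.le]

theorem isCadlag_shift {E : Type*} [TopologicalSpace E] {f : ℝ≥0 → E} (hf : IsCadlag f) (s : ℝ≥0) :
    IsCadlag fun t => f (s + t) := by
  constructor
  · intro t
    refine ContinuousWithinAt.comp (t := Ici (s + t)) (hf.1 (s + t)) (by fun_prop) fun u hu => ?_
    exact add_le_add_right (mem_Ici.1 hu) s
  · intro t
    obtain ⟨l, hl⟩ := hf.2 (s + t)
    refine ⟨l, hl.comp (tendsto_nhdsWithin_iff.2 ⟨?_, ?_⟩)⟩
    · exact ((continuous_const.add continuous_id).tendsto t).mono_left nhdsWithin_le_nhds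
    · filter_upwards [self_mem_nhdsWithin] with u hu
      exact add_lt_add_right (mem_Iio.1 hu) s

theorem IsCadlag.sub_const {f : ℝ≥0 → ℝ} (hf : IsCadlag f) (c : ℝ) : IsCadlag fun t => f t - c :=
  ⟨fun t => (hf.1 t).sub continuousWithinAt_const, fun t => by
    obtain ⟨l, hl⟩ := hf.2 t
    exact ⟨l - c, hl.sub_const c⟩⟩

section PastFuture

variable {d : ℕ} {Ω : Type*} [MeasurableSpace Ω] {J : ℝ≥0 → Ω → Fin d}
  {L : Fin d → ℝ≥0 → Ω → ℝ} {B : ℕ → Fin d → Fin d → Ω → ℝ} {T : Ω → ℝ≥0}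

/-- The ingredients used up to time `s`, if there have been `m` jumps. -/
theorem MeasurableIngredients.past (h : MeasurableIngredients J L B) (s : ℝ≥0) (m : ℕ) :
    MeasurableIngredients (fun t => J (min t s)) (fun i t => L i (min t s))
      (fun n i k => if n < m then B n i k else fun _ => 0) where
  chain _ := h.chain _
  chain_cadlag ω := isCadlag_stop (h.chain_cadlag ω) s
  levy i _ := h.levy i _
  levy_cadlag i ω := isCadlag_stop (h.levy_cadlag i ω) s
  job n i k := by
    split_ifs
    · exact h.job n i k
    · exact measurable_const

/-- The ingredients used after time `s`, if there have been `m` jumps. -/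
theorem MeasurableIngredients.future (h : MeasurableIngredients J L B) (s : ℝ≥0) (m : ℕ) :
    MeasurableIngredients (fun t => J (s + t)) (fun i t ω => L i (s + t) ω - L i s ω)
      (fun n => B (m + n)) where
  chain _ := h.chain _
  chain_cadlag ω := isCadlag_shift (h.chain_cadlag ω) s
  levy i _ := (h.levy i _).sub (h.levy i _)
  levy_cadlag i ω := (isCadlag_shift (h.levy_cadlag i ω) s).sub_const _
  job _ i k := h.job _ i k

end PastFuture

/-! ### Memorylessness and absence of atoms of the exponential clock -/

section Clock

variable {Ω : Type*} [MeasurableSpace Ω] {P : Measure Ω} {T : Ω → ℝ≥0} {β : ℝ}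

theorem clock_le (hβ : 0 < β) (hT : Measurable T)
    (hlaw : P.map (fun ω => (T ω : ℝ)) = expMeasure β) (t : ℝ≥0) :
    P {ω | T ω ≤ t} = ENNReal.ofReal (1 - Real.exp (-(β * t))) := by
  have := isProbabilityMeasure_expMeasure hβ
  have h1 : P {ω | T ω ≤ t} = expMeasure β (Iic (t : ℝ)) := by
    rw [← hlaw, Measure.map_apply hT.coe_nnreal_real measurableSet_Iic]
    congr 1
  rw [h1, ← ofReal_cdf, cdf_expMeasure_eq hβ, if_pos t.coe_nonneg]

theorem clock_gt [IsProbabilityMeasure P] (hβ : 0 < β) (hT : Measurable T)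
    (hlaw : P.map (fun ω => (T ω : ℝ)) = expMeasure β) (t : ℝ≥0) :
    P {ω | t < T ω} = ENNReal.ofReal (Real.exp (-(β * t))) := by
  have h1 : {ω | t < T ω} = {ω | T ω ≤ t}ᶜ := by ext ω; simp
  rw [h1, prob_compl_eq_one_sub (measurableSet_le hT measurable_const), clock_le hβ hT hlaw,
    ← ENNReal.ofReal_one, ← ENNReal.ofReal_sub _ (by
      rw [sub_nonneg, Real.exp_le_one_iff]; exact neg_nonpos.2 (mul_nonneg hβ.le t.coe_nonneg))]
  congr 1
  ring

theorem clock_gt_ne_zero [IsProbabilityMeasure P] (hβ : 0 < β) (hT : Measurable T)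
    (hlaw : P.map (fun ω => (T ω : ℝ)) = expMeasure β) (t : ℝ≥0) : P {ω | t < T ω} ≠ 0 := by
  rw [clock_gt hβ hT hlaw, Ne, ENNReal.ofReal_eq_zero, not_le]
  exact Real.exp_pos _

/-- The exponential clock has no memory. -/
theorem clock_memoryless [IsProbabilityMeasure P] (hβ : 0 < β) (hT : Measurable T)
    (hlaw : P.map (fun ω => (T ω : ℝ)) = expMeasure β) (s : ℝ≥0) :
    P[|{ω | s < T ω}].map (fun ω => T ω - s) = P.map T := by
  have := cond_isProbabilityMeasure (μ := P) (clock_gt_ne_zero hβ hT hlaw s)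
  have hTs : Measurable fun ω => T ω - s := hT.sub measurable_const
  have := Measure.isProbabilityMeasure_map (μ := P[|{ω | s < T ω}]) hTs.aemeasurable
  refine Measure.ext_of_Iic _ _ fun t => ?_
  have hms : MeasurableSet {ω | s < T ω} := measurableSet_lt measurable_const hT
  rw [Measure.map_apply hTs measurableSet_Iic, Measure.map_apply hT measurableSet_Iic,
    cond_apply hms]
  have e1 : {ω | s < T ω} ∩ (fun ω => T ω - s) ⁻¹' Iic t = {ω | s < T ω} \ {ω | s + t < T ω} := by
    ext ω
    simp [add_comm s t]
  have e2 : T ⁻¹' Iic t = {ω | T ω ≤ t} := rfl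
  have hsub : {ω | s + t < T ω} ⊆ {ω | s < T ω} := fun ω hω =>
    lt_of_le_of_lt (le_self_add (a := s) (b := t)) hω
  rw [e1, e2, measure_sdiff hsub (measurableSet_lt measurable_const hT).nullMeasurableSet
    (measure_ne_top _ _), clock_gt hβ hT hlaw, clock_gt hβ hT hlaw, clock_le hβ hT hlaw,
    ← ENNReal.ofReal_sub _ (Real.exp_pos _).le, ← ENNReal.ofReal_inv_of_pos (Real.exp_pos _),
    ← ENNReal.ofReal_mul (by positivity)]
  congr 1
  rw [mul_sub, inv_mul_cancel₀ (Real.exp_pos _).ne', ← Real.exp_neg, ← Real.exp_add]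
  congr 2
  push_cast
  ring

theorem clock_eq_zero (hT : Measurable T)
    (hlaw : P.map (fun ω => (T ω : ℝ)) = expMeasure β) (t : ℝ≥0) : P {ω | T ω = t} = 0 := by
  have h1 : P {ω | T ω = t} = expMeasure β {(t : ℝ)} := by
    rw [← hlaw, Measure.map_apply hT.coe_nnreal_real (measurableSet_singleton _)]
    congr 1
    ext ω
    simp
  rw [h1, expMeasure, gammaMeasure]
  exact withDensity_absolutelyContinuous _ _ (Real.volume_singleton)

end Clock

/-! ### Past and future of each source of randomness -/

section Sources

variable {d : ℕ} {Ω : Type*} {J : ℝ≥0 → Ω → Fin d} {L : Fin d → ℝ≥0 → Ω → ℝ}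
  {B : ℕ → Fin d → Fin d → Ω → ℝ} {T : Ω → ℝ≥0}

/-- The future increments, indexed as the original ingredients. -/
def futureSource (J : ℝ≥0 → Ω → Fin d) (L : Fin d → ℝ≥0 → Ω → ℝ)
    (B : ℕ → Fin d → Fin d → Ω → ℝ) (T : Ω → ℝ≥0) (s : ℝ≥0) (m : ℕ) :
    ∀ r : Source d, Ω → SourceSpace r :=
  assemble (fun t => J (s + t)) (fun i t ω => L i (s + t) ω - L i s ω)
    (fun n i k => if n < m then fun _ => 0 else B n i k) (fun ω => T ω - s)

/-- The past ingredients. -/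
def pastSource (J : ℝ≥0 → Ω → Fin d) (L : Fin d → ℝ≥0 → Ω → ℝ)
    (B : ℕ → Fin d → Fin d → Ω → ℝ) (s : ℝ≥0) (m : ℕ) :
    ∀ r : Source d, Ω → SourceSpace r :=
  assemble (fun t => J (min t s)) (fun i t => L i (min t s))
    (fun n i k => if n < m then B n i k else fun _ => 0) (fun _ => 0)

theorem comap_pastSource_le (s : ℝ≥0) (m : ℕ) : ∀ r,
    MeasurableSpace.comap (pastSource J L B s m r) inferInstance ≤ sourceSigma J L B T r
  | .chain => by
    refine Measurable.comap_le (@measurable_pi_lambda Ω ℝ≥0 (fun _ => Fin d) (processSigma J)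
      (fun _ => inferInstance) _ fun t => ?_)
    exact Measurable.mono (comap_measurable (J (min t s)))
      (le_iSup (fun u => MeasurableSpace.comap (J u) ⊤) (min t s)) le_rfl
  | .levy i => by
    refine Measurable.comap_le (@measurable_pi_lambda Ω ℝ≥0 (fun _ => ℝ) (processSigma (L i))
      (fun _ => inferInstance) _ fun t => ?_)
    exact Measurable.mono (comap_measurable (L i (min t s)))
      (le_iSup (fun u => MeasurableSpace.comap (L i u) inferInstance) (min t s)) le_rfl
  | .job n i k => by
    refine Measurable.comap_le (?_ : Measurable[MeasurableSpace.comap (B n i k) inferInstance]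
      (if n < m then B n i k else fun _ => 0))
    split_ifs
    · exact comap_measurable _
    · exact measurable_const
  | .clock => Measurable.comap_le (measurable_const (a := (0 : ℝ≥0)))

/-- Keeping the original job labels, with used jobs replaced by `0`, makes past and future
comparable source by source, as `indep_iSup_iSup` requires; `reindexJobs` renumbers afterwards. -/
theorem comap_futureSource_le (s : ℝ≥0) (m : ℕ) : ∀ r,
    MeasurableSpace.comap (futureSource J L B T s m r) inferInstance ≤ sourceSigma J L B T r
  | .chain => by
    refine Measurable.comap_le (@measurable_pi_lambda Ω ℝ≥0 (fun _ => Fin d) (processSigma J)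
      (fun _ => inferInstance) _ fun t => ?_)
    exact Measurable.mono (comap_measurable (J (s + t)))
      (le_iSup (fun u => MeasurableSpace.comap (J u) ⊤) (s + t)) le_rfl
  | .levy i => by
    refine Measurable.comap_le (@measurable_pi_lambda Ω ℝ≥0 (fun _ => ℝ) (processSigma (L i))
      (fun _ => inferInstance) _ fun t => ?_)
    have key : ∀ u, Measurable[processSigma (L i)] (L i u) := fun u =>
      Measurable.mono (comap_measurable (L i u))
        (le_iSup (fun u => MeasurableSpace.comap (L i u) inferInstance) u) le_rfl
    exact (key (s + t)).sub (key s)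
  | .job n i k => by
    refine Measurable.comap_le (?_ : Measurable[MeasurableSpace.comap (B n i k) inferInstance]
      (if n < m then fun _ => 0 else B n i k))
    split_ifs
    · exact measurable_const
    · exact comap_measurable _
  | .clock => Measurable.comap_le ((comap_measurable T).sub measurable_const)

/-- The source that plays the role of `r` after `m` jumps. -/
def shiftSource (m : ℕ) : Source d → Source d
  | .job n i k => .job (m + n) i k
  | r => r

theorem shiftSource_injective (m : ℕ) : Function.Injective (shiftSource (d := d) m) := by
  rintro (_ | _ | _ | _) (_ | _ | _ | _) h <;> simp_all [shiftSource]

/-- After renumbering, each component is read from a relabelled source; since the relabelling is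
injective, mutual independence survives. -/
theorem comap_future_le (s : ℝ≥0) (m : ℕ) : ∀ r,
    MeasurableSpace.comap (assemble (fun t => J (s + t)) (fun i t ω => L i (s + t) ω - L i s ω)
      (fun n => B (m + n)) (fun ω => T ω - s) r) inferInstance
        ≤ sourceSigma J L B T (shiftSource m r)
  | .chain => comap_futureSource_le (L := L) (B := B) (T := T) s m .chain
  | .levy i => comap_futureSource_le (J := J) (L := L) (B := B) (T := T) s m (.levy i)
  | .job _ _ _ => le_rfl
  | .clock => comap_futureSource_le (J := J) (L := L) (B := B) s m .clock

/-- Move the jobs after the `m`-th one to the front. -/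
def reindexJobs (m : ℕ) (e : ∀ r : Source d, SourceSpace r) : ∀ r : Source d, SourceSpace r
  | .chain => e .chain
  | .levy i => e (.levy i)
  | .job n i k => e (.job (m + n) i k)
  | .clock => e .clock

theorem measurable_reindexJobs (m : ℕ) : Measurable (reindexJobs (d := d) m) :=
  measurable_pi_lambda _ fun
    | .chain => measurable_pi_apply _
    | .levy _ => measurable_pi_apply _
    | .job n i k => measurable_pi_apply (Source.job (m + n) i k)
    | .clock => measurable_pi_apply _

/-- Used to change the measure: conditioning on an event of one source leaves the laws of the other
sources unchanged. -/
theorem indepFun_of_eq_on {Ω : Type*} {m mΩ : MeasurableSpace Ω} {μ ν : Measure Ω} {α γ : Type*}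
    [MeasurableSpace α] [MeasurableSpace γ] {X : Ω → α} {Y : Ω → γ}
    (hX : MeasurableSpace.comap X inferInstance ≤ m)
    (hY : MeasurableSpace.comap Y inferInstance ≤ m)
    (heq : ∀ A, MeasurableSet[m] A → μ A = ν A) (h : IndepFun X Y ν) : IndepFun X Y μ := by
  rw [IndepFun_iff] at h ⊢
  intro A C hA hC
  rw [heq _ ((hX _ hA).inter (hY _ hC)), heq _ (hX _ hA), heq _ (hY _ hC)]
  exact h A C hA hC

theorem map_eq_of_eq_on {Ω : Type*} {m mΩ : MeasurableSpace Ω} {μ ν : Measure Ω} (hm : m ≤ mΩ) {α : Type*}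
    [MeasurableSpace α] {X : Ω → α} (hX : MeasurableSpace.comap X inferInstance ≤ m)
    (heq : ∀ A, MeasurableSet[m] A → μ A = ν A) : μ.map X = ν.map X := by
  have hX' : Measurable X := measurable_iff_comap_le.2 (hX.trans hm)
  refine Measure.ext fun A hA => ?_
  rw [Measure.map_apply hX' hA, Measure.map_apply hX' hA]
  exact heq _ (hX _ ⟨A, hA, rfl⟩)

end Sources

/-! ### Independence of past and future, and the law of the future -/

section Renewal

variable {d : ℕ} {Ω : Type*} [mΩ : MeasurableSpace Ω] {P : Measure Ω}
  {Q : Matrix (Fin d) (Fin d) ℝ} {β : ℝ} {J : ℝ≥0 → Ω → Fin d} {L : Fin d → ℝ≥0 → Ω → ℝ}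
  {B : ℕ → Fin d → Fin d → Ω → ℝ} {T : Ω → ℝ≥0}

theorem IsModel.ingredients (h : IsModel P Q β J L B T) : MeasurableIngredients J L B where
  chain := h.chain.measurable
  chain_cadlag := h.chain.cadlag
  levy i := (h.levy i).measurable
  levy_cadlag i := (h.levy i).cadlag
  job := h.job_measurable

theorem IsModel.measurableSet_state (_h : IsModel P Q β J L B T) (s : ℝ≥0) (k : Fin d) :
    MeasurableSet[sourceSigma J L B T .chain] {ω | J s ω = k} :=
  (le_iSup (fun u => MeasurableSpace.comap (J u) ⊤) s) _ ⟨{k}, trivial, rfl⟩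

theorem IsModel.measurableSet_alive (_h : IsModel P Q β J L B T) (s : ℝ≥0) :
    MeasurableSet[sourceSigma J L B T .clock] {ω | s < T ω} :=
  ⟨Ioi s, measurableSet_Ioi, rfl⟩

/-- Conditioning on the state of the chain. -/
theorem IsModel.cond_state (h : IsModel P Q β J L B T) {s : ℝ≥0} {k : Fin d}
    (h0 : P {ω | J s ω = k} ≠ 0) :
    iIndep (sourceSigma J L B T) P[|{ω | J s ω = k}] ∧
      ∀ r ≠ Source.chain, ∀ A, MeasurableSet[sourceSigma J L B T r] A →
        P[|{ω | J s ω = k}] A = P A :=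
  iIndep.cond_of_measurableSet h.indep (sourceSigma_le h.ingredients h.clock_measurable)
    (h.measurableSet_state s k) h0

variable [IsProbabilityMeasure P]

/-- The law, given that `J` is in state `k` and `T` has not occurred at time `s`. -/
noncomputable def aliveAt (P : Measure Ω) (J : ℝ≥0 → Ω → Fin d) (T : Ω → ℝ≥0) (s : ℝ≥0)
    (k : Fin d) : Measure Ω :=
  P[|{ω | J s ω = k}][|{ω | s < T ω}]

theorem IsModel.cond_state_alive (h : IsModel P Q β J L B T) (hβ : 0 < β) {s : ℝ≥0} {k : Fin d}
    (h0 : P {ω | J s ω = k} ≠ 0) : P[|{ω | J s ω = k}] {ω | s < T ω} ≠ 0 := by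
  rw [(h.cond_state h0).2 .clock (by simp) _ (h.measurableSet_alive s)]
  exact clock_gt_ne_zero hβ h.clock_measurable h.clock_law s

/-- Conditioning in two stages keeps each event within a single source: the state at `s` affects the
law of the chain only, survival beyond `s` that of the clock only. -/
theorem IsModel.aliveAt_spec (h : IsModel P Q β J L B T) (hβ : 0 < β) {s : ℝ≥0} {k : Fin d}
    (h0 : P {ω | J s ω = k} ≠ 0) :
    iIndep (sourceSigma J L B T) (aliveAt P J T s k) ∧
      ∀ r ≠ Source.clock, ∀ A, MeasurableSet[sourceSigma J L B T r] A →
        aliveAt P J T s k A = P[|{ω | J s ω = k}] A :=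
  iIndep.cond_of_measurableSet (h.cond_state h0).1
    (sourceSigma_le h.ingredients h.clock_measurable) (h.measurableSet_alive s)
    (h.cond_state_alive hβ h0)

theorem IsModel.isProbabilityMeasure_aliveAt (h : IsModel P Q β J L B T) (hβ : 0 < β) {s : ℝ≥0}
    {k : Fin d} (h0 : P {ω | J s ω = k} ≠ 0) : IsProbabilityMeasure (aliveAt P J T s k) :=
  have := cond_isProbabilityMeasure (μ := P) h0
  cond_isProbabilityMeasure (h.cond_state_alive hβ h0)

/-- The chain contributes its Markov property and the Lévy processes their independent increments; a
job lies entirely in the past or in the future, and the past part of the clock is constant. -/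
theorem IsModel.indepFun_source (h : IsModel P Q β J L B T) (hβ : 0 < β) {s : ℝ≥0} {k : Fin d}
    (h0 : P {ω | J s ω = k} ≠ 0) (m : ℕ) : ∀ r,
    IndepFun (pastSource J L B s m r) (futureSource J L B T s m r) (aliveAt P J T s k)
  | .chain => by
    exact indepFun_of_eq_on (comap_pastSource_le s m .chain) (comap_futureSource_le s m .chain)
      ((h.aliveAt_spec hβ h0).2 .chain (by simp)) (h.chain.indepFun_shift h0)
  | .levy i => by
    refine indepFun_of_eq_on (comap_pastSource_le s m (.levy i))
      (comap_futureSource_le s m (.levy i)) (fun A hA => ?_) ((h.levy i).indepFun_shift s)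
    rw [(h.aliveAt_spec hβ h0).2 (.levy i) (by simp) A hA,
      (h.cond_state h0).2 (.levy i) (by simp) A hA]
  | .job n i l => by
    have := h.isProbabilityMeasure_aliveAt hβ h0
    change IndepFun (if n < m then B n i l else fun _ => 0)
      (if n < m then fun _ => 0 else B n i l) _
    split_ifs
    · exact indepFun_const_right _ _
    · exact indepFun_const_left _ _
  | .clock => by
    have := h.isProbabilityMeasure_aliveAt hβ h0
    exact indepFun_const_left (0 : ℝ≥0) _

theorem IsModel.indepFun_pastSource_futureSource (h : IsModel P Q β J L B T) (hβ : 0 < β)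
    {s : ℝ≥0} {k : Fin d} (h0 : P {ω | J s ω = k} ≠ 0) (m : ℕ) :
    IndepFun (fun ω r => pastSource J L B s m r ω) (fun ω r => futureSource J L B T s m r ω)
      (aliveAt P J T s k) := by
  have key := indep_iSup_iSup (h.aliveAt_spec hβ h0).1
    (sourceSigma_le h.ingredients h.clock_measurable) (comap_pastSource_le s m)
    (comap_futureSource_le s m) fun r => (IndepFun_iff_Indep _ _ _).1 (h.indepFun_source hβ h0 m r)
  rw [IndepFun_iff_Indep]
  have le : ∀ X : ∀ r : Source d, Ω → SourceSpace r,
      MeasurableSpace.comap (fun ω r => X r ω) inferInstance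
        ≤ ⨆ r, MeasurableSpace.comap (X r) inferInstance := fun X =>
    Measurable.comap_le (@measurable_pi_lambda _ _ _ (⨆ r, MeasurableSpace.comap (X r)
      inferInstance) _ _ fun r => Measurable.mono (comap_measurable (X r))
        (le_iSup (fun r => MeasurableSpace.comap (X r) inferInstance) r) le_rfl)
  exact indep_of_indep_of_le_left (indep_of_indep_of_le_right key (le _)) (le _)

/-- The reasons are, in turn, time homogeneity of the chain, stationarity of the increments, the
common law of the jobs and memorylessness. -/
theorem IsModel.map_source (h : IsModel P Q β J L B T) (hβ : 0 < β) {s : ℝ≥0} {k : Fin d}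
    (h0 : P {ω | J s ω = k} ≠ 0) (m : ℕ) : ∀ r,
    (aliveAt P J T s k).map (assemble (fun t => J (s + t))
      (fun i t ω => L i (s + t) ω - L i s ω) (fun n => B (m + n)) (fun ω => T ω - s) r)
      = P[|{ω | J 0 ω = k}].map (assemble J L B T r)
  | .chain => by
    have hle := sourceSigma_le h.ingredients h.clock_measurable
    rw [map_eq_of_eq_on (hle .chain) (comap_future_le s m .chain)
      ((h.aliveAt_spec hβ h0).2 .chain (by simp))]
    exact h.chain.map_shift h0 (h.start k)
  | .levy i => by
    have hle := sourceSigma_le h.ingredients h.clock_measurable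
    rw [map_eq_of_eq_on (hle (.levy i)) (comap_future_le s m (.levy i)) (ν := P) fun A hA => by
      rw [(h.aliveAt_spec hβ h0).2 (.levy i) (by simp) A hA,
        (h.cond_state h0).2 (.levy i) (by simp) A hA],
      map_eq_of_eq_on (hle (.levy i)) (comap_assemble_le (.levy i)) (ν := P)
        ((h.cond_state (h.start k)).2 (.levy i) (by simp))]
    exact (h.levy i).map_shift s
  | .job n i l => by
    have hle := sourceSigma_le h.ingredients h.clock_measurable
    rw [map_eq_of_eq_on (hle (.job (m + n) i l)) (comap_future_le s m (.job n i l)) (ν := P)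
      fun A hA => by
        rw [(h.aliveAt_spec hβ h0).2 (.job (m + n) i l) (by simp) A hA,
          (h.cond_state h0).2 (.job (m + n) i l) (by simp) A hA],
      map_eq_of_eq_on (hle (.job n i l)) (comap_assemble_le (.job n i l)) (ν := P)
        ((h.cond_state (h.start k)).2 (.job n i l) (by simp))]
    exact (h.job_law (m + n) i l).map_eq.trans (h.job_law n i l).map_eq.symm
  | .clock => by
    have hle := sourceSigma_le h.ingredients h.clock_measurable
    have hal := h.measurableSet_alive s
    have hc := (h.cond_state h0).2 .clock (by simp)
    rw [map_eq_of_eq_on (hle .clock) (comap_future_le s m .clock) (ν := P[|{ω | s < T ω}])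
      fun A hA => by
        rw [aliveAt, cond_apply (hle .clock _ hal), cond_apply (hle .clock _ hal), hc _ hal,
          hc _ (MeasurableSet.inter hal hA)],
      map_eq_of_eq_on (hle .clock) (comap_assemble_le .clock) (ν := P)
        ((h.cond_state (h.start k)).2 .clock (by simp))]
    exact clock_memoryless hβ h.clock_measurable h.clock_law s

/-- Mutual independence makes both joint laws products, and the factors agree. -/
theorem IsModel.map_future (h : IsModel P Q β J L B T) (hβ : 0 < β) {s : ℝ≥0} {k : Fin d}
    (h0 : P {ω | J s ω = k} ≠ 0) (m : ℕ) :
    (aliveAt P J T s k).map (fun ω r => assemble (fun t => J (s + t))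
      (fun i t ω => L i (s + t) ω - L i s ω) (fun n => B (m + n)) (fun ω => T ω - s) r ω)
      = P[|{ω | J 0 ω = k}].map (fun ω r => assemble J L B T r ω) := by
  have hTs : Measurable fun ω => T ω - s := h.clock_measurable.sub measurable_const
  have i1 : iIndepFun (assemble (fun t => J (s + t))
      (fun i t ω => L i (s + t) ω - L i s ω) (fun n => B (m + n)) (fun ω => T ω - s))
      (aliveAt P J T s k) :=
    iIndep_of_iIndep_of_le ((h.aliveAt_spec hβ h0).1.precomp (shiftSource_injective m))
      (comap_future_le s m)
  have i2 : iIndepFun (assemble J L B T) P[|{ω | J 0 ω = k}] :=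
    iIndep_of_iIndep_of_le (h.cond_state (h.start k)).1 comap_assemble_le
  rw [i1.map_fun_eq_infinitePi_map (measurable_assemble (h.ingredients.future s m) hTs),
    i2.map_fun_eq_infinitePi_map (measurable_assemble h.ingredients h.clock_measurable)]
  simp only [h.map_source hβ h0 m]

/-- At time `s`, on the event that `J` is in state `k`, the past ingredients are independent of the
future ones, and the latter are distributed as the original ingredients started in `k`. -/
theorem IsModel.lintegral_past_future (h : IsModel P Q β J L B T) (hβ : 0 < β) (s : ℝ≥0)
    (k : Fin d) (m : ℕ) {G : Data d × Data d → ℝ≥0∞} (hG : Measurable G) :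
    ∫⁻ ω in {ω | J s ω = k} ∩ {ω | s < T ω}, G (toData (h.ingredients.past s m) (fun _ => 0) ω,
        toData (h.ingredients.future s m) (fun ω => T ω - s) ω) ∂P
      = ∫⁻ ω in {ω | J s ω = k} ∩ {ω | s < T ω}, ∫⁻ ω', G (toData (h.ingredients.past s m)
        (fun _ => 0) ω, toData h.ingredients T ω') ∂(startAt P J k) ∂P := by
  have mJ : MeasurableSet {ω | J s ω = k} :=
    measurableSet_eq_fun (h.chain.measurable s) measurable_const
  have mT : MeasurableSet {ω | s < T ω} := measurableSet_lt measurable_const h.clock_measurable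
  by_cases h0 : P {ω | J s ω = k} = 0
  · rw [Measure.restrict_eq_zero.2 (measure_mono_null inter_subset_left h0)]
    simp
  set Xp := toData (h.ingredients.past s m) (fun _ => 0)
  set Xf := toData (h.ingredients.future s m) (fun ω => T ω - s)
  set X := toData h.ingredients T
  have hXp : Measurable Xp := measurable_toData _ measurable_const
  have hXf : Measurable Xf := measurable_toData _ (h.clock_measurable.sub measurable_const)
  have hX : Measurable X := measurable_toData _ h.clock_measurable
  have hprob := h.isProbabilityMeasure_aliveAt hβ h0
  have hprob' : IsProbabilityMeasure (startAt P J k) :=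
    cond_isProbabilityMeasure (μ := P) (h.start k)
  have hind : IndepFun Xp Xf (aliveAt P J T s k) := by
    have h1 := (h.indepFun_pastSource_futureSource hβ h0 m).comp measurable_id
      (measurable_reindexJobs m)
    have e : (reindexJobs m ∘ fun ω r => futureSource J L B T s m r ω) = fun ω => (Xf ω).1 := by
      funext ω r
      cases r with
      | job n i k =>
        change (if m + n < m then fun _ => (0 : ℝ) else B (m + n) i k) ω = B (m + n) i k ω
        rw [if_neg (by omega)]
      | _ => rfl
    rw [e, IndepFun_iff] at h1
    rw [IndepFun_iff]
    rintro _ _ ⟨_, ⟨A, hA, rfl⟩, rfl⟩ ⟨_, ⟨C, hC, rfl⟩, rfl⟩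
    exact h1 _ _ ⟨A, hA, rfl⟩ ⟨C, hC, rfl⟩
  have hmap : (aliveAt P J T s k).map Xf = (startAt P J k).map X := by
    refine Measure.ext ?_
    rintro _ ⟨A, hA, rfl⟩
    have h1 := DFunLike.congr_fun (h.map_future hβ h0 m) A
    have hTs : Measurable fun ω => T ω - s := h.clock_measurable.sub measurable_const
    rw [Measure.map_apply (measurable_pi_lambda _ (measurable_assemble (h.ingredients.future s m)
      hTs)) hA, Measure.map_apply (measurable_pi_lambda _
      (measurable_assemble h.ingredients h.clock_measurable)) hA] at h1
    rw [Measure.map_apply hXf (measurable_subtype_coe hA),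
      Measure.map_apply hX (measurable_subtype_coe hA)]
    exact h1
  have hcond : aliveAt P J T s k
      = (P ({ω | J s ω = k} ∩ {ω | s < T ω}))⁻¹ • P.restrict ({ω | J s ω = k} ∩ {ω | s < T ω}) := by
    rw [aliveAt, cond_cond_eq_cond_inter mJ mT]; rfl
  have hne : P ({ω | J s ω = k} ∩ {ω | s < T ω}) ≠ 0 := fun hz => by
    have := hprob.measure_univ
    rw [hcond, Measure.restrict_eq_zero.2 hz] at this
    simp at this
  -- Under `aliveAt` the pair has a product law; after replacing the law of the future by that of
  -- fresh ingredients, Fubini gives the iterated integral.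
  have main : ∫⁻ ω, G (Xp ω, Xf ω) ∂(aliveAt P J T s k)
      = ∫⁻ ω, ∫⁻ ω', G (Xp ω, X ω') ∂(startAt P J k) ∂(aliveAt P J T s k) := by
    have h1 := (indepFun_iff_map_prod_eq_prod_map_map hXp.aemeasurable hXf.aemeasurable).1 hind
    have : IsProbabilityMeasure ((startAt P J k).map X) :=
      Measure.isProbabilityMeasure_map (μ := startAt P J k) hX.aemeasurable
    rw [← lintegral_map hG (hXp.prodMk hXf), h1, hmap, lintegral_prod _ hG.aemeasurable,
      lintegral_map hG.lintegral_prod_right' hXp]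
    refine lintegral_congr fun ω => ?_
    exact lintegral_map (hG.comp measurable_prodMk_left) hX
  rw [hcond, lintegral_smul_measure, lintegral_smul_measure, smul_eq_mul, smul_eq_mul] at main
  exact (ENNReal.mul_right_inj (ENNReal.inv_ne_zero.2 (measure_ne_top _ _))
    (ENNReal.inv_ne_top.2 hne)).1 main

end Renewal

/-! ### The exit time and the Markov property of the reflected process at a fixed time -/

theorem reflected_congr {K : ℝ} {φ φ' : ℝ≥0 → ℝ} {t : ℝ≥0} (h : ∀ u ≤ t, φ u = φ' u) :
    reflected K φ t = reflected K φ' t := by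
  have hm : ∀ n, φ (min (denseTime n) t) = φ' (min (denseTime n) t) := fun n =>
    h _ (min_le_right _ _)
  have : regulatorLevels K φ t = regulatorLevels K φ' t := by
    simp only [regulatorLevels, hm]
  rw [reflected, reflected, this, h t le_rfl]

/-- The first exit time from `[0, K]`. -/
noncomputable def exitTime (K : ℝ) (φ : ℝ≥0 → ℝ) : ℝ≥0∞ := firstTime {t | φ t ∉ Icc 0 K}

/-- An exit strictly before `a` is visible on the path up to `s`. For `≤` with `a = s`, the path
just after `s` would matter. -/
theorem exitTime_lt_congr {K : ℝ} {φ φ' : ℝ≥0 → ℝ} {s a : ℝ≥0} (h : ∀ u ≤ s, φ u = φ' u)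
    (ha : a ≤ s) : exitTime K φ < a ↔ exitTime K φ' < a := by
  rw [exitTime, exitTime, firstTime_lt_iff, firstTime_lt_iff]
  refine exists_congr fun t => ?_
  simp only [mem_ofPred_eq, ENNReal.coe_lt_coe]
  constructor
  · rintro ⟨h1, h2⟩
    exact ⟨h t (h2.le.trans ha) ▸ h1, h2⟩
  · rintro ⟨h1, h2⟩
    exact ⟨(h t (h2.le.trans ha)).symm ▸ h1, h2⟩

theorem eventually_notMem_Icc {K : ℝ} {φ : ℝ≥0 → ℝ} (hφ : ∀ t, ContinuousWithinAt φ (Ici t) t)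
    {t : ℝ≥0} (ht : φ t ∉ Icc 0 K) : ∀ᶠ u in 𝓝[>] t, φ u ∉ Icc 0 K :=
  ((hφ t).mono Ioi_subset_Ici_self).eventually (isClosed_Icc.isOpen_compl.mem_nhds ht)

theorem gridIndex_eq_iff {n k : ℕ} {t : ℝ≥0} :
    gridIndex n t = k ↔ (k / (n + 1) : ℝ≥0) ≤ t ∧ t < gridTime n k := by
  rw [gridIndex, Nat.floor_eq_iff zero_le, gridTime, div_le_iff₀ (by positivity),
    lt_div_iff₀ (by positivity), mul_comm]

theorem measurable_exitTime {Ω : Type*} [MeasurableSpace Ω] (K : ℝ) {φ : ℝ≥0 → Ω → ℝ}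
    (hφ : ∀ t, Measurable (φ t)) (hc : ∀ ω t, ContinuousWithinAt (fun s => φ s ω) (Ici t) t) :
    Measurable fun ω => exitTime K fun t => φ t ω :=
  measurable_firstTime (fun t => (hφ t measurableSet_Icc).compl)
    fun ω _ ht => eventually_notMem_Icc (hc ω) ht

/-- The reward `e^{-α w}`, paid if the final state is `j`. -/
noncomputable def payoff {d : ℕ} (α : ℝ) (j : Fin d) (w : ℝ) (i : Fin d) : ℝ≥0∞ :=
  if i = j then ENNReal.ofReal (Real.exp (-α * w)) else 0

theorem measurable_payoff {d : ℕ} (α : ℝ) (j : Fin d) {Ω : Type*} [MeasurableSpace Ω]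
    {W : Ω → ℝ} {I : Ω → Fin d} (hW : Measurable W) (hI : Measurable I) :
    Measurable fun ω => payoff α j (W ω) (I ω) :=
  Measurable.ite (measurableSet_eq_fun hI measurable_const)
    (Real.measurable_exp.comp (measurable_const.mul hW)).ennreal_ofReal measurable_const

theorem payoff_le_one {d : ℕ} {α : ℝ} (hα : 0 ≤ α) (j : Fin d) {w : ℝ} (hw : 0 ≤ w) (i : Fin d) :
    payoff α j w i ≤ 1 := by
  rw [payoff]
  split_ifs
  · rw [ENNReal.ofReal_le_one, Real.exp_le_one_iff]
    have := mul_nonneg hα hw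
    linarith
  · exact zero_le

section Markov

variable {d : ℕ} {Ω : Type*} [mΩ : MeasurableSpace Ω] {P : Measure Ω} [IsProbabilityMeasure P]
  {Q : Matrix (Fin d) (Fin d) ℝ} {α β K : ℝ} {J : ℝ≥0 → Ω → Fin d} {L : Fin d → ℝ≥0 → Ω → ℝ}
  {B : ℕ → Fin d → Fin d → Ω → ℝ} {T : Ω → ℝ≥0}

/-- The expected reward of the reflected process started in level `v` and state `k`. -/
noncomputable def value (P : Measure Ω) (J : ℝ≥0 → Ω → Fin d) (L : Fin d → ℝ≥0 → Ω → ℝ)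
    (B : ℕ → Fin d → Fin d → Ω → ℝ) (T : Ω → ℝ≥0) (K α : ℝ) (j : Fin d) (v : ℝ)
    (k : Fin d) : ℝ≥0∞ :=
  ∫⁻ ω, payoff α j (reflected K (fun t => v + freeProcess J L B t ω) (T ω)) (J (T ω) ω)
    ∂(startAt P J k)

theorem MeasurableIngredients.reflected {Ω : Type*} [MeasurableSpace Ω] {J : ℝ≥0 → Ω → Fin d}
    {L : Fin d → ℝ≥0 → Ω → ℝ} {B : ℕ → Fin d → Fin d → Ω → ℝ}
    (h : MeasurableIngredients J L B) {Ω' : Type*} [MeasurableSpace Ω'] {X : Ω' → Ω}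
    (hX : Measurable X) {v : Ω' → ℝ} (hv : Measurable v) {τ : Ω' → ℝ≥0} (hτ : Measurable τ)
    (K : ℝ) :
    Measurable fun ω => MAPQueue.reflected K
      (fun t => v ω + MAPQueue.freeProcess J L B t (X ω)) (τ ω) := by
  refine measurable_reflected (φ := fun t ω => v ω + MAPQueue.freeProcess J L B t (X ω))
    (fun τ' hτ' => hv.add ?_) K hτ
  exact measurable_comp_time_of_rightContinuous (X := fun t ω => MAPQueue.freeProcess J L B t (X ω))
    (fun t => (h.freeProcess_measurable t).comp hX) (fun ω t => h.freeProcess_rightContinuous (X ω) t) hτ'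

theorem MeasurableIngredients.chain_comp {Ω : Type*} [MeasurableSpace Ω] {J : ℝ≥0 → Ω → Fin d}
    {L : Fin d → ℝ≥0 → Ω → ℝ} {B : ℕ → Fin d → Fin d → Ω → ℝ}
    (h : MeasurableIngredients J L B) {Ω' : Type*} [MeasurableSpace Ω'] {X : Ω' → Ω}
    (hX : Measurable X) {τ : Ω' → ℝ≥0} (hτ : Measurable τ) :
    Measurable fun ω => J (τ ω) (X ω) :=
  measurable_comp_time_of_rightContinuous (X := fun t ω => J t (X ω))
    (fun t => (h.chain t).comp hX) (fun ω t => (h.chain_cadlag (X ω)).1 t) hτ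

theorem IsModel.measurable_value (h : IsModel P Q β J L B T) (K α : ℝ) (j k : Fin d) :
    Measurable fun v => value P J L B T K α j v k := by
  have : IsProbabilityMeasure (startAt P J k) := cond_isProbabilityMeasure (h.start k)
  have h1 : Measurable fun p : ℝ × Ω => payoff α j
      (MAPQueue.reflected K (fun t => p.1 + freeProcess J L B t p.2) (T p.2)) (J (T p.2) p.2) :=
    measurable_payoff α j (h.ingredients.reflected measurable_snd measurable_fst
      (h.clock_measurable.comp measurable_snd) K)
      (h.ingredients.chain_comp measurable_snd (h.clock_measurable.comp measurable_snd))
  exact h1.lintegral_prod_right'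

/-- The event `A` is determined by the ingredients up to time `s`. -/
def IsPastEvent (h : MeasurableIngredients J L B) (s : ℝ≥0) (A : Set Ω) : Prop :=
  MeasurableSet A ∧ ∀ m, ∃ A' : Set (Data d), MeasurableSet A' ∧
    ∀ ω, jumpTime (fun t => J t ω) m ≤ s → s < jumpTime (fun t => J t ω) (m + 1) →
      (ω ∈ A ↔ toData (h.past s m) (fun _ => 0) ω ∈ A')

/-- The free process of the past ingredients agrees with the original one up to time `s`. -/
theorem freeProcess_past (h : MeasurableIngredients J L B) {s : ℝ≥0} {m : ℕ} {ω : Ω}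
    (hm : s < jumpTime (fun t => J t ω) (m + 1)) {u : ℝ≥0} (hu : u ≤ s) :
    freeProcess Data.chain Data.levy Data.job u (toData (h.past s m) (fun _ => 0) ω)
      = freeProcess J L B u ω := by
  refine (freePath_congr (h.chain_cadlag ω) ((h.past s m).chain_cadlag ω) hm (fun u hu => ?_)
    (fun i u hu => ?_) (fun n hn => ?_) hu).symm
  · rw [min_eq_left hu]
  · change L i u ω = L i (min u s) ω
    rw [min_eq_left hu]
  · funext i k
    change B n i k ω = (if n < m then B n i k else fun _ => 0) ω
    rw [if_pos hn]

theorem sojourn_past_iff (h : MeasurableIngredients J L B) {s : ℝ≥0} {m : ℕ} {ω : Ω} (n : ℕ) :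
    jumpTime (fun t => Data.chain t (toData (h.past s m) (fun _ => 0) ω)) n ≤ s
      ↔ jumpTime (fun t => J t ω) n ≤ s := by
  have A := jumpTime_agree (h.chain_cadlag ω) ((h.past s m).chain_cadlag ω) (s := s)
    (fun u hu => by rw [min_eq_left hu]) n
  constructor
  · intro h1
    rw [A.2 h1]; exact h1
  · intro h1
    have := A.1 h1
    exact this.le.trans h1

theorem isPastEvent_exit (h : MeasurableIngredients J L B) (K x : ℝ) (i : Fin d) {a s : ℝ≥0}
    (has : a ≤ s) : IsPastEvent h s ({ω | J 0 ω = i} ∩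
      {ω | a ≤ exitTime K (fun t => x + freeProcess J L B t ω)} ∩
      {ω | exitTime K (fun t => x + freeProcess J L B t ω) < s}) := by
  have hY : ∀ {Ω : Type _} [MeasurableSpace Ω] {J : ℝ≥0 → Ω → Fin d} {L : Fin d → ℝ≥0 → Ω → ℝ}
      {B : ℕ → Fin d → Fin d → Ω → ℝ}, MeasurableIngredients J L B →
      MeasurableSet ({ω | J 0 ω = i} ∩
        {ω | a ≤ exitTime K (fun t => x + freeProcess J L B t ω)} ∩
        {ω | exitTime K (fun t => x + freeProcess J L B t ω) < s}) := by
    intro Ω _ J L B h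
    have h1 : Measurable fun ω => exitTime K (fun t => x + freeProcess J L B t ω) :=
      measurable_exitTime K (φ := fun t ω => x + freeProcess J L B t ω)
        (fun t => measurable_const.add (h.freeProcess_measurable t))
        fun ω t => continuousWithinAt_const.add (h.freeProcess_rightContinuous ω t)
    exact ((measurableSet_eq_fun (h.chain 0) measurable_const).inter
      (measurableSet_le measurable_const h1)).inter (measurableSet_lt h1 measurable_const)
  have hD : MeasurableSet ({e : Data d | Data.chain 0 e = i} ∩
      {e | a ≤ exitTime K (fun t => x + freeProcess Data.chain Data.levy Data.job t e)} ∩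
      {e | exitTime K (fun t => x + freeProcess Data.chain Data.levy Data.job t e) < s}) := by
    have h1 : Measurable fun e : Data d =>
        exitTime K (fun t => x + freeProcess Data.chain Data.levy Data.job t e) :=
      measurable_exitTime K (φ := fun t e => x + freeProcess Data.chain Data.levy Data.job t e)
        (fun t => measurable_const.add (Data.measurableIngredients.freeProcess_measurable t))
        fun ω t => continuousWithinAt_const.add
          (Data.measurableIngredients.freeProcess_rightContinuous ω t)
    exact ((measurableSet_eq_fun (Data.measurableIngredients.chain 0) measurable_const).inter
      (measurableSet_le measurable_const h1)).inter (measurableSet_lt h1 measurable_const)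
  refine ⟨hY h, fun m => ⟨_, hD, fun ω h1 h2 => ?_⟩⟩
  have e : ∀ b ≤ s, exitTime K (fun t => x + freeProcess J L B t ω) < (b : ℝ≥0) ↔
      exitTime K (fun t => x + freeProcess Data.chain Data.levy Data.job t
        (toData (h.past s m) (fun _ => 0) ω)) < (b : ℝ≥0) := fun b hb =>
    exitTime_lt_congr (fun u hu => by rw [freeProcess_past h h2 hu]) hb
  simp only [mem_inter_iff, mem_ofPred_eq, ← not_lt (b := (a : ℝ≥0∞)), e a has, e s le_rfl]
  have e0 : Data.chain 0 (toData (h.past s m) (fun _ => 0) ω) = J 0 ω := by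
    change J (min 0 s) ω = J 0 ω
    rw [min_eq_left zero_le]
  rw [e0]

variable {V : ℝ → ℝ≥0 → Ω → ℝ}

theorem reflection_eq (h : MeasurableIngredients J L B) {x : ℝ} {v : ℝ≥0 → Ω → ℝ} {ω : Ω}
    (hv : IsDoublyReflected K x (fun t => freeProcess J L B t ω) (fun t => v t ω)) (t : ℝ≥0) :
    v t ω = reflected K (fun t => x + freeProcess J L B t ω) t := by
  obtain ⟨Um, Up, hR⟩ := hv.exists_isReflection
  exact hR.eq_reflected
    (fun t => continuousWithinAt_const.add (h.freeProcess_rightContinuous ω t)) t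

/-- The restarted reflection starts from `v s` and is driven by the increments after `s`, which by
`freePath_shift` form the free path of the future ingredients; uniqueness identifies the two. -/
theorem reflection_shift (h : MeasurableIngredients J L B) {x : ℝ} {v : ℝ≥0 → Ω → ℝ} {ω : Ω}
    (hv : IsDoublyReflected K x (fun t => freeProcess J L B t ω) (fun t => v t ω)) {s : ℝ≥0}
    {m : ℕ} (h1 : jumpTime (fun t => J t ω) m ≤ s) (h2 : s < jumpTime (fun t => J t ω) (m + 1))
    (T' : Ω → ℝ≥0) (t : ℝ≥0) :
    v (s + t) ω = reflected K (fun t => v s ω + freeProcess Data.chain Data.levy Data.job t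
      (toData (h.future s m) T' ω)) t := by
  obtain ⟨Um, Up, hR⟩ := hv.exists_isReflection
  have e : ∀ t, freeProcess Data.chain Data.levy Data.job t (toData (h.future s m) T' ω)
      = (x + freeProcess J L B (s + t) ω) - (x + freeProcess J L B s ω) := fun t => by
    rw [add_sub_add_left_eq_sub]
    exact (freePath_shift (l := fun i t => L i t ω) (b := fun n i k => B n i k ω)
      (h.chain_cadlag ω) ((h.future s m).chain_cadlag ω) h1 h2 t).symm
  simp only [e]
  refine (hR.shift s).eq_reflected (fun t => continuousWithinAt_const.add ?_) t
  have := Data.measurableIngredients.freeProcess_rightContinuous (toData (h.future s m) T' ω) t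
  simpa only [e] using this

/-- The Markov property at a fixed time `s`, on one sojourn of the chain. -/
theorem IsModel.markov_sojourn (h : IsModel P Q β J L B T) (hβ : 0 < β)
    (hV : ∀ x ∈ Icc 0 K, ∀ ω,
      IsDoublyReflected K x (fun t => freeProcess J L B t ω) (fun t => V x t ω))
    {x : ℝ} (hx : x ∈ Icc 0 K) (α : ℝ) (j k : Fin d) {s : ℝ≥0} {A : Set Ω}
    (hA : IsPastEvent h.ingredients s A) (m : ℕ) :
    ∫⁻ ω in {ω | J s ω = k} ∩ {ω | s < T ω} ∩ (A ∩ {ω | jumpTime (fun t => J t ω) m ≤ s ∧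
        s < jumpTime (fun t => J t ω) (m + 1)}), payoff α j (V x (T ω) ω) (J (T ω) ω) ∂P
      = ∫⁻ ω in {ω | J s ω = k} ∩ {ω | s < T ω} ∩ (A ∩ {ω | jumpTime (fun t => J t ω) m ≤ s ∧
        s < jumpTime (fun t => J t ω) (m + 1)}), value P J L B T K α j (V x s ω) (J s ω) ∂P := by
  have hi := h.ingredients
  have mJ : MeasurableSet {ω | J s ω = k} :=
    measurableSet_eq_fun (hi.chain s) measurable_const
  have mT : MeasurableSet {ω | s < T ω} := measurableSet_lt measurable_const h.clock_measurable
  have mN : MeasurableSet {ω | jumpTime (fun t => J t ω) m ≤ s ∧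
      s < jumpTime (fun t => J t ω) (m + 1)} :=
    (measurableSet_le (hi.jumpTime m) measurable_const).inter
      (measurableSet_lt measurable_const (hi.jumpTime (m + 1)))
  obtain ⟨hAm, hA'⟩ := hA
  obtain ⟨A', mA', hA'⟩ := hA' m
  set N : Set (Data d) := {e | jumpTime (fun t => Data.chain t e) m ≤ s ∧
    s < jumpTime (fun t => Data.chain t e) (m + 1)}
  have mN' : MeasurableSet N :=
    (measurableSet_le (Data.measurableIngredients.jumpTime m) measurable_const).inter
      (measurableSet_lt measurable_const (Data.measurableIngredients.jumpTime (m + 1)))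
  set Xp := toData (hi.past s m) (fun _ => 0)
  set Xf := toData (hi.future s m) (fun ω => T ω - s)
  set X := toData hi T
  set YD : ℝ≥0 → Data d → ℝ := freeProcess Data.chain Data.levy Data.job
  -- The reward as a functional of past and future: the past yields the level at time `s`, from
  -- which the future path is reflected.
  set F : Data d × Data d → ℝ≥0∞ := fun p => payoff α j
    (MAPQueue.reflected K (fun t => MAPQueue.reflected K (fun t => x + YD t p.1) s + YD t p.2)
      (Data.clock p.2)) (Data.chain (Data.clock p.2) p.2)
  have mF : Measurable F := by
    refine measurable_payoff α j ?_ (Data.measurableIngredients.chain_comp measurable_snd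
      (Data.measurable_clock.comp measurable_snd))
    exact Data.measurableIngredients.reflected measurable_snd
      (Data.measurableIngredients.reflected measurable_fst measurable_const measurable_const K)
      (Data.measurable_clock.comp measurable_snd) K
  set G : Data d × Data d → ℝ≥0∞ := (Prod.fst ⁻¹' (A' ∩ N)).indicator F
  have mG : Measurable G := mF.indicator (measurable_fst (mA'.inter mN'))
  have hXp : ∀ ω, Xp ω ∈ A' ∩ N ↔ ω ∈ A ∩ {ω | jumpTime (fun t => J t ω) m ≤ s ∧
      s < jumpTime (fun t => J t ω) (m + 1)} := fun ω => by
    have e : Xp ω ∈ N ↔ jumpTime (fun t => J t ω) m ≤ s ∧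
        s < jumpTime (fun t => J t ω) (m + 1) := by
      change _ ≤ _ ∧ _ < _ ↔ _
      rw [← not_le, sojourn_past_iff hi, sojourn_past_iff hi, not_le]
    constructor
    · rintro ⟨h1, h2⟩
      have h3 := e.1 h2
      exact ⟨(hA' ω h3.1 h3.2).2 h1, h3⟩
    · rintro ⟨h1, h2⟩
      exact ⟨(hA' ω h2.1 h2.2).1 h1, e.2 h2⟩
  have hstart : ∀ ω, s < jumpTime (fun t => J t ω) (m + 1) →
      MAPQueue.reflected K (fun t => x + YD t (Xp ω)) s = V x s ω := fun ω h2 => by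
    rw [reflection_eq hi (hV x hx ω)]
    exact reflected_congr fun u hu => congrArg (x + ·) (freeProcess_past hi h2 hu)
  have key := h.lintegral_past_future hβ s k m mG
  have e1 : ∀ ω ∈ {ω | J s ω = k} ∩ {ω | s < T ω}, G (Xp ω, Xf ω)
      = (A ∩ {ω | jumpTime (fun t => J t ω) m ≤ s ∧ s < jumpTime (fun t => J t ω) (m + 1)}).indicator
        (fun ω => payoff α j (V x (T ω) ω) (J (T ω) ω)) ω := by
    intro ω hω
    have hTs : s + (T ω - s) = T ω := add_tsub_cancel_of_le (le_of_lt hω.2)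
    by_cases hm : Xp ω ∈ A' ∩ N
    · have hm' := (hXp ω).1 hm
      rw [indicator_of_mem hm']
      refine (indicator_of_mem (show (Xp ω, Xf ω) ∈ Prod.fst ⁻¹' (A' ∩ N) from hm) F).trans ?_
      change payoff α j (MAPQueue.reflected K (fun t => MAPQueue.reflected K
        (fun t => x + YD t (Xp ω)) s + YD t (Xf ω)) (T ω - s)) (J (s + (T ω - s)) ω) = _
      rw [hstart ω hm'.2.2, ← reflection_shift hi (hV x hx ω) hm'.2.1 hm'.2.2, hTs]
    · rw [indicator_of_notMem fun hc => hm ((hXp ω).2 hc)]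
      exact indicator_of_notMem (show (Xp ω, Xf ω) ∉ Prod.fst ⁻¹' (A' ∩ N) from hm) F
  have e2 : ∀ ω ∈ {ω | J s ω = k} ∩ {ω | s < T ω}, ∫⁻ ω', G (Xp ω, X ω') ∂(startAt P J k)
      = (A ∩ {ω | jumpTime (fun t => J t ω) m ≤ s ∧ s < jumpTime (fun t => J t ω) (m + 1)}).indicator
        (fun ω => value P J L B T K α j (V x s ω) (J s ω)) ω := by
    intro ω hω
    by_cases hm : Xp ω ∈ A' ∩ N
    · have hm' := (hXp ω).1 hm
      rw [indicator_of_mem hm', show J s ω = k from hω.1, value]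
      refine lintegral_congr fun ω' => ?_
      refine (indicator_of_mem (show (Xp ω, X ω') ∈ Prod.fst ⁻¹' (A' ∩ N) from hm) F).trans ?_
      change payoff α j (MAPQueue.reflected K (fun t => MAPQueue.reflected K
        (fun t => x + YD t (Xp ω)) s + YD t (X ω')) (T ω')) (J (T ω') ω') = _
      rw [hstart ω hm'.2.2]
      rfl
    · rw [indicator_of_notMem fun hc => hm ((hXp ω).2 hc)]
      refine (lintegral_congr fun ω' => ?_).trans lintegral_zero
      exact indicator_of_notMem (show (Xp ω, X ω') ∉ Prod.fst ⁻¹' (A' ∩ N) from hm) F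
  rw [setLIntegral_congr_fun (mJ.inter mT) e1, setLIntegral_congr_fun (mJ.inter mT) e2,
    lintegral_indicator (hAm.inter mN), lintegral_indicator (hAm.inter mN),
    Measure.restrict_restrict (hAm.inter mN), inter_comm] at key
  exact key

/-- The Markov property of the reflected process at a fixed time `s`. -/
theorem IsModel.markov (h : IsModel P Q β J L B T) (hβ : 0 < β)
    (hV : ∀ x ∈ Icc 0 K, ∀ ω,
      IsDoublyReflected K x (fun t => freeProcess J L B t ω) (fun t => V x t ω))
    {x : ℝ} (hx : x ∈ Icc 0 K) (α : ℝ) (j : Fin d) {s : ℝ≥0} {A : Set Ω}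
    (hA : IsPastEvent h.ingredients s A) :
    ∫⁻ ω in A ∩ {ω | s < T ω}, payoff α j (V x (T ω) ω) (J (T ω) ω) ∂P
      = ∫⁻ ω in A ∩ {ω | s < T ω}, value P J L B T K α j (V x s ω) (J s ω) ∂P := by
  have hi := h.ingredients
  -- Split by the state at time `s` and by the number of jumps so far, because only for a fixed
  -- number of jumps is it known which jobs belong to the past.
  set E : Fin d × ℕ → Set Ω := fun p => {ω | J s ω = p.1} ∩ {ω | s < T ω} ∩
    (A ∩ {ω | jumpTime (fun t => J t ω) p.2 ≤ s ∧ s < jumpTime (fun t => J t ω) (p.2 + 1)})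
  have mE : ∀ p, MeasurableSet (E p) := fun p =>
    ((measurableSet_eq_fun (hi.chain s) measurable_const).inter
      (measurableSet_lt measurable_const h.clock_measurable)).inter
      (hA.1.inter ((measurableSet_le (hi.jumpTime _) measurable_const).inter
        (measurableSet_lt measurable_const (hi.jumpTime _))))
  have hU : A ∩ {ω | s < T ω} = ⋃ p, E p := by
    ext ω
    simp only [mem_iUnion, E, mem_inter_iff, mem_ofPred_eq, Prod.exists]
    constructor
    · rintro ⟨h1, h2⟩
      obtain ⟨m, hm⟩ := (hi.chain_cadlag ω).exists_sojourn s
      exact ⟨J s ω, m, ⟨rfl, h2⟩, h1, hm⟩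
    · rintro ⟨k, m, ⟨-, h2⟩, h1, -⟩
      exact ⟨h1, h2⟩
  have hd : Pairwise (Function.onFun Disjoint E) := by
    rintro ⟨k, m⟩ ⟨k', m'⟩ hne
    refine disjoint_left.2 fun ω h1 h2 => hne ?_
    have e1 : k = k' := h1.1.1.symm.trans h2.1.1
    have e2 : ∀ {a b : ℕ}, jumpTime (fun t => J t ω) b ≤ s →
        s < jumpTime (fun t => J t ω) (a + 1) → b ≤ a := fun {a b} hb ha => by
      by_contra! hab
      exact absurd ((jumpTime_mono _ hab).trans hb) (not_le.2 ha)
    exact Prod.ext e1 (le_antisymm (e2 h1.2.2.1 h2.2.2.2) (e2 h2.2.2.1 h1.2.2.2))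
  rw [hU, lintegral_iUnion mE hd, lintegral_iUnion mE hd]
  exact tsum_congr fun p => h.markov_sojourn hβ hV hx α j p.1 hA p.2

end Markov

/-! ### The strong Markov property at the exit time -/

section StrongMarkov

variable {d : ℕ} {Ω : Type*} [mΩ : MeasurableSpace Ω] {P : Measure Ω}
  {Q : Matrix (Fin d) (Fin d) ℝ} {α β K : ℝ} {J : ℝ≥0 → Ω → Fin d} {L : Fin d → ℝ≥0 → Ω → ℝ}
  {B : ℕ → Fin d → Fin d → Ω → ℝ} {T : Ω → ℝ≥0} {V : ℝ → ℝ≥0 → Ω → ℝ}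

theorem MeasurableIngredients.exitTime (h : MeasurableIngredients J L B) (K x : ℝ) :
    Measurable fun ω => MAPQueue.exitTime K (fun t => x + MAPQueue.freeProcess J L B t ω) :=
  measurable_exitTime K (φ := fun t ω => x + MAPQueue.freeProcess J L B t ω)
    (fun t => measurable_const.add (h.freeProcess_measurable t))
    fun ω t => continuousWithinAt_const.add (h.freeProcess_rightContinuous ω t)

theorem MeasurableIngredients.reflection_at (h : MeasurableIngredients J L B)
    {x : ℝ} {v : ℝ≥0 → Ω → ℝ}
    (hv : ∀ ω, IsDoublyReflected K x (fun t => MAPQueue.freeProcess J L B t ω) (fun t => v t ω))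
    {τ : Ω → ℝ≥0} (hτ : Measurable τ) : Measurable fun ω => v (τ ω) ω := by
  simp only [reflection_eq h (hv _)]
  exact h.reflected measurable_id measurable_const hτ K

theorem measurable_comp_level_state {g : ℝ → Fin d → ℝ≥0∞} (hg : ∀ k, Measurable fun v => g v k)
    {w : Ω → ℝ} (hw : Measurable w) {k : Ω → Fin d} (hk : Measurable k) :
    Measurable fun ω => g (w ω) (k ω) := by
  have h1 : Measurable fun p : Fin d × ℝ => g p.2 p.1 := measurable_from_prod_countable_right hg
  exact h1.comp (hk.prodMk hw)

theorem value_eq (h : MeasurableIngredients J L B)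
    (hV : ∀ x ∈ Icc 0 K, ∀ ω,
      IsDoublyReflected K x (fun t => freeProcess J L B t ω) (fun t => V x t ω))
    {v : ℝ} (hv : v ∈ Icc 0 K) (α : ℝ) (j k : Fin d) :
    value P J L B T K α j v k
      = ∫⁻ ω, payoff α j (V v (T ω) ω) (J (T ω) ω) ∂(startAt P J k) :=
  lintegral_congr fun ω => by rw [reflection_eq h (hV v hv ω)]

theorem IsDoublyReflected.mem {K x : ℝ} {y v : ℝ≥0 → ℝ} (h : IsDoublyReflected K x y v) (t : ℝ≥0) :
    v t ∈ Icc 0 K := by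
  obtain ⟨Um, Up, -, -, -, h4, -⟩ := h
  exact h4 t

theorem continuous_payoff (α : ℝ) (j i : Fin d) : Continuous fun w => payoff α j w i := by
  unfold payoff
  split_ifs
  · exact ENNReal.continuous_ofReal.comp (Real.continuous_exp.comp (continuous_const_mul _))
  · exact continuous_const

theorem value_le_one (h : MeasurableIngredients J L B) (hα : 0 ≤ α)
    (hV : ∀ x ∈ Icc 0 K, ∀ ω,
      IsDoublyReflected K x (fun t => freeProcess J L B t ω) (fun t => V x t ω))
    {v : ℝ} (hv : v ∈ Icc 0 K) (j k : Fin d) : value P J L B T K α j v k ≤ 1 := by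
  rw [value_eq h hV hv]
  refine (lintegral_mono fun ω => payoff_le_one hα j ((hV v hv ω).mem _).1 _).trans ?_
  rw [lintegral_one]
  exact prob_le_one (μ := P[|{ω | J 0 ω = k}])

variable [IsProbabilityMeasure P]

/-- Path by path the reflection is Lipschitz in its starting level, and rewards are at most `1`, so
dominated convergence applies. -/
theorem IsModel.tendsto_value (h : IsModel P Q β J L B T) (hα : 0 ≤ α)
    (hV : ∀ x ∈ Icc 0 K, ∀ ω,
      IsDoublyReflected K x (fun t => freeProcess J L B t ω) (fun t => V x t ω))
    {v : ℕ → ℝ} (hv : ∀ n, v n ∈ Icc 0 K) {w : ℝ} (hw : w ∈ Icc 0 K)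
    (hvw : Tendsto v atTop (𝓝 w)) (j k : Fin d) :
    Tendsto (fun n => value P J L B T K α j (v n) k) atTop
      (𝓝 (value P J L B T K α j w k)) := by
  have hi := h.ingredients
  have : IsProbabilityMeasure (startAt P J k) := cond_isProbabilityMeasure (h.start k)
  simp only [value_eq hi hV hw, value_eq hi hV (hv _)]
  refine tendsto_lintegral_of_dominated_convergence (fun _ => 1)
    (fun n => measurable_payoff α j (hi.reflection_at (hV _ (hv n)) h.clock_measurable)
      (hi.chain_at h.clock_measurable))
    (fun n => ae_of_all _ fun ω => payoff_le_one hα j ((hV _ (hv n) ω).mem _).1 _)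
    (by simp) (ae_of_all _ fun ω => ?_)
  refine ((continuous_payoff α j _).tendsto _).comp (tendsto_iff_dist_tendsto_zero.2 ?_)
  obtain ⟨Um, Up, hR⟩ := (hV w hw ω).exists_isReflection
  refine squeeze_zero (fun _ => dist_nonneg) (g := fun n => 2 * |v n - w|) (fun n => ?_) ?_
  · obtain ⟨Um', Up', hR'⟩ := (hV _ (hv n) ω).exists_isReflection
    exact hR'.abs_sub_le hR (hi.freeProcess_rightContinuous ω) (T ω)
  · have := (tendsto_iff_dist_tendsto_zero.1 hvw).const_mul 2
    simpa [Real.dist_eq] using this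

/-- The Markov property at the first grid time after the exit time. -/
theorem IsModel.markov_gridAfter (h : IsModel P Q β J L B T) (hβ : 0 < β)
    (hV : ∀ x ∈ Icc 0 K, ∀ ω,
      IsDoublyReflected K x (fun t => freeProcess J L B t ω) (fun t => V x t ω))
    {x : ℝ} (hx : x ∈ Icc 0 K) (α : ℝ) (i j : Fin d) {ρ : Ω → ℝ≥0∞}
    (hρ : ρ = fun ω => exitTime K fun t => x + freeProcess J L B t ω) (n : ℕ) :
    ∫⁻ ω in {ω | J 0 ω = i ∧ ρ ω ≠ ∞ ∧ gridAfter n (ρ ω).toNNReal < T ω},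
        payoff α j (V x (T ω) ω) (J (T ω) ω) ∂P
      = ∫⁻ ω in {ω | J 0 ω = i ∧ ρ ω ≠ ∞ ∧ gridAfter n (ρ ω).toNNReal < T ω},
        value P J L B T K α j (V x (gridAfter n (ρ ω).toNNReal) ω)
          (J (gridAfter n (ρ ω).toNNReal) ω) ∂P := by
  have hi := h.ingredients
  -- On `A κ` the first grid time after the exit is the deterministic time `gridTime n κ`, at which
  -- `A κ` belongs to the past.
  set A : ℕ → Set Ω := fun κ => {ω | J 0 ω = i} ∩
    {ω | ((κ / (n + 1) : ℝ≥0) : ℝ≥0∞) ≤ exitTime K (fun t => x + freeProcess J L B t ω)} ∩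
    {ω | exitTime K (fun t => x + freeProcess J L B t ω) < gridTime n κ}
  have hA : ∀ κ, IsPastEvent hi (gridTime n κ) (A κ) := fun κ =>
    isPastEvent_exit hi K x i (by rw [gridTime]; gcongr; simp)
  have mE : ∀ κ, MeasurableSet (A κ ∩ {ω | gridTime n κ < T ω}) := fun κ =>
    (hA κ).1.inter (measurableSet_lt measurable_const h.clock_measurable)
  have mem : ∀ κ ω, ω ∈ A κ ↔ J 0 ω = i ∧ ρ ω ≠ ∞ ∧ gridIndex n (ρ ω).toNNReal = κ := by
    intro κ ω
    simp only [A, mem_inter_iff, mem_ofPred_eq, ← congrFun hρ ω, and_assoc, gridIndex_eq_iff]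
    refine and_congr_right fun _ => ?_
    constructor
    · rintro ⟨h1, h2⟩
      have h3 : ρ ω ≠ ∞ := (h2.trans ENNReal.coe_lt_top).ne
      rw [← ENNReal.coe_toNNReal h3, ENNReal.coe_le_coe] at h1
      rw [← ENNReal.coe_toNNReal h3, ENNReal.coe_lt_coe] at h2
      exact ⟨h3, h1, h2⟩
    · rintro ⟨h3, h1, h2⟩
      rw [← ENNReal.coe_toNNReal h3, ENNReal.coe_le_coe, ENNReal.coe_lt_coe]
      exact ⟨h1, h2⟩
  have hU : {ω | J 0 ω = i ∧ ρ ω ≠ ∞ ∧ gridAfter n (ρ ω).toNNReal < T ω}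
      = ⋃ κ, A κ ∩ {ω | gridTime n κ < T ω} := by
    ext ω
    simp only [mem_iUnion, mem_inter_iff, mem]
    constructor
    · rintro ⟨h1, h2, h3⟩
      exact ⟨_, ⟨h1, h2, rfl⟩, h3⟩
    · rintro ⟨κ, ⟨h1, h2, rfl⟩, h3⟩
      exact ⟨h1, h2, h3⟩
  have hd : Pairwise (Function.onFun Disjoint fun κ => A κ ∩ {ω | gridTime n κ < T ω}) := by
    intro κ κ' hne
    refine disjoint_left.2 fun ω h1 h2 => hne ?_
    exact ((mem κ ω).1 h1.1).2.2.symm.trans ((mem κ' ω).1 h2.1).2.2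
  rw [hU, lintegral_iUnion mE hd, lintegral_iUnion mE hd]
  refine tsum_congr fun κ => (h.markov hβ hV hx α j (hA κ)).trans ?_
  refine setLIntegral_congr_fun (mE κ) fun ω hω => ?_
  have e : gridAfter n (ρ ω).toNNReal = gridTime n κ := by
    rw [gridAfter, ((mem κ ω).1 hω.1).2.2]
  simp only [e]

/-- The strong Markov property at the exit time. -/
theorem IsModel.strong_markov (h : IsModel P Q β J L B T) (hα : 0 ≤ α) (hβ : 0 < β)
    (hV : ∀ x ∈ Icc 0 K, ∀ ω,
      IsDoublyReflected K x (fun t => freeProcess J L B t ω) (fun t => V x t ω))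
    {x : ℝ} (hx : x ∈ Icc 0 K) (i j : Fin d) {ρ : Ω → ℝ≥0∞}
    (hρ : ρ = fun ω => exitTime K fun t => x + freeProcess J L B t ω) :
    ∫⁻ ω in {ω | J 0 ω = i ∧ ρ ω < T ω}, payoff α j (V x (T ω) ω) (J (T ω) ω) ∂P
      = ∫⁻ ω in {ω | J 0 ω = i ∧ ρ ω < T ω},
        value P J L B T K α j (V x (ρ ω).toNNReal ω) (J (ρ ω).toNNReal ω) ∂P := by
  have hi := h.ingredients
  have mρ : Measurable ρ := hρ ▸ hi.exitTime K x
  have mρ' : Measurable fun ω => (ρ ω).toNNReal := mρ.ennreal_toNNReal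
  have mg : ∀ n, Measurable fun ω => gridAfter n (ρ ω).toNNReal := fun n =>
    (measurable_gridAfter n).comp mρ'
  set E : ℕ → Set Ω := fun n => {ω | J 0 ω = i ∧ ρ ω ≠ ∞ ∧ gridAfter n (ρ ω).toNNReal < T ω}
  set E' : Set Ω := {ω | J 0 ω = i ∧ ρ ω < T ω}
  have m0 : MeasurableSet {ω | J 0 ω = i} := measurableSet_eq_fun (hi.chain 0) measurable_const
  have mE : ∀ n, MeasurableSet (E n) := fun n => by
    have h1 : MeasurableSet {ω | gridAfter n (ρ ω).toNNReal < T ω} :=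
      measurableSet_lt (mg n) h.clock_measurable
    exact m0.inter ((mρ (measurableSet_singleton ∞)).compl.inter h1)
  have mE' : MeasurableSet E' :=
    m0.inter (measurableSet_lt mρ h.clock_measurable.coe_nnreal_ennreal)
  -- Grid times lie strictly after the exit, so `E n ⊆ E'`; they converge to it, so a clock that
  -- outlives the exit outlives them for large `n`.
  have hE : ∀ ω, ∀ᶠ n in atTop, ω ∈ E n ↔ ω ∈ E' := by
    intro ω
    by_cases hω : ω ∈ E'
    · have h3 : ρ ω ≠ ∞ := (hω.2.trans ENNReal.coe_lt_top).ne
      have h4 : (ρ ω).toNNReal < T ω := by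
        rw [← ENNReal.coe_lt_coe, ENNReal.coe_toNNReal h3]; exact hω.2
      filter_upwards [(tendsto_gridAfter (ρ ω).toNNReal).mono_right nhdsWithin_le_nhds |>.eventually
        (gt_mem_nhds h4)] with n hn
      exact iff_of_true ⟨hω.1, h3, hn⟩ hω
    · refine Eventually.of_forall fun n => iff_of_false (fun hn => hω ⟨hn.1, ?_⟩) hω
      rw [← ENNReal.coe_toNNReal hn.2.1, ENNReal.coe_lt_coe]
      exact (lt_gridAfter n _).trans hn.2.2
  have mF : Measurable fun ω => payoff α j (V x (T ω) ω) (J (T ω) ω) :=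
    measurable_payoff α j (hi.reflection_at (hV x hx) h.clock_measurable)
      (hi.chain_at h.clock_measurable)
  have lim1 : Tendsto (fun n => ∫⁻ ω in E n, payoff α j (V x (T ω) ω) (J (T ω) ω) ∂P) atTop
      (𝓝 (∫⁻ ω in E', payoff α j (V x (T ω) ω) (J (T ω) ω) ∂P)) := by
    simp only [← lintegral_indicator (mE _), ← lintegral_indicator mE']
    refine tendsto_lintegral_of_dominated_convergence (fun _ => 1)
      (fun n => mF.indicator (mE n)) (fun n => ae_of_all _ fun ω => ?_) (by simp)
      (ae_of_all _ fun ω => tendsto_const_nhds.congr' ?_)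
    · exact indicator_apply_le' (fun _ => payoff_le_one hα j ((hV x hx ω).mem _).1 _)
        fun _ => zero_le
    · filter_upwards [hE ω] with n hn
      simp only [indicator, hn]
  have lim2 : Tendsto (fun n => ∫⁻ ω in E n, value P J L B T K α j
        (V x (gridAfter n (ρ ω).toNNReal) ω) (J (gridAfter n (ρ ω).toNNReal) ω) ∂P) atTop
      (𝓝 (∫⁻ ω in E', value P J L B T K α j (V x (ρ ω).toNNReal ω)
        (J (ρ ω).toNNReal ω) ∂P)) := by
    simp only [← lintegral_indicator (mE _), ← lintegral_indicator mE']
    refine tendsto_lintegral_of_dominated_convergence (fun _ => 1)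
      (fun n => (measurable_comp_level_state (h.measurable_value K α j)
        (hi.reflection_at (hV x hx) (mg n))        (hi.chain_at (mg n))).indicator (mE n))
      (fun n => ae_of_all _ fun ω => ?_) (by simp) (ae_of_all _ fun ω => ?_)
    · exact indicator_apply_le' (fun _ => value_le_one hi hα hV ((hV x hx ω).mem _) j _)
        fun _ => zero_le
    · have hg := (tendsto_gridAfter (ρ ω).toNNReal).mono_right
        (nhdsWithin_mono _ (Ioi_subset_Ici_self))
      -- By right continuity the level converges while the discrete state becomes constant; then
      -- continuity of `value` in the level suffices.
      have hVt : Tendsto (fun n => V x (gridAfter n (ρ ω).toNNReal) ω) atTop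
          (𝓝 (V x (ρ ω).toNNReal ω)) :=
        ((hV x hx ω).rightContinuous (hi.freeProcess_rightContinuous ω) _).tendsto.comp hg
      have hJt : ∀ᶠ n in atTop, J (gridAfter n (ρ ω).toNNReal) ω = J (ρ ω).toNNReal ω :=
        (((hi.chain_cadlag ω).1 _).tendsto.comp hg).eventually
          (isOpen_discrete {J (ρ ω).toNNReal ω} |>.mem_nhds rfl)
      by_cases hω : ω ∈ E'
      · rw [indicator_of_mem hω]
        refine (h.tendsto_value hα hV (fun n => (hV x hx ω).mem _) ((hV x hx ω).mem _) hVt j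
          (J (ρ ω).toNNReal ω)).congr' ?_
        filter_upwards [hE ω, hJt] with n hn hJn
        rw [indicator_of_mem (hn.2 hω), hJn]
      · rw [indicator_of_notMem hω]
        refine tendsto_const_nhds.congr' ?_
        filter_upwards [hE ω] with n hn
        rw [indicator_of_notMem fun hc => hω (hn.1 hc)]
  refine tendsto_nhds_unique lim1 (lim2.congr fun n => ?_)
  exact (h.markov_gridAfter hβ hV hx α i j hρ n).symm

end StrongMarkov

/-! ### Leaving the interval through its two ends -/

section Exit

theorem firstTime_union (S S' : Set ℝ≥0) :
    firstTime (S ∪ S') = min (firstTime S) (firstTime S') := iInf_union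

theorem exitTime_eq_min (K x : ℝ) (y : ℝ≥0 → ℝ) :
    exitTime K (fun t => x + y t) = min (dropTime y x) (exceedTime y (K - x)) := by
  rw [exitTime, dropTime, exceedTime, ← firstTime_union]
  congr 1
  ext t
  simp only [mem_ofPred_eq, mem_union, mem_Icc, not_and_or, not_le, gt_iff_lt]
  exact or_congr ⟨fun h => by linarith, fun h => by linarith⟩
    ⟨fun h => by linarith, fun h => by linarith⟩

theorem mem_of_lt_exitTime {K : ℝ} {φ : ℝ≥0 → ℝ} {u : ℝ≥0} (h : u < exitTime K φ) :
    φ u ∈ Icc 0 K := by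
  by_contra hu
  exact absurd (firstTime_le (S := {t | φ t ∉ Icc 0 K}) hu) (not_le.2 h)

/-- If `f s < c`, right continuity would keep `f` below `c` for a while after `s`, and the first
time would be later than `s`. -/
theorem le_at_firstTime {f : ℝ≥0 → ℝ} (hf : ∀ t, ContinuousWithinAt f (Ici t) t) {c : ℝ} {s : ℝ≥0}
    (hs : firstTime {t | f t > c} = s) : c ≤ f s := by
  by_contra! hlt
  obtain ⟨b, hb, hsub⟩ := mem_nhdsGE_iff_exists_Ico_subset.1
    ((hf s).eventually (gt_mem_nhds hlt))
  have h1 : (b : ℝ≥0∞) ≤ firstTime {t | f t > c} := by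
    refine le_firstTime_iff.2 fun t ht => ENNReal.coe_le_coe.2 ?_
    by_contra! htb
    have hlt' : f t < c := hsub ⟨?_, htb⟩
    · exact lt_asymm hlt' ht
    have := firstTime_le ht
    rwa [hs, ENNReal.coe_le_coe] at this
  rw [hs, ENNReal.coe_le_coe] at h1
  exact absurd hb (not_lt.2 h1)

variable {K x : ℝ} {y v : ℝ≥0 → ℝ}

/-- This is where the absence of downward jumps enters. Right continuity gives `x + y ≤ 0` at the
passage time and `hdrop` gives `x + y ≥ 0`; so the free path is still in `[0, K]` there and the
reflection has not modified it. -/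
theorem eq_zero_of_dropTime (hx : x ∈ Icc 0 K) (hy0 : y 0 = 0)
    (hy : ∀ t, ContinuousWithinAt y (Ici t) t)
    (hdrop : ∀ t, 0 < t → ∀ ε > 0, ∀ᶠ u in 𝓝[<] t, y u < y t + ε)
    (hv : IsDoublyReflected K x y v) (h1 : dropTime y x ≤ exceedTime y (K - x))
    (h2 : dropTime y x ≠ ∞) : v (dropTime y x).toNNReal = 0 := by
  obtain ⟨Um, Up, hR⟩ := hv.exists_isReflection
  obtain ⟨s, hs⟩ : ∃ s : ℝ≥0, (s : ℝ≥0∞) = _ := ⟨_, ENNReal.coe_toNNReal h2⟩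
  rw [← hs, ENNReal.toNNReal_coe]
  have hmem : ∀ u < s, x + y u ∈ Icc 0 K := fun u hu => by
    refine mem_of_lt_exitTime (K := K) (φ := fun t => x + y t) ?_
    rw [exitTime_eq_min, min_eq_left h1, ← hs]
    exact ENNReal.coe_lt_coe.2 hu
  have hle : x ≤ -y s := le_at_firstTime (f := fun t => -y t) (fun t => (hy t).neg) hs.symm
  have hge : 0 ≤ x + y s := by
    rcases eq_or_lt_of_le (zero_le (a := s)) with h0 | h0
    · rw [← h0, hy0, add_zero]; exact hx.1
    · refine le_of_forall_pos_le_add fun ε hε => ?_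
      have : (𝓝[<] s).NeBot := nhdsLT_neBot_of_exists_lt ⟨0, h0⟩
      obtain ⟨u, h3, h4⟩ := ((hdrop s h0 ε hε).and self_mem_nhdsWithin).exists
      have := (hmem u h4).1
      linarith
  have he : x + y s = 0 := by linarith
  have hall : ∀ u ≤ s, x + y u ∈ Icc 0 K := fun u hu => by
    rcases eq_or_lt_of_le hu with rfl | hu
    · rw [he]; exact ⟨le_rfl, hx.1.trans hx.2⟩
    · exact hmem u hu
  rw [hR.eq_of_mem (fun u hu => (hall u hu).1) fun u hu => (hall u hu).2, he]

/-- An overshoot is possible here, but the regulator removes the excess whatever its size. -/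
theorem eq_of_exceedTime (hK : 0 ≤ K) (hy : ∀ t, ContinuousWithinAt y (Ici t) t)
    (hv : IsDoublyReflected K x y v) (h1 : exceedTime y (K - x) ≤ dropTime y x)
    (h2 : exceedTime y (K - x) ≠ ∞) : v (exceedTime y (K - x)).toNNReal = K := by
  obtain ⟨Um, Up, hR⟩ := hv.exists_isReflection
  obtain ⟨s, hs⟩ : ∃ s : ℝ≥0, (s : ℝ≥0∞) = _ := ⟨_, ENNReal.coe_toNNReal h2⟩
  rw [← hs, ENNReal.toNNReal_coe]
  have hmem : ∀ u < s, x + y u ∈ Icc 0 K := fun u hu => by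
    refine mem_of_lt_exitTime (K := K) (φ := fun t => x + y t) ?_
    rw [exitTime_eq_min, min_eq_right h1, ← hs]
    exact ENNReal.coe_lt_coe.2 hu
  have hle : K - x ≤ y s := le_at_firstTime hy hs.symm
  refine hR.eq_upper (fun u hu => ?_) (fun u hu => (hmem u hu).2) (by linarith)
  rcases eq_or_lt_of_le hu with rfl | hu
  · linarith
  · exact (hmem u hu).1

theorem eq_of_lt_exitTime (hv : IsDoublyReflected K x y v) {t : ℝ≥0}
    (ht : t < exitTime K fun t => x + y t) : v t = x + y t := by
  obtain ⟨Um, Up, hR⟩ := hv.exists_isReflection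
  have hmem : ∀ u ≤ t, x + y u ∈ Icc 0 K := fun u hu =>
    mem_of_lt_exitTime (φ := fun t => x + y t) ((ENNReal.coe_le_coe.2 hu).trans_lt ht)
  exact hR.eq_of_mem (fun u hu => (hmem u hu).1) fun u hu => (hmem u hu).2

/-- The reward at the exit time, decomposed according to the end through which the path leaves. -/
theorem exit_decomposition {d : ℕ} (hK : 0 < K) (hx : x ∈ Icc 0 K) (hy0 : y 0 = 0)
    (hy : ∀ t, ContinuousWithinAt y (Ici t) t)
    (hdrop : ∀ t, 0 < t → ∀ ε > 0, ∀ᶠ u in 𝓝[<] t, y u < y t + ε)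
    (hv : IsDoublyReflected K x y v) (l : ℝ≥0 → Fin d) (g : ℝ → Fin d → ℝ≥0∞) {t : ℝ≥0}
    (ht : (t : ℝ≥0∞) ≠ exitTime K fun t => x + y t) :
    open Classical in
    (if (exitTime K fun t => x + y t) < t then
      g (v (exitTime K fun t => x + y t).toNNReal) (l (exitTime K fun t => x + y t).toNNReal)
      else 0)
      = ∑ k, ((if dropTime y x ≤ min (exceedTime y (K - x)) t ∧
          l (dropTime y x).toNNReal = k then g 0 k else 0)
        + if exceedTime y (K - x) ≤ min (dropTime y x) t ∧
          l (exceedTime y (K - x)).toNNReal = k then g K k else 0) := by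
  rw [exitTime_eq_min] at ht ⊢
  rcases lt_or_gt_of_ne ht with hlt | hlt
  · rw [if_neg (not_lt.2 hlt.le)]
    symm
    refine Finset.sum_eq_zero fun k _ => ?_
    rw [if_neg fun hc => ?_, if_neg fun hc => ?_, add_zero]
    · exact absurd ((hlt.trans_le (min_le_right _ _)).trans_le (hc.1.trans (min_le_right _ _)))
        (lt_irrefl _)
    · exact absurd ((hlt.trans_le (min_le_left _ _)).trans_le (hc.1.trans (min_le_right _ _)))
        (lt_irrefl _)
  · rw [if_pos hlt]
    -- If both passage times coincided, the reflected path would be at `0` and at `K`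
    -- simultaneously.
    have hne : ¬ (dropTime y x ≤ exceedTime y (K - x) ∧ exceedTime y (K - x) ≤ dropTime y x) := by
      rintro ⟨h1, h2⟩
      rw [min_eq_left h1] at hlt
      have hf : dropTime y x ≠ ∞ := (hlt.trans ENNReal.coe_lt_top).ne
      have e := le_antisymm h1 h2
      have z := eq_zero_of_dropTime hx hy0 hy hdrop hv h1 hf
      rw [e] at z hf
      exact hK.ne (z.symm.trans (eq_of_exceedTime hK.le hy hv h2 hf))
    rcases le_total (dropTime y x) (exceedTime y (K - x)) with h1 | h1
    · rw [min_eq_left h1] at hlt ⊢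
      rw [eq_zero_of_dropTime hx hy0 hy hdrop hv h1 (hlt.trans ENNReal.coe_lt_top).ne,
        Finset.sum_eq_single (l (dropTime y x).toNNReal)]
      · rw [if_pos ⟨le_min h1 hlt.le, rfl⟩,
          if_neg fun hc => hne ⟨h1, hc.1.trans (min_le_left _ _)⟩, add_zero]
      · intro k _ hk
        rw [if_neg fun hc => hk hc.2.symm,
          if_neg fun hc => hne ⟨h1, hc.1.trans (min_le_left _ _)⟩, add_zero]
      · exact fun hc => absurd (Finset.mem_univ _) hc
    · rw [min_eq_right h1] at hlt ⊢
      rw [eq_of_exceedTime hK.le hy hv h1 (hlt.trans ENNReal.coe_lt_top).ne,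
        Finset.sum_eq_single (l (exceedTime y (K - x)).toNNReal)]
      · rw [if_neg fun hc => hne ⟨hc.1.trans (min_le_left _ _), h1⟩,
          if_pos ⟨le_min h1 hlt.le, rfl⟩, zero_add]
      · intro k _ hk
        rw [if_neg fun hc => hne ⟨hc.1.trans (min_le_left _ _), h1⟩,
          if_neg fun hc => hk hc.2.symm, add_zero]
      · exact fun hc => absurd (Finset.mem_univ _) hc

end Exit

/-! ### The decomposition at the exit time -/

/-- Measurability of the exit time holds for any σ-algebra that makes the ingredients measurable;
here it is applied to one that need not know the clock. -/
theorem comap_exitTime_le {d : ℕ} {Ω : Type*} {m : MeasurableSpace Ω} {J : ℝ≥0 → Ω → Fin d}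
    {L : Fin d → ℝ≥0 → Ω → ℝ} {B : ℕ → Fin d → Fin d → Ω → ℝ} {T : Ω → ℝ≥0}
    (hle : ∀ r ≠ Source.clock, sourceSigma J L B T r ≤ m) (hJ : ∀ ω, IsCadlag fun t => J t ω)
    (hL : ∀ i ω, IsCadlag fun t => L i t ω) (K x : ℝ) :
    MeasurableSpace.comap (fun ω => exitTime K fun t => x + freeProcess J L B t ω) inferInstance
      ≤ m := by
  refine (MeasurableIngredients.exitTime ⟨fun t => ?_, hJ, fun i t => ?_, hL, fun n i k => ?_⟩
    K x).comap_le
  · exact Measurable.mono (comap_measurable (J t))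
      ((le_iSup (fun u => MeasurableSpace.comap (J u) ⊤) t).trans (hle .chain (by simp))) le_rfl
  · exact Measurable.mono (comap_measurable (L i t))
      ((le_iSup (fun u => MeasurableSpace.comap (L i u) inferInstance) t).trans
        (hle (.levy i) (by simp))) le_rfl
  · exact Measurable.mono (comap_measurable (B n i k)) (hle (.job n i k) (by simp)) le_rfl

section Decomposition

variable {d : ℕ} {Ω : Type*} [mΩ : MeasurableSpace Ω] {P : Measure Ω}
  {Q : Matrix (Fin d) (Fin d) ℝ} {α β K : ℝ} {J : ℝ≥0 → Ω → Fin d} {L : Fin d → ℝ≥0 → Ω → ℝ}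
  {B : ℕ → Fin d → Fin d → Ω → ℝ} {T : Ω → ℝ≥0} {V : ℝ → ℝ≥0 → Ω → ℝ}

/-- The clock does not ring at the exit time. -/
theorem IsModel.clock_ne_exitTime [IsProbabilityMeasure P] (h : IsModel P Q β J L B T) (x : ℝ) :
    ∀ᵐ ω ∂P, (T ω : ℝ≥0∞) ≠ exitTime K fun t => x + freeProcess J L B t ω := by
  set ρ : Ω → ℝ≥0∞ := fun ω => exitTime K fun t => x + freeProcess J L B t ω
  have mρ : Measurable ρ := h.ingredients.exitTime K x
  have hind : IndepFun ρ T P := by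
    rw [IndepFun_iff_Indep]
    have h1 := indep_iSup_of_disjoint (sourceSigma_le h.ingredients h.clock_measurable) h.indep
      (S := {Source.clock}ᶜ) (T := {Source.clock}) disjoint_compl_left
    refine indep_of_indep_of_le_left (indep_of_indep_of_le_right h1 ?_) ?_
    · exact le_iSup₂ (f := fun r (_ : r ∈ ({Source.clock} : Set (Source d))) =>
        sourceSigma J L B T r) Source.clock rfl
    · exact comap_exitTime_le (fun r hr => le_iSup₂
        (f := fun r (_ : r ∈ ({Source.clock}ᶜ : Set (Source d))) => sourceSigma J L B T r) r hr)
        h.chain.cadlag (fun i => (h.levy i).cadlag) K x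
  have hS : MeasurableSet {p : ℝ≥0∞ × ℝ≥0 | (p.2 : ℝ≥0∞) = p.1} :=
    measurableSet_eq_fun measurable_snd.coe_nnreal_ennreal measurable_fst
  have h2 := (indepFun_iff_map_prod_eq_prod_map_map mρ.aemeasurable
    h.clock_measurable.aemeasurable).1 hind
  have := Measure.isProbabilityMeasure_map (μ := P) h.clock_measurable.aemeasurable
  -- By independence the pair has a product law; given the exit time, the clock would have to hit
  -- one prescribed point, which has probability zero, and it never takes the value `∞`.
  have h3 : (P.map fun ω => (ρ ω, T ω)) {p : ℝ≥0∞ × ℝ≥0 | (p.2 : ℝ≥0∞) = p.1} = 0 := by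
    rw [h2, Measure.measure_prod_null hS]
    refine ae_of_all _ fun r => ?_
    change (P.map T) (Prod.mk r ⁻¹' {p : ℝ≥0∞ × ℝ≥0 | (p.2 : ℝ≥0∞) = p.1}) = 0
    rw [Measure.map_apply h.clock_measurable (measurable_prodMk_left hS)]
    by_cases hr : r = ∞
    · subst hr
      simp
    · lift r to ℝ≥0 using hr
      simpa [preimage] using clock_eq_zero h.clock_measurable h.clock_law r
  rw [Measure.map_apply (mρ.prodMk h.clock_measurable) hS] at h3
  rw [ae_iff]
  simpa using h3

theorem IsModel.freeProcess_no_drop (h : IsModel P Q β J L B T) (ω : Ω) (t : ℝ≥0) (ht : 0 < t)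
    (ε : ℝ) (hε : ε > 0) :
    ∀ᶠ u in 𝓝[<] t, freeProcess J L B u ω < freeProcess J L B t ω + ε :=
  freePath_no_drop (h.ingredients.chain_cadlag ω) (fun i => (h.levy i).cadlag ω)
    (fun i => (h.levy i).no_negative_jumps ω) (fun n i k => h.job_nonneg n i k ω) ht hε

theorem MeasurableIngredients.dropTime (h : MeasurableIngredients J L B) (u : ℝ) :
    Measurable fun ω => MAPQueue.dropTime (MAPQueue.freeProcess J L B · ω) u :=
  measurable_firstTime (fun t => measurableSet_lt measurable_const (h.freeProcess_measurable t).neg)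
    fun ω t ht => ((h.freeProcess_rightContinuous ω t).neg.mono Ioi_subset_Ici_self).eventually
      (lt_mem_nhds ht)

theorem MeasurableIngredients.exceedTime (h : MeasurableIngredients J L B) (u : ℝ) :
    Measurable fun ω => MAPQueue.exceedTime (MAPQueue.freeProcess J L B · ω) u :=
  measurable_firstTime (fun t => measurableSet_lt measurable_const (h.freeProcess_measurable t))
    fun ω t ht => ((h.freeProcess_rightContinuous ω t).mono Ioi_subset_Ici_self).eventually
      (lt_mem_nhds ht)

/-- The strong Markov property under the law of the process started in state `i`. -/
theorem IsModel.strong_markov_startAt [IsProbabilityMeasure P] (h : IsModel P Q β J L B T)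
    (hα : 0 ≤ α) (hβ : 0 < β)
    (hV : ∀ x ∈ Icc 0 K, ∀ ω,
      IsDoublyReflected K x (fun t => freeProcess J L B t ω) (fun t => V x t ω))
    {x : ℝ} (hx : x ∈ Icc 0 K) (i j : Fin d) {ρ : Ω → ℝ≥0∞}
    (hρ : ρ = fun ω => exitTime K fun t => x + freeProcess J L B t ω) :
    ∫⁻ ω in {ω | ρ ω < T ω}, payoff α j (V x (T ω) ω) (J (T ω) ω) ∂(startAt P J i)
      = ∫⁻ ω in {ω | ρ ω < T ω}, value P J L B T K α j (V x (ρ ω).toNNReal ω)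
          (J (ρ ω).toNNReal ω) ∂(startAt P J i) := by
  have mρ : Measurable ρ := hρ ▸ h.ingredients.exitTime K x
  have m1 : MeasurableSet {ω | ρ ω < T ω} :=
    measurableSet_lt mρ h.clock_measurable.coe_nnreal_ennreal
  have e : (startAt P J i).restrict {ω | ρ ω < T ω}
      = (P {ω | J 0 ω = i})⁻¹ • P.restrict {ω | J 0 ω = i ∧ ρ ω < T ω} := by
    rw [startAt, ProbabilityTheory.cond, Measure.restrict_smul, Measure.restrict_restrict m1,
      inter_comm]
    rfl
  rw [e, lintegral_smul_measure, lintegral_smul_measure, h.strong_markov hα hβ hV hx i j hρ]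

theorem IsModel.value_decomposition [IsProbabilityMeasure P] (h : IsModel P Q β J L B T)
    (hK : 0 < K) (hα : 0 ≤ α) (hβ : 0 < β)
    (hV : ∀ x ∈ Icc 0 K, ∀ ω,
      IsDoublyReflected K x (fun t => freeProcess J L B t ω) (fun t => V x t ω))
    {x : ℝ} (hx : x ∈ Icc 0 K) (i j : Fin d) :
    value P J L B T K α j x i
      = ∑ k, (value P J L B T K α j 0 k * (startAt P J i)
            {ω | dropTime (freeProcess J L B · ω) x
              ≤ min (exceedTime (freeProcess J L B · ω) (K - x)) (T ω) ∧
              J (dropTime (freeProcess J L B · ω) x).toNNReal ω = k}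
          + value P J L B T K α j K k * (startAt P J i)
            {ω | exceedTime (freeProcess J L B · ω) (K - x)
              ≤ min (dropTime (freeProcess J L B · ω) x) (T ω) ∧
              J (exceedTime (freeProcess J L B · ω) (K - x)).toNNReal ω = k})
        + ∫⁻ ω in {ω | (T ω : ℝ≥0∞) ≤ min (dropTime (freeProcess J L B · ω) x)
            (exceedTime (freeProcess J L B · ω) (K - x))},
            payoff α j (x + freeProcess J L B (T ω) ω) (J (T ω) ω) ∂(startAt P J i) := by
  classical
  have hi := h.ingredients
  set μ := startAt P J i
  set ρ : Ω → ℝ≥0∞ := fun ω => exitTime K fun t => x + freeProcess J L B t ω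
  have mρ : Measurable ρ := hi.exitTime K x
  have mT : Measurable fun ω => (T ω : ℝ≥0∞) := h.clock_measurable.coe_nnreal_ennreal
  have mσ := hi.dropTime x
  have mτ := hi.exceedTime (K - x)
  have m1 : MeasurableSet {ω | ρ ω < T ω} := measurableSet_lt mρ mT
  have hne : ∀ᵐ ω ∂μ, (T ω : ℝ≥0∞) ≠ ρ ω :=
    (cond_absolutelyContinuous (μ := P) (s := {ω | J 0 ω = i})).ae_le (h.clock_ne_exitTime x)
  have mA : ∀ k, MeasurableSet {ω | dropTime (freeProcess J L B · ω) x
      ≤ min (exceedTime (freeProcess J L B · ω) (K - x)) (T ω) ∧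
        J (dropTime (freeProcess J L B · ω) x).toNNReal ω = k} := fun k =>
    (measurableSet_le mσ (mτ.min mT)).inter
      (measurableSet_eq_fun (hi.chain_at mσ.ennreal_toNNReal) measurable_const)
  have mA' : ∀ k, MeasurableSet {ω | exceedTime (freeProcess J L B · ω) (K - x)
      ≤ min (dropTime (freeProcess J L B · ω) x) (T ω) ∧
        J (exceedTime (freeProcess J L B · ω) (K - x)).toNNReal ω = k} := fun k =>
    (measurableSet_le mτ (mσ.min mT)).inter
      (measurableSet_eq_fun (hi.chain_at mτ.ennreal_toNNReal) measurable_const)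
  -- Split according to whether the exit precedes the clock. The strong Markov property treats the
  -- first part; on the second the path is still free, ties being null.
  rw [value_eq hi hV hx, ← lintegral_add_compl _ m1, h.strong_markov_startAt hα hβ hV hx i j rfl]
  congr 1
  · rw [← lintegral_indicator m1]
    have e : ∀ᵐ ω ∂μ, {ω | ρ ω < T ω}.indicator (fun ω => value P J L B T K α j
          (V x (ρ ω).toNNReal ω) (J (ρ ω).toNNReal ω)) ω
        = ∑ k, ({ω | dropTime (freeProcess J L B · ω) x
              ≤ min (exceedTime (freeProcess J L B · ω) (K - x)) (T ω) ∧
              J (dropTime (freeProcess J L B · ω) x).toNNReal ω = k}.indicator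
                (fun _ => value P J L B T K α j 0 k) ω
          + {ω | exceedTime (freeProcess J L B · ω) (K - x)
              ≤ min (dropTime (freeProcess J L B · ω) x) (T ω) ∧
              J (exceedTime (freeProcess J L B · ω) (K - x)).toNNReal ω = k}.indicator
                (fun _ => value P J L B T K α j K k) ω) := by
      filter_upwards [hne] with ω hω
      simp only [indicator_apply, mem_ofPred_eq]
      exact exit_decomposition hK hx (freePath_zero (hi.chain_cadlag ω))
        (hi.freeProcess_rightContinuous ω) (h.freeProcess_no_drop ω) (hV x hx ω)
        (fun t => J t ω) (value P J L B T K α j) hω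
    refine (lintegral_congr_ae e).trans ((lintegral_finsetSum _ fun k _ => ?_).trans
      (Finset.sum_congr rfl fun k _ => ?_))
    · exact (measurable_const.indicator (mA k)).add (measurable_const.indicator (mA' k))
    rw [lintegral_add_left (measurable_const.indicator (mA k)),
      lintegral_indicator_const (mA k), lintegral_indicator_const (mA' k)]
  · have e : {ω | (T ω : ℝ≥0∞) ≤ min (dropTime (freeProcess J L B · ω) x)
        (exceedTime (freeProcess J L B · ω) (K - x))} = {ω | ρ ω < T ω}ᶜ := by
      ext ω
      simp only [mem_ofPred_eq, mem_compl_iff, not_lt, ρ, exitTime_eq_min]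
    rw [e]
    refine setLIntegral_congr_fun_ae m1.compl ?_
    filter_upwards [hne] with ω hω hω'
    have hlt : T ω < ρ ω := lt_of_le_of_ne (not_lt.1 hω') hω
    rw [eq_of_lt_exitTime (hV x hx ω) hlt]

end Decomposition

/-! ### From extended non-negative integrals to the matrix entries -/

section Matrices

variable {d : ℕ} {Ω : Type*} [mΩ : MeasurableSpace Ω] {P : Measure Ω}
  {Q : Matrix (Fin d) (Fin d) ℝ} {α β K : ℝ} {J : ℝ≥0 → Ω → Fin d} {L : Fin d → ℝ≥0 → Ω → ℝ}
  {B : ℕ → Fin d → Fin d → Ω → ℝ} {T : Ω → ℝ≥0} {V : ℝ → ℝ≥0 → Ω → ℝ}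

theorem IsModel.chi_apply (h : IsModel P Q β J L B T)
    (hV : ∀ x ∈ Icc 0 K, ∀ ω,
      IsDoublyReflected K x (fun t => freeProcess J L B t ω) (fun t => V x t ω))
    {v : ℝ} (hv : v ∈ Icc 0 K) (k j : Fin d) :
    chi P J T α (V v) k j = (value P J L B T K α j v k).toReal := by
  have hi := h.ingredients
  have m1 : MeasurableSet {ω | J (T ω) ω = j} :=
    measurableSet_eq_fun (hi.chain_at h.clock_measurable) measurable_const
  have m2 : Measurable fun ω => Real.exp (-α * V v (T ω) ω) :=
    Real.measurable_exp.comp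
      (measurable_const.mul (hi.reflection_at (hV v hv) h.clock_measurable))
  rw [value_eq hi hV hv, chi, Matrix.of_apply, integral_eq_lintegral_of_nonneg_ae
    (ae_of_all _ fun ω => indicator_nonneg (fun _ _ => (Real.exp_pos _).le) ω)
    (m2.indicator m1).aestronglyMeasurable]
  congr 1
  refine lintegral_congr fun ω => ?_
  by_cases hω : J (T ω) ω = j <;> simp [payoff, indicator, hω]

/-- The prefactor `exp (-α * x)` merges with `exp (-α * Y)` into the reward at level `x + Y`. -/
theorem IsModel.deltaStar_apply (h : IsModel P Q β J L B T) (x : ℝ) (i j : Fin d) :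
    deltaStar P J T (freeProcess J L B) α K x i j
      = (∫⁻ ω in {ω | (T ω : ℝ≥0∞) ≤ min (dropTime (freeProcess J L B · ω) x)
            (exceedTime (freeProcess J L B · ω) (K - x))},
            payoff α j (x + freeProcess J L B (T ω) ω) (J (T ω) ω) ∂(startAt P J i)).toReal := by
  have hi := h.ingredients
  have m0 : MeasurableSet {ω | (T ω : ℝ≥0∞) ≤ min (dropTime (freeProcess J L B · ω) x)
      (exceedTime (freeProcess J L B · ω) (K - x))} :=
    measurableSet_le h.clock_measurable.coe_nnreal_ennreal
      ((hi.dropTime x).min (hi.exceedTime (K - x)))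
  have m1 : MeasurableSet {ω | (T ω : ℝ≥0∞) ≤ min (dropTime (freeProcess J L B · ω) x)
      (exceedTime (freeProcess J L B · ω) (K - x)) ∧ J (T ω) ω = j} :=
    m0.inter (measurableSet_eq_fun (hi.chain_at h.clock_measurable) measurable_const)
  have m2 : Measurable fun ω => Real.exp (-α * freeProcess J L B (T ω) ω) :=
    Real.measurable_exp.comp (measurable_const.mul (hi.freeProcess_at h.clock_measurable))
  rw [deltaStar, Matrix.of_apply, ← integral_const_mul, integral_eq_lintegral_of_nonneg_ae
    (ae_of_all _ fun ω => mul_nonneg (Real.exp_pos _).le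
      (indicator_nonneg (fun _ _ => (Real.exp_pos _).le) ω))
    ((m2.indicator m1).const_mul _).aestronglyMeasurable, ← lintegral_indicator m0]
  congr 1
  refine lintegral_congr fun ω => ?_
  simp only [indicator_apply, mem_ofPred_eq, payoff]
  split_ifs with h1 h2 h3 h3
  · rw [← Real.exp_add, ← mul_add]
  · exact absurd h1.2 h3
  · exact absurd h1.1 ‹_›
  · exact absurd ⟨‹_›, ‹_›⟩ h1
  · rw [mul_zero, ENNReal.ofReal_zero]
  · rw [mul_zero, ENNReal.ofReal_zero]

end Matrices

end MAPQueue

open MAPQueue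

theorem mainTheorem5 {Ω : Type*} [MeasurableSpace Ω] (P : Measure Ω) [IsProbabilityMeasure P]
    {d : ℕ} (Q : Matrix (Fin d) (Fin d) ℝ) (K α β : ℝ) (hK : 0 < K) (hα : 0 ≤ α) (hβ : 0 < β)
    (J : ℝ≥0 → Ω → Fin d) (L : Fin d → ℝ≥0 → Ω → ℝ) (B : ℕ → Fin d → Fin d → Ω → ℝ)
    (T : Ω → ℝ≥0) (hmodel : IsModel P Q β J L B T)
    (V : ℝ → ℝ≥0 → Ω → ℝ)
    (hV : ∀ x ∈ Icc 0 K, ∀ ω,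
      IsDoublyReflected K x (fun t => freeProcess J L B t ω) (fun t => V x t ω))
    (x : ℝ) (hx : x ∈ Icc 0 K) :
    chi P J T α (V x)
      = deltaMinus P J T (freeProcess J L B) x (K - x) * chi P J T α (V 0)
        + deltaPlus P J T (freeProcess J L B) x (K - x) * chi P J T α (V K)
        + deltaStar P J T (freeProcess J L B) α K x := by
  have hi := hmodel.ingredients
  have h0 : (0 : ℝ) ∈ Icc 0 K := ⟨le_rfl, hK.le⟩
  have hKK : K ∈ Icc 0 K := ⟨hK.le, le_rfl⟩
  ext i j
  have : IsProbabilityMeasure (startAt P J i) := cond_isProbabilityMeasure (hmodel.start i)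
  -- Rewards are at most `1`, so every term is finite and `toReal` respects the sums.
  have hfin : ∀ {v : ℝ}, v ∈ Icc 0 K → ∀ k, value P J L B T K α j v k ≠ ∞ := fun hv k =>
    ((value_le_one hi hα hV hv j k).trans_lt ENNReal.one_lt_top).ne
  have key := hmodel.value_decomposition hK hα hβ hV hx i j
  have hx' := hfin hx i
  rw [key] at hx'
  have hs := ENNReal.add_ne_top.1 hx'
  rw [Matrix.add_apply, Matrix.add_apply, Matrix.mul_apply, Matrix.mul_apply,
    hmodel.chi_apply hV hx, key, ENNReal.toReal_add hs.1 hs.2, hmodel.deltaStar_apply,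
    ENNReal.toReal_sum fun k hk => ENNReal.sum_ne_top.1 hs.1 k hk, ← Finset.sum_add_distrib]
  congr 1
  refine Finset.sum_congr rfl fun k _ => ?_
  rw [ENNReal.toReal_add (ENNReal.mul_ne_top (hfin h0 k) (measure_ne_top _ _))
    (ENNReal.mul_ne_top (hfin hKK k) (measure_ne_top _ _)), ENNReal.toReal_mul,
    ENNReal.toReal_mul, hmodel.chi_apply hV h0, hmodel.chi_apply hV hKK, mul_comm,
    mul_comm (ENNReal.toReal (value P J L B T K α j K k))]
  rfl
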